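/- Let $G$ be a compact connected Lie group with Lie algebra $\mathfrak g$, let $\langle\cdot,\cdot\rangle$ be an $\mathrm{Ad}$-invariant inner product on $\mathfrak g$, and let $G\hookrightarrow G_{\mathbb C}$ be the complexification of $G$ (a connected complex Lie group with Lie algebra $\mathfrak g_{\mathbb C}=\mathfrak g\oplus i\mathfrak g$ in which $G$ is a maximal compact subgroup). Identify $T^*G\cong G\times\mathfrak g$ by left translations and the inner product, and $T_{(x,y)}(T^*G)\cong\mathfrak g\oplus\mathfrak g$, so that the canonical symplectic form is $$\omega_{(x,y)}\big((U,V),(W,Z)\big)=\langle U,Z\rangle-\langle V,W\rangle+\langle y,[U,W]\rangle ;$$ the Hamiltonian vector field $X_g$ of a function $g$ is given by $\omega(X_g,\cdot)=dg$, and $\phi^t_{X_g}$ is its flow. Let $\mathbb C^+=\{\tau\in\mathbb C:\operatorname{Im}\tau>0\}$. Let $h:\mathfrak g\to\mathbb R$ be smooth and $\mathrm{Ad}$-invariant with everywhere positive definite Hessian, and let $u_h:\mathfrak g\to\mathfrak g$ be its gradient. Let $\mathfrak t\subset\mathfrak g$ be a Cartan subalgebra, let $F:\mathfrak g\to\mathfrak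 g$ be linear and self-adjoint with $\operatorname{im}F\subset\mathfrak t$, $F|_{\mathfrak t^\perp}=0$ and $F|_{\mathfrak t}>0$, and let $f(y)=\frac12\langle y,Fy\rangle$. Regard $h$ and $f$ as functions on $T^*G$ depending only on $y$. For $\tau,\sigma\in\mathbb C$ put $$A_{\tau,\sigma}:T^*G\to G_{\mathbb C},\qquad A_{\tau,\sigma}(x,y)=x\,e^{\tau u_h(y)}e^{\sigma Fy}.$$ A family of complex subspaces of a finite-dimensional complex vector space is called holomorphic in its parameters if it is locally spanned by a pointwise linearly independent frame depending holomorphically on the parameters. "Analytic continuation" of a family of complex subspaces of the fibres of $T(T^*G)\otimes\mathbb C$ means an extension, at each point of $T^*G$, from real parameters to a holomorphic family over all complex parameters. Then the Hamiltonian flows of $h$ and $f$ exist for all real times, and the following holds. 1. Let $\mathcal P_{0,0}=\ker D\pi\otimes\mathbb C$ be the vertical polarization, $\pi:T^*G\to G$. The family $$\mathcal P_{t,s}=\big(\phi^{-s}_{X_f}\circ\phi^{-t}_{X_h}\big)_*\mathcal P_{0,0},\qquad (t,s)\in\mathbb R^2,$$ has a unique analytic continuation to $(t,s)\in\mathbb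 C^2$. For $\tau,\sigma\in\mathbb C$, the polarization $\mathcal P_{\tau,\sigma}$ is the value of this continuation at $t=\bar\tau$, $s=\bar\sigma$. 2. For every $\tau\in\mathbb C^+$ the family of pull-backs $$A_{\tau,s}^*\,T^{(1,0)}G_{\mathbb C}=\{v\in T(T^*G)\otimes\mathbb C:\ DA_{\tau,s}(v)\in T^{(1,0)}G_{\mathbb C}\},\qquad s\in\mathbb R,$$ of the holomorphic tangent space of $G_{\mathbb C}$ (for its standard complex structure) has a unique analytic continuation to $s\in\mathbb C$, and for every $\sigma\in\mathbb C^+\cup\mathbb R$ the value of this continuation at $s=\bar\sigma$ is $\mathcal P_{\tau,\sigma}$. -/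

import Mathlib

open scoped Manifold ContDiff TensorProduct Topology ComplexConjugate

noncomputable section

namespace CotangentPolarization

/-! ### The Lie algebra, the adjoint action and the cotangent bundle -/

section Real

variable (E : Type*) [NormedAddCommGroup E] [NormedSpace ℝ E]
  (G : Type*) [TopologicalSpace G] [ChartedSpace E G] [Group G]

/-- The Lie algebra `𝔤 = T₁G` of a real Lie group modelled on `E`. Its elements are those of Mathlib's
`GroupLieAlgebra 𝓘(ℝ, E) G = TangentSpace 𝓘(ℝ, E) (1 : G)`, which is the vector space `E`; here it
also carries the norm of `E`, which is used only for the topology and smooth structure of this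
finite-dimensional space. -/
@[nolint unusedArguments]
def LieAlg (E : Type*) [NormedAddCommGroup E] [NormedSpace ℝ E]
    (G : Type*) [TopologicalSpace G] [ChartedSpace E G] [Group G] : Type _ := E

instance instNormedAddCommGroupLieAlg : NormedAddCommGroup (LieAlg E G) :=
  inferInstanceAs (NormedAddCommGroup E)

instance instNormedSpaceLieAlg : NormedSpace ℝ (LieAlg E G) :=
  inferInstanceAs (NormedSpace ℝ E)

instance instFiniteDimensionalLieAlg [FiniteDimensional ℝ E] : FiniteDimensional ℝ (LieAlg E G) :=
  inferInstanceAs (FiniteDimensional ℝ E)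

/-- Mathlib's bracket on `T₁G`, i.e. the bracket of left-invariant vector fields. -/
instance instBracketLieAlg : Bracket (LieAlg E G) (LieAlg E G) where
  bracket := (Bracket.bracket :
    GroupLieAlgebra 𝓘(ℝ, E) G → GroupLieAlgebra 𝓘(ℝ, E) G → GroupLieAlgebra 𝓘(ℝ, E) G)

theorem lieGroup_minSmoothness [LieGroup 𝓘(ℝ, E) ∞ G] :
    LieGroup 𝓘(ℝ, E) (minSmoothness ℝ 3) G :=
  LieGroup.of_le (n := ∞) (by
    rw [minSmoothness_of_isRCLikeNormedField]
    exact ENat.LEInfty.out)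

/-- Mathlib's Lie ring structure on `T₁G`. -/
instance instLieRingLieAlg [FiniteDimensional ℝ E] [LieGroup 𝓘(ℝ, E) ∞ G] :
    LieRing (LieAlg E G) :=
  haveI : CompleteSpace E := FiniteDimensional.complete ℝ E
  haveI := lieGroup_minSmoothness E G
  { add_lie := fun U V W => LieRing.add_lie (L := GroupLieAlgebra 𝓘(ℝ, E) G) U V W
    lie_add := fun U V W => LieRing.lie_add (L := GroupLieAlgebra 𝓘(ℝ, E) G) U V W
    lie_self := fun U => LieRing.lie_self (L := GroupLieAlgebra 𝓘(ℝ, E) G) U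
    leibniz_lie := fun U V W => LieRing.leibniz_lie (L := GroupLieAlgebra 𝓘(ℝ, E) G) U V W }

/-- Mathlib's Lie algebra structure on `T₁G`. -/
instance instLieAlgebraLieAlg [FiniteDimensional ℝ E] [LieGroup 𝓘(ℝ, E) ∞ G] :
    LieAlgebra ℝ (LieAlg E G) :=
  haveI : CompleteSpace E := FiniteDimensional.complete ℝ E
  haveI := lieGroup_minSmoothness E G
  { lie_smul := fun c U V => LieAlgebra.lie_smul (L := GroupLieAlgebra 𝓘(ℝ, E) G) c U V }

/-- `T*G`, identified with `G × 𝔤` by left translations and the inner product of `𝔤`. -/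
abbrev CotG : Type _ := G × LieAlg E G

/-- The manifold structure of `T*G = G × 𝔤`. -/
abbrev cotModel : ModelWithCorners ℝ (E × LieAlg E G) (ModelProd E (LieAlg E G)) :=
  (𝓘(ℝ, E)).prod 𝓘(ℝ, LieAlg E G)

/-- The tangent space of `T*G` at `p`. -/
abbrev TCotG (p : CotG E G) : Type _ := TangentSpace (cotModel E G) p

variable {G}

/-- The adjoint action of `g` on `𝔤`: the derivative at `1` of `x ↦ g x g⁻¹`. -/
def Ad (g : G) (U : LieAlg E G) : LieAlg E G :=
  mfderiv 𝓘(ℝ, E) 𝓘(ℝ, E) (fun x : G => g * x * g⁻¹) 1 U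

/-- The left trivialization `T_x G → 𝔤` (the Maurer-Cartan form), the derivative at `x` of
`z ↦ x⁻¹ z`. -/
def leftTriv (x : G) (v : TangentSpace 𝓘(ℝ, E) x) : LieAlg E G :=
  mfderiv 𝓘(ℝ, E) 𝓘(ℝ, E) (fun z : G => x⁻¹ * z) x v

variable {E}

/-- An `Ad`-invariant inner product on `𝔤`. -/
structure IsAdInvariantInner (B : LinearMap.BilinForm ℝ (LieAlg E G)) : Prop where
  symm : ∀ U V, B U V = B V U
  pos : ∀ U, U ≠ 0 → 0 < B U U
  ad_invariant : ∀ (g : G) (U V), B (Ad E g U) (Ad E g V) = B U V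

/-- The canonical symplectic form of `T*G` in the left trivialization:
`ω_(x,y)((U,V),(W,Z)) = ⟨U,Z⟩ - ⟨V,W⟩ + ⟨y,[U,W]⟩`. -/
def omega (B : LinearMap.BilinForm ℝ (LieAlg E G)) (p : CotG E G) (v w : TCotG E G p) : ℝ :=
  B (leftTriv E p.1 v.1) w.2 - B v.2 (leftTriv E p.1 w.1)
    + B p.2 ⁅leftTriv E p.1 v.1, leftTriv E p.1 w.1⁆

theorem IsAdInvariantInner.nondegenerate {B : LinearMap.BilinForm ℝ (LieAlg E G)}
    (hB : IsAdInvariantInner B) : B.Nondegenerate := by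
  refine ⟨fun U hU => ?_, fun U hU => ?_⟩
  · by_contra hne
    exact absurd (hU U) (hB.pos U hne).ne'
  · by_contra hne
    exact absurd (hU U) (hB.pos U hne).ne'

/-- The gradient `u_g` of `g : 𝔤 → ℝ`: `⟨u_g(y), A⟩ = dg_y(A)`. -/
def gradient [FiniteDimensional ℝ E] {B : LinearMap.BilinForm ℝ (LieAlg E G)}
    (hB : IsAdInvariantInner B) (g : LieAlg E G → ℝ) (y : LieAlg E G) : LieAlg E G :=
  (B.toDual hB.nondegenerate).symm (fderiv ℝ g y).toLinearMap

/-- The functions on `𝔤` defining the `G × G`-invariant Hamiltonians: smooth, `Ad`-invariant, with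
everywhere positive definite Hessian. -/
structure IsInvariantConvex (h : LieAlg E G → ℝ) : Prop where
  smooth : ContDiff ℝ ∞ h
  ad_invariant : ∀ (g : G) (y), h (Ad E g y) = h y
  hessian_pos : ∀ y A, A ≠ 0 → 0 < fderiv ℝ (fderiv ℝ h) y A A

/-- The self-adjoint maps `F : 𝔤 → 𝔤` with image in `𝔱`, zero on `𝔱^⊥` and positive definite
on `𝔱`. -/
structure IsTorusForm (B : LinearMap.BilinForm ℝ (LieAlg E G)) (𝔱 : Submodule ℝ (LieAlg E G))
    (F : LieAlg E G →ₗ[ℝ] LieAlg E G) : Prop where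
  self_adjoint : ∀ U V, B (F U) V = B U (F V)
  image_subset : ∀ U, F U ∈ 𝔱
  zero_on_orthogonal : ∀ U, (∀ A ∈ 𝔱, B U A = 0) → F U = 0
  pos : ∀ A ∈ 𝔱, A ≠ 0 → 0 < B A (F A)

/-- `φ` is the (complete) Hamiltonian flow on `T*G` of the function `H`: the curves `t ↦ φ t p` are
the integral curves, starting at `p`, of the vector field `X_H` with `ω(X_H, ·) = dH`. -/
def IsHamiltonianFlow (B : LinearMap.BilinForm ℝ (LieAlg E G)) (H : CotG E G → ℝ)
    (φ : ℝ → CotG E G → CotG E G) : Prop :=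
  ∃ X : (p : CotG E G) → TCotG E G p,
    (∀ p (v : TCotG E G p), omega B p (X p) v = mfderiv (cotModel E G) 𝓘(ℝ, ℝ) H p v) ∧
    ∀ p, φ 0 p = p ∧ IsMIntegralCurve (I := cotModel E G) (fun t => φ t p) X

/-! ### Distributions in the complexified tangent bundle of `T*G` -/

variable (E G)

/-- A family of complex subspaces of the fibres of `T(T*G) ⊗ ℂ`. -/
abbrev ComplexDistribution : Type _ := (p : CotG E G) → Submodule ℂ (ℂ ⊗[ℝ] TCotG E G p)

/-- The vertical polarization `Ker Dπ` (complexified), where `π : T*G → G` is the projection. -/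
def vertical : ComplexDistribution E G := fun p =>
  LinearMap.ker ((mfderiv (cotModel E G) 𝓘(ℝ, E) (Prod.fst : CotG E G → G) p).toLinearMap.baseChange ℂ)

variable {E G}

/-- `Q` is the push-forward of `P` by `φ : T*G → T*G`: `Q_{φ(p)} = Dφ_p (P_p)`. For bijective
`φ` this determines `Q`. -/
def IsPushforward (φ : CotG E G → CotG E G) (P Q : ComplexDistribution E G) : Prop :=
  ∀ p, Q (φ p) =
    (P p).map ((mfderiv (cotModel E G) (cotModel E G) φ p).toLinearMap.baseChange ℂ)

end Real

/-! ### Holomorphic families of subspaces -/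

/-- A family `z ↦ P z` of subspaces of a finite-dimensional complex vector space is holomorphic if
near each parameter it is spanned by a frame (pointwise linearly independent) that depends
holomorphically on the parameter. Holomorphy of a vector-valued map is tested on linear
functionals. -/
def IsHolomorphicFamily {Z W : Type*} [NormedAddCommGroup Z] [NormedSpace ℂ Z]
    [AddCommGroup W] [Module ℂ W] (P : Z → Submodule ℂ W) : Prop :=
  ∀ z₀ : Z, ∃ (k : ℕ) (e : Fin k → Z → W),
    (∀ (j : Fin k) (l : Module.Dual ℂ W), AnalyticAt ℂ (fun z => l (e j z)) z₀) ∧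
    ∀ᶠ z in 𝓝 z₀, LinearIndependent ℂ (fun j => e j z) ∧
      Submodule.span ℂ (Set.range fun j => e j z) = P z

/-! ### The complexified group -/

section Complexification

variable {EC : Type*} [NormedAddCommGroup EC] [NormedSpace ℂ EC]
  {GC : Type*} [TopologicalSpace GC] [ChartedSpace EC GC]

/-- The (real) tangent space of the complex manifold `GC` at `q`. -/
abbrev RTan (EC : Type*) [NormedAddCommGroup EC] [NormedSpace ℂ EC]
    {GC : Type*} [TopologicalSpace GC] [ChartedSpace EC GC] (q : GC) : Type _ :=
  TangentSpace 𝓘(ℝ, EC) q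

/-- Multiplication by `c : ℂ` on the tangent space of a complex manifold; for `c = i` this is
the standard complex structure. -/
def cmul (c : ℂ) (q : GC) : RTan EC q →ₗ[ℝ] RTan EC q :=
  (c • (LinearMap.id : EC →ₗ[ℝ] EC) : EC →ₗ[ℝ] EC)

/-- The holomorphic tangent space `T^{(1,0)}` at `q`: the `+i`-eigenspace of the complex-linear
extension of the standard complex structure. -/
def T10 (q : GC) : Submodule ℂ (ℂ ⊗[ℝ] RTan EC q) :=
  Module.End.eigenspace ((cmul (EC := EC) Complex.I q).baseChange ℂ) Complex.I

variable [Group GC]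

/-- `γ` is the one-parameter subgroup with velocity `X` at the identity. -/
def IsOneParameterSubgroup (γ : ℝ → GC) (X : RTan EC (1 : GC)) : Prop :=
  (∀ a b, γ (a + b) = γ a * γ b) ∧
    HasMFDerivAt 𝓘(ℝ, ℝ) 𝓘(ℝ, EC) γ 0
      (ContinuousLinearMap.toSpanSingleton ℝ (X : EC) : ℝ →L[ℝ] EC)

open Classical in
/-- The exponential map: `e^X = γ(1)` for the one-parameter subgroup `γ` with velocity `X`. -/
def lieExp (X : RTan EC (1 : GC)) : GC :=
  if hX : ∃ γ : ℝ → GC, IsOneParameterSubgroup γ X then hX.choose 1 else 1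

variable {E : Type*} [NormedAddCommGroup E] [NormedSpace ℝ E]
  {G : Type*} [TopologicalSpace G] [ChartedSpace E G] [Group G]

variable (EC E) in
/-- The derivative `𝔤 → T₁(GC)` of a homomorphism `G → GC` at the identity. -/
def dHom (ι : G →* GC) (U : LieAlg E G) : RTan EC (1 : GC) :=
  mfderiv 𝓘(ℝ, E) 𝓘(ℝ, EC) ι 1 U

variable (EC E) in
/-- `ι : G → GC` is the complexification of the compact connected Lie group `G`: `GC` is a connected
complex Lie group, `ι` is an injective smooth homomorphism onto a maximal compact subgroup, and
the Lie algebra of `GC` is `𝔤 ⊗ ℂ = 𝔤 ⊕ i𝔤`. -/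
structure IsComplexification (ι : G →* GC) : Prop where
  lie_group : LieGroup 𝓘(ℂ, EC) ω GC
  connected : ConnectedSpace GC
  smooth : ContMDiff 𝓘(ℝ, E) 𝓘(ℝ, EC) ∞ ι
  injective : Function.Injective ι
  lie_algebra : ∀ Z : RTan EC (1 : GC), ∃! UV : LieAlg E G × LieAlg E G,
    Z = dHom EC E ι UV.1 + cmul Complex.I 1 (dHom EC E ι UV.2)
  maximal_compact : ∀ K : Subgroup GC, IsCompact (K : Set GC) → ι.range ≤ K → K = ι.range

variable (EC) in
/-- The map `A_{τ,σ}(x,y) = x e^{τ u_h(y)} e^{σ F y}` from `T*G` to `GC`, where `u = u_h`. -/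
def mapA (ι : G →* GC) (u : LieAlg E G → LieAlg E G) (F : LieAlg E G →ₗ[ℝ] LieAlg E G)
    (τ σ : ℂ) (p : CotG E G) : GC :=
  ι p.1 * lieExp (cmul τ 1 (dHom EC E ι (u p.2))) * lieExp (cmul σ 1 (dHom EC E ι (F p.2)))

variable (EC) in
/-- The pull-back of `T^{(1,0)} GC` by a smooth map `A : T*G → GC`, i.e. the complex tangent
vectors of `T*G` that `DA` maps into `T^{(1,0)} GC`. -/
def pullbackT10 (A : CotG E G → GC) : ComplexDistribution E G := fun p =>
  (T10 (EC := EC) (A p)).comap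
    ((mfderiv (cotModel E G) 𝓘(ℝ, EC) A p).toLinearMap.baseChange ℂ)

variable (EC) in
/-- `Q` is an analytic continuation in `s` from `ℝ` to `ℂ`, pointwise on `T*G`, of the pull-backs of
`T^{(1,0)} GC` by `A_{τ,s}`. -/
def ContinuesPullback (ι : G →* GC) (u : LieAlg E G → LieAlg E G)
    (F : LieAlg E G →ₗ[ℝ] LieAlg E G) (τ : ℂ) (Q : ℂ → ComplexDistribution E G) : Prop :=
  (∀ p, IsHolomorphicFamily fun z => Q z p) ∧
    ∀ s : ℝ, Q s = pullbackT10 EC (mapA EC ι u F τ s)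

end Complexification

/-- `P` is an analytic continuation in `(t,s)` from `ℝ × ℝ` to `ℂ × ℂ`, pointwise on `T*G`, of the
push-forwards of the vertical polarization by `φ_f^{-s} ∘ φ_h^{-t}`. -/
def ContinuesFlow {E : Type*} [NormedAddCommGroup E] [NormedSpace ℝ E]
    {G : Type*} [TopologicalSpace G] [ChartedSpace E G] [Group G]
    (φh φf : ℝ → CotG E G → CotG E G) (P : ℂ × ℂ → ComplexDistribution E G) : Prop :=
  (∀ p, IsHolomorphicFamily fun z => P z p) ∧
    ∀ t s : ℝ, IsPushforward (φf (-s) ∘ φh (-t)) (vertical E G) (P ((t : ℂ), (s : ℂ)))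

end CotangentPolarization

end

/-! Write `u` for the gradient of `h` and translate everything to the identity. Up to right
translation and the adjoint action of `x`, the derivative of `A_{z,w}` at `(x,y)` is `(U,V) ↦ U +
S(z,w) V`, where `S(z,w) = z ((e^{z ad u} - 1)/(z ad u)) Du + w e^{z ad u} F`, with `u = u(y)` and
`Du` its derivative at `y`. This operator (`slope`) is entire in `(z,w)`. Hence the spaces `U +
S(z,w) V = 0` inside `𝔤_ℂ ⊕ 𝔤_ℂ` (`contDist`) are graphs over the second factor and form a
holomorphic family over `ℂ × ℂ`. Both families of the theorem are values of it.

Flows. The two Hamiltonian flows are `(x e^{t v(y)}, Ad(e^{-t v(y)}) y)` with `v = u` or `v = F`,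
because `v` is constant along these curves: `[y, u(y)] = 0` by invariance of `h`, and `F` has
abelian image and is self-adjoint. Equivariance of `u` shows that `π ∘ φ_h^t ∘ φ_f^s` sends `(x,y)`
to `x e^{t u(y)} e^{s F y}`, which is `A_{t,s}` for real parameters. Pushing the vertical
distribution forward by the inverse map amounts to taking the kernel of the derivative of this
composite, so `isPushforward_gradFlow` gives `contDist` at `(t,s)`.

Pull-backs. Let `L` be the translated derivative of `A_{z,w}`. A vector `a + i b` goes into
`T^{(1,0)}` exactly when `L a = i L b`. Conjugating this equation gives `L̄ a + i L̄ b = 0`, and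
`L̄` is the same expression at the conjugate parameters because `ad` and `F` are real. So
`pullbackT10_mapA` gives `contDist` at `(z̄, w̄)`, which is where the bars in the statement come
from. For fixed `τ` the pull-backs therefore continue to `contDist` along the line with first
parameter `τ̄`.

Uniqueness is an identity theorem for families of subspaces (`eq_of_eq_on_real`): the frame of a
competing family satisfies the analytic equation of the graph near the real axis, hence everywhere,
and the ranks agree.

The formula for `S` rests on the derivative of the exponential map (`hasRightLogDerivAt_groupExp`)
and on `Ad(e^X) = e^{ad X}` (`IsOneParam.conjDeriv_eq_exp`), where `ad` is the antisymmetrized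
second derivative of the multiplication in a chart and agrees with the bracket of left-invariant
fields (`groupLieAlgebra_bracket_eq`). -/

noncomputable section

namespace CotangentPolarization

open Filter Set

/-! ### Manifold derivatives as maps between the model spaces -/

section ModelDeriv

variable {F : Type*} [NormedAddCommGroup F] [NormedSpace ℝ F] {K : Type*} [TopologicalSpace K]
  {J : ModelWithCorners ℝ F K} {M : Type*} [TopologicalSpace M] [ChartedSpace K M]
  {F' : Type*} [NormedAddCommGroup F'] [NormedSpace ℝ F'] {K' : Type*} [TopologicalSpace K']
  {J' : ModelWithCorners ℝ F' K'} {M' : Type*} [TopologicalSpace M'] [ChartedSpace K' M']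
  {F'' : Type*} [NormedAddCommGroup F''] [NormedSpace ℝ F''] {K'' : Type*} [TopologicalSpace K'']
  {J'' : ModelWithCorners ℝ F'' K''} {M'' : Type*} [TopologicalSpace M''] [ChartedSpace K'' M'']

variable (J J') in
/-- `HasMFDerivAt` with the derivative regarded as a map between the model vector spaces. -/
def HasModelDerivAt (f : M → M') (p : M) (f' : F →L[ℝ] F') : Prop := HasMFDerivAt J J' f p f'

variable (J J') in
/-- `mfderiv` regarded as a map between the model vector spaces. -/
def modelDeriv (f : M → M') (p : M) : F →L[ℝ] F' := mfderiv J J' f p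

theorem MDifferentiableAt.hasModelDerivAt {f : M → M'} {p : M} (h : MDifferentiableAt J J' f p) :
    HasModelDerivAt J J' f p (modelDeriv J J' f p) := h.hasMFDerivAt

namespace HasModelDerivAt

theorem mdifferentiableAt {f : M → M'} {p : M} {f' : F →L[ℝ] F'}
    (h : HasModelDerivAt J J' f p f') : MDifferentiableAt J J' f p :=
  HasMFDerivAt.mdifferentiableAt h

theorem modelDeriv_eq {f : M → M'} {p : M} {f' : F →L[ℝ] F'}
    (h : HasModelDerivAt J J' f p f') : modelDeriv J J' f p = f' := HasMFDerivAt.mfderiv h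

theorem unique {f : M → M'} {p : M} {f' f'' : F →L[ℝ] F'}
    (h : HasModelDerivAt J J' f p f') (h' : HasModelDerivAt J J' f p f'') : f' = f'' :=
  h.modelDeriv_eq.symm.trans h'.modelDeriv_eq

theorem comp {f : M → M'} {g : M' → M''} {p : M} {y : M'} {f' : F →L[ℝ] F'} {g' : F' →L[ℝ] F''}
    (hg : HasModelDerivAt J' J'' g y g') (hf : HasModelDerivAt J J' f p f') (hy : f p = y) :
    HasModelDerivAt J J'' (fun q => g (f q)) p (g'.comp f') := by
  subst hy
  exact HasMFDerivAt.comp p hg hf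

theorem congr_fun {f f₁ : M → M'} {p : M} {f' : F →L[ℝ] F'} (h : HasModelDerivAt J J' f p f')
    (h₁ : ∀ q, f₁ q = f q) : HasModelDerivAt J J' f₁ p f' := by
  rwa [show f₁ = f from funext h₁]

theorem congr_deriv {f : M → M'} {p : M} {f' f₁' : F →L[ℝ] F'} (h : HasModelDerivAt J J' f p f')
    (h₁ : f' = f₁') : HasModelDerivAt J J' f p f₁' := h₁ ▸ h

theorem prodMk {f : M → M'} {g : M → M''} {p : M} {f' : F →L[ℝ] F'} {g' : F →L[ℝ] F''}
    (hf : HasModelDerivAt J J' f p f') (hg : HasModelDerivAt J J'' g p g') :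
    HasModelDerivAt J (J'.prod J'') (fun q => (f q, g q)) p (f'.prod g') :=
  HasMFDerivAt.prodMk hf hg

theorem fst (p : M × M') :
    HasModelDerivAt (J.prod J') J (Prod.fst : M × M' → M) p (ContinuousLinearMap.fst ℝ F F') :=
  hasMFDerivAt_fst p

theorem snd (p : M × M') :
    HasModelDerivAt (J.prod J') J' (Prod.snd : M × M' → M') p (ContinuousLinearMap.snd ℝ F F') :=
  hasMFDerivAt_snd p

theorem id (p : M) : HasModelDerivAt J J (fun q : M => q) p (ContinuousLinearMap.id ℝ F) :=
  hasMFDerivAt_id p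

theorem const (c : M') (p : M) : HasModelDerivAt J J' (fun _ : M => c) p (0 : F →L[ℝ] F') :=
  hasMFDerivAt_const c p

end HasModelDerivAt

theorem hasModelDerivAt_iff_hasFDerivAt {f : F → F'} {p : F} {f' : F →L[ℝ] F'} :
    HasModelDerivAt 𝓘(ℝ, F) 𝓘(ℝ, F') f p f' ↔ HasFDerivAt f f' p :=
  hasMFDerivAt_iff_hasFDerivAt

end ModelDeriv

/-! ### Product rule, adjoint action and one-parameter subgroups. -/

section LieGroupCalculus

variable {E : Type*} [NormedAddCommGroup E] [NormedSpace ℝ E]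
  {H : Type*} [TopologicalSpace H] [ChartedSpace E H] [Group H]
  {F : Type*} [NormedAddCommGroup F] [NormedSpace ℝ F] {K : Type*} [TopologicalSpace K]
  {J : ModelWithCorners ℝ F K} {M : Type*} [TopologicalSpace M] [ChartedSpace K M]

/-- The derivative at `1` of the conjugation by `g`, as an operator on the model space. -/
def conjDeriv (g : H) : E →L[ℝ] E := modelDeriv 𝓘(ℝ, E) 𝓘(ℝ, E) (fun x : H => g * x * g⁻¹) 1

variable (J) in
/-- `f'` is the right logarithmic derivative of `f` at `p`. -/
def HasRightLogDerivAt (f : M → H) (p : M) (f' : F →L[ℝ] E) : Prop :=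
  HasModelDerivAt J 𝓘(ℝ, E) (fun q => f q * (f p)⁻¹) p f'

/-- `γ` is a one-parameter subgroup with velocity `X`. -/
def IsOneParam (γ : ℝ → H) (X : E) : Prop :=
  (∀ a b, γ (a + b) = γ a * γ b) ∧
    HasModelDerivAt 𝓘(ℝ, ℝ) 𝓘(ℝ, E) γ 0 (ContinuousLinearMap.toSpanSingleton ℝ X)

theorem IsOneParam.map_zero {γ : ℝ → H} {X : E} (h : IsOneParam γ X) : γ 0 = 1 := by
  have := h.1 0 0
  simpa using this

theorem IsOneParam.map_neg {γ : ℝ → H} {X : E} (h : IsOneParam γ X) (t : ℝ) :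
    γ (-t) = (γ t)⁻¹ := by
  rw [eq_inv_iff_mul_eq_one, ← h.1, neg_add_cancel, h.map_zero]

theorem conjDeriv_one : (conjDeriv (1 : H) : E →L[ℝ] E) = 1 :=
  ((HasModelDerivAt.id (J := 𝓘(ℝ, E)) (1 : H)).congr_fun
    (f₁ := fun x : H => 1 * x * 1⁻¹) (by simp)).modelDeriv_eq

theorem IsOneParam.comp_mul {γ : ℝ → H} {X : E} (h : IsOneParam γ X) (c : ℝ) :
    IsOneParam (fun t => γ (c * t)) (c • X) := by
  refine ⟨fun a b => by simp only [mul_add, h.1], ?_⟩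
  have h1 : HasModelDerivAt 𝓘(ℝ, ℝ) 𝓘(ℝ, ℝ) (fun t : ℝ => c * t) 0
      (c • ContinuousLinearMap.id ℝ ℝ) :=
    hasModelDerivAt_iff_hasFDerivAt.2 ((hasFDerivAt_id (𝕜 := ℝ) (0 : ℝ)).const_mul c)
  exact (h.2.comp h1 (by simp)).congr_deriv (by ext; simp)

theorem IsOneParam.hasModelDerivAt_sub {γ : ℝ → H} {X : E} (h : IsOneParam γ X) (t : ℝ) :
    HasModelDerivAt 𝓘(ℝ, ℝ) 𝓘(ℝ, E) (fun s => γ (s - t)) t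
      (ContinuousLinearMap.toSpanSingleton ℝ X) := by
  have h1 : HasModelDerivAt 𝓘(ℝ, ℝ) 𝓘(ℝ, ℝ) (fun s : ℝ => s - t) t (ContinuousLinearMap.id ℝ ℝ) :=
    hasModelDerivAt_iff_hasFDerivAt.2 ((hasFDerivAt_id (𝕜 := ℝ) t).sub_const t)
  exact (h.2.comp h1 (by simp)).congr_deriv (by ext; simp)

variable [LieGroup 𝓘(ℝ, E) ∞ H]

theorem hasModelDerivAt_mul_left (g x : H) :
    HasModelDerivAt 𝓘(ℝ, E) 𝓘(ℝ, E) (fun x : H => g * x) x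
      (modelDeriv 𝓘(ℝ, E) 𝓘(ℝ, E) (fun x : H => g * x) x) :=
  MDifferentiableAt.hasModelDerivAt
    ((contMDiff_mul_left (I := 𝓘(ℝ, E)) (n := ∞)).mdifferentiable (by simp) _)

theorem hasModelDerivAt_mul_right (g x : H) :
    HasModelDerivAt 𝓘(ℝ, E) 𝓘(ℝ, E) (fun x : H => x * g) x
      (modelDeriv 𝓘(ℝ, E) 𝓘(ℝ, E) (fun x : H => x * g) x) :=
  MDifferentiableAt.hasModelDerivAt
    ((contMDiff_mul_right (I := 𝓘(ℝ, E)) (n := ∞)).mdifferentiable (by simp) _)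

theorem hasModelDerivAt_conj (g : H) :
    HasModelDerivAt 𝓘(ℝ, E) 𝓘(ℝ, E) (fun x : H => g * x * g⁻¹) 1 (conjDeriv g : E →L[ℝ] E) :=
  MDifferentiableAt.hasModelDerivAt
    ((hasModelDerivAt_mul_right g⁻¹ _).comp (hasModelDerivAt_mul_left g 1) rfl).mdifferentiableAt

theorem HasModelDerivAt.conj {f : M → H} {p : M} {f' : F →L[ℝ] E} (a : H)
    (hf : HasModelDerivAt J 𝓘(ℝ, E) f p f') (hp : f p = 1) :
    HasModelDerivAt J 𝓘(ℝ, E) (fun q => a * f q * a⁻¹) p ((conjDeriv a).comp f') :=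
  (hasModelDerivAt_conj a).comp hf hp

/-- On each of the two axes through `(1,1)` the multiplication is the identity, and a linear map on
the product is determined by its restrictions to the axes. -/
theorem hasModelDerivAt_mul_one :
    HasModelDerivAt (𝓘(ℝ, E).prod 𝓘(ℝ, E)) 𝓘(ℝ, E) (fun x : H × H => x.1 * x.2) (1, 1)
      (ContinuousLinearMap.fst ℝ E E + ContinuousLinearMap.snd ℝ E E) := by
  have hd : MDifferentiableAt (𝓘(ℝ, E).prod 𝓘(ℝ, E)) 𝓘(ℝ, E) (fun x : H × H => x.1 * x.2) (1, 1) :=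
    (contMDiff_mul 𝓘(ℝ, E) ∞).mdifferentiable (by simp) _
  refine (MDifferentiableAt.hasModelDerivAt hd).congr_deriv ?_
  have h1 := (MDifferentiableAt.hasModelDerivAt hd).comp
    ((HasModelDerivAt.id (J := 𝓘(ℝ, E)) (1 : H)).prodMk
      (HasModelDerivAt.const (J' := 𝓘(ℝ, E)) (1 : H) (1 : H))) rfl
  have h2 := (MDifferentiableAt.hasModelDerivAt hd).comp
    ((HasModelDerivAt.const (J := 𝓘(ℝ, E)) (1 : H) (1 : H)).prodMk
      (HasModelDerivAt.id (J := 𝓘(ℝ, E)) (1 : H))) rfl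
  have e1 := h1.unique ((HasModelDerivAt.id (J := 𝓘(ℝ, E)) (1 : H)).congr_fun (by simp))
  have e2 := h2.unique ((HasModelDerivAt.id (J := 𝓘(ℝ, E)) (1 : H)).congr_fun (by simp))
  ext v
  · simpa using congrArg (fun L => L v) e1
  · simpa using congrArg (fun L => L v) e2

theorem HasModelDerivAt.mul_of_eq_one {f g : M → H} {p : M} {f' g' : F →L[ℝ] E}
    (hf : HasModelDerivAt J 𝓘(ℝ, E) f p f') (hg : HasModelDerivAt J 𝓘(ℝ, E) g p g')
    (hfp : f p = 1) (hgp : g p = 1) :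
    HasModelDerivAt J 𝓘(ℝ, E) (fun q => f q * g q) p (f' + g') :=
  (hasModelDerivAt_mul_one.comp (hf.prodMk hg) (by rw [hfp, hgp])).congr_deriv (by ext; simp)

/-- The quotient `f(q) g(q) (f(p) g(p))⁻¹` is `f(q) f(p)⁻¹` times the conjugate by `f(p)` of `g(q)
g(p)⁻¹`. Both factors equal `1` at `p`, so their derivatives add. -/
theorem HasRightLogDerivAt.mul {f g : M → H} {p : M} {f' g' : F →L[ℝ] E}
    (hf : HasRightLogDerivAt J f p f') (hg : HasRightLogDerivAt J g p g') :
    HasRightLogDerivAt J (fun q => f q * g q) p (f' + (conjDeriv (f p)).comp g') :=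
  (HasModelDerivAt.mul_of_eq_one hf (HasModelDerivAt.conj (f p) hg (by simp)) (by simp)
    (by simp)).congr_fun fun q => by simp [mul_assoc]

theorem HasRightLogDerivAt.hasModelDerivAt {f : M → H} {p : M} {f' : F →L[ℝ] E}
    (hf : HasRightLogDerivAt J f p f') :
    HasModelDerivAt J 𝓘(ℝ, E) f p
      ((modelDeriv 𝓘(ℝ, E) 𝓘(ℝ, E) (fun x : H => x * f p) 1).comp f') :=
  ((hasModelDerivAt_mul_right (f p) 1).comp hf (by simp)).congr_fun fun q => by simp

theorem conjDeriv_mul (a b : H) : (conjDeriv (a * b) : E →L[ℝ] E) = conjDeriv a * conjDeriv b :=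
  ((HasModelDerivAt.conj a (hasModelDerivAt_conj (E := E) b) (by simp)).congr_fun
    (f₁ := fun x : H => a * b * x * (a * b)⁻¹) (by simp [mul_assoc])).modelDeriv_eq

theorem conjDeriv_inv_mul (a : H) : (conjDeriv a⁻¹ : E →L[ℝ] E) * conjDeriv a = 1 := by
  rw [← conjDeriv_mul, inv_mul_cancel, conjDeriv_one]

/-! ### One-parameter subgroups -/

theorem IsOneParam.conj {γ : ℝ → H} {X : E} (h : IsOneParam γ X) (g : H) :
    IsOneParam (fun t => g * γ t * g⁻¹) (conjDeriv g X) :=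
  ⟨fun a b => by simp [h.1, mul_assoc],
    (HasModelDerivAt.conj g h.2 h.map_zero).congr_deriv (by ext; simp)⟩

theorem IsOneParam.isMIntegralCurve {γ : ℝ → H} {X : E} (h : IsOneParam γ X) (x : H) :
    IsMIntegralCurve (I := 𝓘(ℝ, E)) (fun t => x * γ t)
      (mulInvariantVectorField (I := 𝓘(ℝ, E)) (G := H) (X : E)) := by
  intro t
  have h5 := ((hasModelDerivAt_mul_left (E := E) (x * γ t) 1).comp (h.hasModelDerivAt_sub t)
    (by simp [h.map_zero])).congr_fun (f₁ := fun t => x * γ t) (fun s => by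
      rw [mul_assoc, ← h.1]; simp)
  exact h5.congr_deriv (ContinuousLinearMap.ext_ring (ContinuousLinearMap.map_smul
    (modelDeriv 𝓘(ℝ, E) 𝓘(ℝ, E) (fun y : H => x * γ t * y) 1) 1 X))

theorem contMDiff_mulInvariantVectorField_one (X : GroupLieAlgebra 𝓘(ℝ, E) H) :
    ContMDiff 𝓘(ℝ, E) 𝓘(ℝ, E).tangent 1
      (fun g : H => (⟨g, mulInvariantVectorField X g⟩ : TangentBundle 𝓘(ℝ, E) H)) := by
  have := lieGroup_minSmoothness E H
  refine (contMDiff_mulInvariantVectorField X).of_le ?_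
  rw [minSmoothness_of_isRCLikeNormedField]
  norm_num

theorem modelDeriv_mul_left_comp (a b : H) :
    modelDeriv 𝓘(ℝ, E) 𝓘(ℝ, E) (fun y : H => a * b * y) 1 =
      (modelDeriv 𝓘(ℝ, E) 𝓘(ℝ, E) (fun y : H => a * y) b).comp
        (modelDeriv 𝓘(ℝ, E) 𝓘(ℝ, E) (fun y : H => b * y) 1) :=
  (((hasModelDerivAt_mul_left a b).comp (hasModelDerivAt_mul_left b 1) (by simp)).congr_fun
    (f₁ := fun y : H => a * b * y) (fun y => mul_assoc _ _ _)).modelDeriv_eq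

theorem isMIntegralCurveOn_mul_left {γ : ℝ → H} {X : GroupLieAlgebra 𝓘(ℝ, E) H} {s : Set ℝ}
    (h : IsMIntegralCurveOn γ (mulInvariantVectorField X) s) (x : H) :
    IsMIntegralCurveOn (fun t => x * γ t) (mulInvariantVectorField X) s := by
  intro t ht
  have h2 := HasMFDerivAt.comp_hasMFDerivWithinAt t
    (hasModelDerivAt_mul_left (E := E) x (γ t)) (h t ht)
  refine h2.congr_mfderiv ?_
  have h3 := congrArg (fun L => L X) (modelDeriv_mul_left_comp (E := E) x (γ t))
  refine ContinuousLinearMap.ext_ring ?_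
  change _ = (1 : ℝ) • modelDeriv 𝓘(ℝ, E) 𝓘(ℝ, E) (fun y : H => x * γ t * y) 1 X
  refine Eq.trans ?_ (congrArg (fun v => (1 : ℝ) • v) h3).symm
  exact ContinuousLinearMap.map_smul (modelDeriv 𝓘(ℝ, E) 𝓘(ℝ, E) (fun y : H => x * y) (γ t)) 1
    (modelDeriv 𝓘(ℝ, E) 𝓘(ℝ, E) (fun y : H => γ t * y) 1 X)

variable [FiniteDimensional ℝ E] [T2Space H]

/-- The subgroup is the integral curve through `1` of the left-invariant field with value `X`. -/
theorem exists_isOneParam (X : E) : ∃ γ : ℝ → H, IsOneParam γ X := by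
  have : CompleteSpace E := FiniteDimensional.complete ℝ E
  have : IsManifold 𝓘(ℝ, E) 1 H :=
    have : IsManifold 𝓘(ℝ, E) ∞ H := LieGroup.toContMDiffMul.toIsManifold
    IsManifold.of_le (n := ∞) (by simp)
  set V := mulInvariantVectorField (I := 𝓘(ℝ, E)) (G := H) X with hV
  have hsm := contMDiff_mulInvariantVectorField_one (H := H) (E := E) X
  obtain ⟨γ, hγ0, hγ⟩ := exists_isMIntegralCurveAt_of_contMDiffAt_boundaryless (I := 𝓘(ℝ, E))
    (x₀ := (1 : H)) 0 hsm.contMDiffAt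
  obtain ⟨ε, hε, hγε⟩ := isMIntegralCurveAt_iff'.1 hγ
  -- Left translates of the local curve are integral curves through every point with the same
  -- lifetime `ε`, so the field is complete.
  obtain ⟨γ, hγ0, hγ⟩ := exists_isMIntegralCurve_of_isMIntegralCurveOn hsm hε
    (fun x => ⟨fun t => x * γ t, by simp [hγ0], by
      rw [Real.ball_eq_Ioo, zero_sub, zero_add] at hγε
      exact isMIntegralCurveOn_mul_left hγε x⟩) (1 : H)
  refine ⟨γ, fun a b => ?_, ?_⟩
  -- The homomorphism property: `γ(a) γ(t)` and `γ(t + a)` are integral curves with the same value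
  -- at `t = 0`.
  · have h1 : IsMIntegralCurve (fun t => γ a * γ t) V := fun t =>
      hasMFDerivWithinAt_univ.1
        (isMIntegralCurveOn_mul_left (hγ.isMIntegralCurveOn univ) (γ a) t (mem_univ t))
    have h2 : IsMIntegralCurve (γ ∘ (· + a)) V := hγ.comp_add a
    have := isMIntegralCurve_Ioo_eq_of_contMDiff_boundaryless (t₀ := 0) hsm h2 h1 (by simp [hγ0])
    have := congrFun this b
    simpa [add_comm] using this
  · have h0 := hγ 0
    rw [hγ0] at h0
    refine HasModelDerivAt.congr_deriv h0 ?_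
    have h1 : modelDeriv 𝓘(ℝ, E) 𝓘(ℝ, E) (fun x : H => 1 * x) 1 = ContinuousLinearMap.id ℝ E :=
      ((HasModelDerivAt.id (J := 𝓘(ℝ, E)) (1 : H)).congr_fun
        (f₁ := fun x : H => 1 * x) (by simp)).modelDeriv_eq
    refine ContinuousLinearMap.ext_ring ?_
    change (1 : ℝ) • modelDeriv 𝓘(ℝ, E) 𝓘(ℝ, E) (fun x : H => 1 * x) 1 X = (1 : ℝ) • X
    rw [h1]; rfl

theorem IsOneParam.unique {γ γ' : ℝ → H} {X : E} (h : IsOneParam γ X) (h' : IsOneParam γ' X) :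
    γ = γ' := by
  have : CompleteSpace E := FiniteDimensional.complete ℝ E
  have : IsManifold 𝓘(ℝ, E) 1 H :=
    have : IsManifold 𝓘(ℝ, E) ∞ H := LieGroup.toContMDiffMul.toIsManifold
    IsManifold.of_le (n := ∞) (by simp)
  have := isMIntegralCurve_Ioo_eq_of_contMDiff_boundaryless (t₀ := 0)
    (contMDiff_mulInvariantVectorField_one (H := H) (E := E) X) (h.isMIntegralCurve 1)
    (h'.isMIntegralCurve 1) (by simp [h.map_zero, h'.map_zero])
  simpa using this

end LieGroupCalculus

/-! ### The multiplication in a chart, and the derivative of the adjoint representation. -/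

section MulChart

variable {E : Type*} [NormedAddCommGroup E] [NormedSpace ℝ E]
  {H : Type*} [TopologicalSpace H] [ChartedSpace E H] [Group H]

variable (E H) in
/-- The preferred chart at the identity. -/
def unitChart : PartialEquiv H E := extChartAt 𝓘(ℝ, E) (1 : H)

variable (E H) in
/-- The multiplication, read in the preferred chart at the identity. -/
def mulChart (z : E × E) : E :=
  unitChart E H ((unitChart E H).symm z.1 * (unitChart E H).symm z.2)

variable (E H) in
/-- The second derivative of the multiplication in the chart at the identity. -/
def mulChartSnd : E × E →L[ℝ] E × E →L[ℝ] E :=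
  fderiv ℝ (fderiv ℝ (mulChart E H)) (unitChart E H 1, unitChart E H 1)

variable (E H) in
/-- The mixed part of `mulChartSnd`. -/
def mulChartMixed : E →L[ℝ] E →L[ℝ] E :=
  ((ContinuousLinearMap.compL ℝ E (E × E) E).flip (ContinuousLinearMap.inr ℝ E E)).comp
    ((mulChartSnd E H).comp (ContinuousLinearMap.inl ℝ E E))

variable (E H) in
/-- The Lie bracket of `T₁H`, as the antisymmetrized second derivative of the multiplication. -/
def adBil : E →L[ℝ] E →L[ℝ] E := mulChartMixed E H - (mulChartMixed E H).flip

theorem adBil_apply (X W : E) :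
    adBil E H X W = mulChartSnd E H (X, 0) (0, W) - mulChartSnd E H (W, 0) (0, X) := rfl

theorem adBil_swap (X W : E) : adBil E H X W = -adBil E H W X := by
  simp [adBil_apply]

theorem adBil_self (X : E) : adBil E H X X = 0 := by simp [adBil_apply]

theorem unitChart_source_mem : (unitChart E H).source ∈ 𝓝 (1 : H) :=
  extChartAt_source_mem_nhds (1 : H)

theorem unitChart_target_mem : (unitChart E H).target ∈ 𝓝 (unitChart E H 1) :=
  extChartAt_target_mem_nhds (1 : H)

theorem one_mem_unitChart_source : (1 : H) ∈ (unitChart E H).source :=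
  mem_extChartAt_source (1 : H)

theorem unitChart_symm_one : (unitChart E H).symm (unitChart E H 1) = 1 :=
  (unitChart E H).left_inv one_mem_unitChart_source

theorem continuousAt_unitChart : ContinuousAt (unitChart E H) (1 : H) :=
  continuousAt_extChartAt (1 : H)

theorem continuousAt_unitChart_symm :
    ContinuousAt (unitChart E H).symm (unitChart E H 1) :=
  continuousAt_extChartAt_symm (1 : H)

theorem mulChart_unit_right {x : E} (hx : x ∈ (unitChart E H).target) :
    mulChart E H (x, unitChart E H 1) = x := by
  simp [mulChart, unitChart_symm_one, (unitChart E H).right_inv hx]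

theorem mulChart_unit_left {x : E} (hx : x ∈ (unitChart E H).target) :
    mulChart E H (unitChart E H 1, x) = x := by
  simp [mulChart, unitChart_symm_one, (unitChart E H).right_inv hx]

theorem hasModelDerivAt_unitChart :
    HasModelDerivAt 𝓘(ℝ, E) 𝓘(ℝ, E) (unitChart E H) (1 : H) (ContinuousLinearMap.id ℝ E) := by
  refine ⟨continuousAt_unitChart, ?_⟩
  refine (hasFDerivWithinAt_id (𝕜 := ℝ) (extChartAt 𝓘(ℝ, E) (1 : H) 1) (range 𝓘(ℝ, E))).congr_of_eventuallyEq ?_ ?_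
  · have : (unitChart E H).target ∈ 𝓝[range 𝓘(ℝ, E)] (extChartAt 𝓘(ℝ, E) (1 : H) 1) :=
      mem_nhdsWithin_of_mem_nhds unitChart_target_mem
    filter_upwards [this] with x hx
    exact (unitChart E H).right_inv hx
  · exact (unitChart E H).right_inv (mem_extChartAt_target (1 : H))

theorem hasModelDerivAt_unitChart_symm :
    HasModelDerivAt 𝓘(ℝ, E) 𝓘(ℝ, E) (unitChart E H).symm (unitChart E H 1)
      (ContinuousLinearMap.id ℝ E) := by
  refine ⟨continuousAt_unitChart_symm, ?_⟩
  refine (hasFDerivWithinAt_id (𝕜 := ℝ) (unitChart E H 1) (range 𝓘(ℝ, E))).congr_of_eventuallyEq ?_ ?_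
  · have : (unitChart E H).target ∈ 𝓝[range 𝓘(ℝ, E)] (unitChart E H 1) :=
      mem_nhdsWithin_of_mem_nhds unitChart_target_mem
    filter_upwards [this] with x hx
    change extChartAt 𝓘(ℝ, E) ((unitChart E H).symm (unitChart E H 1)) ((unitChart E H).symm x) = x
    rw [unitChart_symm_one]
    exact (unitChart E H).right_inv hx
  · change extChartAt 𝓘(ℝ, E) ((unitChart E H).symm (unitChart E H 1)) ((unitChart E H).symm (unitChart E H 1)) = _
    rw [unitChart_symm_one]
    rfl

/-- The derivative at the unit of right translation by the point with coordinates `x`. -/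
def rightTransChart (E H : Type*) [NormedAddCommGroup E] [NormedSpace ℝ E]
    [TopologicalSpace H] [ChartedSpace E H] [Group H] (x : E) : E →L[ℝ] E :=
  (fderiv ℝ (mulChart E H) (unitChart E H 1, x)).comp (ContinuousLinearMap.inl ℝ E E)

/-- The derivative at the unit of left translation by the point with coordinates `x`. -/
def leftTransChart (E H : Type*) [NormedAddCommGroup E] [NormedSpace ℝ E]
    [TopologicalSpace H] [ChartedSpace E H] [Group H] (x : E) : E →L[ℝ] E :=
  (fderiv ℝ (mulChart E H) (x, unitChart E H 1)).comp (ContinuousLinearMap.inr ℝ E E)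

variable [LieGroup 𝓘(ℝ, E) ∞ H]

theorem contDiffAt_mulChart :
    ContDiffAt ℝ ∞ (mulChart E H) (unitChart E H 1, unitChart E H 1) := by
  have : IsManifold 𝓘(ℝ, E) ∞ H := LieGroup.toContMDiffMul.toIsManifold
  rw [← contMDiffAt_iff_contDiffAt]
  have hs : ContMDiffAt 𝓘(ℝ, E) 𝓘(ℝ, E) ∞ (unitChart E H).symm (unitChart E H 1) :=
    (contMDiffOn_extChartAt_symm (1 : H)).contMDiffAt unitChart_target_mem
  have h1 : ContMDiffAt 𝓘(ℝ, E × E) 𝓘(ℝ, E) ∞ (fun z : E × E => (unitChart E H).symm z.1)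
      (unitChart E H 1, unitChart E H 1) :=
    ContMDiffAt.comp (I' := 𝓘(ℝ, E)) (unitChart E H 1, unitChart E H 1) hs
      contDiffAt_fst.contMDiffAt
  have h2 : ContMDiffAt 𝓘(ℝ, E × E) 𝓘(ℝ, E) ∞ (fun z : E × E => (unitChart E H).symm z.2)
      (unitChart E H 1, unitChart E H 1) :=
    ContMDiffAt.comp (I' := 𝓘(ℝ, E)) (unitChart E H 1, unitChart E H 1) hs
      contDiffAt_snd.contMDiffAt
  have h3 := h1.mul h2
  refine ContMDiffAt.comp (I' := 𝓘(ℝ, E)) (unitChart E H 1, unitChart E H 1) ?_ h3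
  simp only [unitChart_symm_one, mul_one]
  exact contMDiffAt_extChartAt

theorem eventually_differentiableAt_mulChart :
    ∀ᶠ z in 𝓝 (unitChart E H 1, unitChart E H 1), DifferentiableAt ℝ (mulChart E H) z := by
  have h : ContDiffAt ℝ 1 (mulChart E H) (unitChart E H 1, unitChart E H 1) :=
    contDiffAt_mulChart.of_le (by simp)
  filter_upwards [h.eventually (by simp)] with z hz
  exact hz.differentiableAt (by simp)

theorem hasFDerivAt_fderiv_mulChart :
    HasFDerivAt (fderiv ℝ (mulChart E H)) (mulChartSnd E H) (unitChart E H 1, unitChart E H 1) := by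
  have h : ContDiffAt ℝ 2 (mulChart E H) (unitChart E H 1, unitChart E H 1) :=
    contDiffAt_mulChart.of_le ENat.LEInfty.out
  exact ((h.fderiv_right (m := 1) (by norm_num)).differentiableAt (by simp)).hasFDerivAt

theorem mulChartSnd_symm (v w : E × E) : mulChartSnd E H v w = mulChartSnd E H w v := by
  have h : ContDiffAt ℝ 2 (mulChart E H) (unitChart E H 1, unitChart E H 1) :=
    contDiffAt_mulChart.of_le ENat.LEInfty.out
  exact h.isSymmSndFDerivAt (by simp) v w

theorem rightTransChart_unit : rightTransChart E H (unitChart E H 1) = 1 := by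
  have hd := eventually_differentiableAt_mulChart (E := E) (H := H).self_of_nhds
  have h1 : HasFDerivAt (fun x : E => mulChart E H (x, unitChart E H 1))
      (rightTransChart E H (unitChart E H 1)) (unitChart E H 1) :=
    hd.hasFDerivAt.comp (f := fun x : E => (x, unitChart E H 1)) _ (hasFDerivAt_prodMk_left _ _)
  refine h1.unique ((hasFDerivAt_id (unitChart E H 1)).congr_of_eventuallyEq ?_)
  filter_upwards [unitChart_target_mem] with x hx
  exact mulChart_unit_right hx

theorem leftTransChart_unit : leftTransChart E H (unitChart E H 1) = 1 := by
  have hd := eventually_differentiableAt_mulChart (E := E) (H := H).self_of_nhds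
  have h1 : HasFDerivAt (fun x : E => mulChart E H (unitChart E H 1, x))
      (leftTransChart E H (unitChart E H 1)) (unitChart E H 1) :=
    hd.hasFDerivAt.comp _ (hasFDerivAt_prodMk_right _ _)
  refine h1.unique ((hasFDerivAt_id (unitChart E H 1)).congr_of_eventuallyEq ?_)
  filter_upwards [unitChart_target_mem] with x hx
  exact mulChart_unit_left hx

theorem hasFDerivAt_leftTransChart :
    HasFDerivAt (leftTransChart E H) (mulChartMixed E H) (unitChart E H 1) := by
  have h1 := (hasFDerivAt_fderiv_mulChart (E := E) (H := H)).comp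
    (f := fun x : E => (x, unitChart E H 1)) (unitChart E H 1)
    (hasFDerivAt_prodMk_left (𝕜 := ℝ) (unitChart E H 1) (unitChart E H 1))
  exact ((ContinuousLinearMap.compL ℝ E (E × E) E).flip
    (ContinuousLinearMap.inr ℝ E E)).hasFDerivAt.comp _ h1

/-- Symmetry of the second derivative turns the mixed part taken in the other order into the flip.
This is why the derivative of the adjoint action comes out antisymmetrized. -/
theorem hasFDerivAt_rightTransChart :
    HasFDerivAt (rightTransChart E H) (mulChartMixed E H).flip (unitChart E H 1) := by
  have h1 := (hasFDerivAt_fderiv_mulChart (E := E) (H := H)).comp (unitChart E H 1)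
    (hasFDerivAt_prodMk_right (𝕜 := ℝ) (unitChart E H 1) (unitChart E H 1))
  have h2 := ((ContinuousLinearMap.compL ℝ E (E × E) E).flip
    (ContinuousLinearMap.inl ℝ E E)).hasFDerivAt.comp (unitChart E H 1) h1
  refine h2.congr_fderiv ?_
  ext X W
  exact mulChartSnd_symm _ _

/-- Differentiate `(g ξ g⁻¹) g = g ξ` in `ξ` at the identity. Near the identity this writes `Ad(g)`
as `R⁻¹ L` in terms of the two translations, a form that can be differentiated in `g`. -/
theorem eventually_rightTransChart_comp_conjDeriv :
    ∀ᶠ g in 𝓝 (1 : H), rightTransChart E H (unitChart E H g) * conjDeriv g =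
      leftTransChart E H (unitChart E H g) := by
  have hc := continuousAt_unitChart (E := E) (H := H)
  have c1 : Tendsto (fun g : H => (unitChart E H 1, unitChart E H g)) (𝓝 1)
      (𝓝 (unitChart E H 1, unitChart E H 1)) := tendsto_const_nhds.prodMk_nhds hc
  have c2 : Tendsto (fun g : H => (unitChart E H g, unitChart E H 1)) (𝓝 1)
      (𝓝 (unitChart E H 1, unitChart E H 1)) := Tendsto.prodMk_nhds hc tendsto_const_nhds
  filter_upwards [c1.eventually eventually_differentiableAt_mulChart,
    c2.eventually eventually_differentiableAt_mulChart, unitChart_source_mem (E := E) (H := H)]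
    with g h1 h2 hg
  have hk : HasFDerivAt (fun ξ : E => unitChart E H (g * (unitChart E H).symm ξ * g⁻¹))
      (conjDeriv g : E →L[ℝ] E) (unitChart E H 1) :=
    hasModelDerivAt_iff_hasFDerivAt.1 (hasModelDerivAt_unitChart.comp
      (HasModelDerivAt.conj g hasModelDerivAt_unitChart_symm unitChart_symm_one)
      (by simp [unitChart_symm_one]))
  have e0 : unitChart E H (g * (unitChart E H).symm (unitChart E H 1) * g⁻¹) = unitChart E H 1 := by
    simp [unitChart_symm_one]
  have hl : HasFDerivAt (fun ξ : E => mulChart E H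
      (unitChart E H (g * (unitChart E H).symm ξ * g⁻¹), unitChart E H g))
      (rightTransChart E H (unitChart E H g) * conjDeriv g) (unitChart E H 1) := by
    have h1' := h1.hasFDerivAt
    rw [← e0] at h1'
    have := h1'.comp (unitChart E H 1) (hk.prodMk (hasFDerivAt_const (unitChart E H g) _))
    refine this.congr_fderiv ?_
    rw [e0]
    ext v
    simp [rightTransChart]
  have hr : HasFDerivAt (fun ξ : E => mulChart E H (unitChart E H g, ξ))
      (leftTransChart E H (unitChart E H g)) (unitChart E H 1) :=
    h2.hasFDerivAt.comp _ (hasFDerivAt_prodMk_right _ _)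
  refine hl.unique (hr.congr_of_eventuallyEq ?_)
  have c3 : Tendsto (fun ξ : E => g * (unitChart E H).symm ξ * g⁻¹) (𝓝 (unitChart E H 1))
      (𝓝 (1 : H)) := by
    have := (HasModelDerivAt.conj (E := E) (H := H) g (hasModelDerivAt_unitChart_symm (E := E))
      (unitChart_symm_one (E := E) (H := H))).mdifferentiableAt.continuousAt
    simpa [ContinuousAt, unitChart_symm_one] using this
  filter_upwards [c3.eventually (unitChart_source_mem (E := E) (H := H))] with ξ hξ
  simp [mulChart, (unitChart E H).left_inv hξ, (unitChart E H).left_inv hg]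

variable [FiniteDimensional ℝ E]

/-- The derivative of the adjoint representation along a curve through the unit. -/
theorem hasDerivAt_conjDeriv {γ : ℝ → H} {X : E} (hγ : HasModelDerivAt 𝓘(ℝ, ℝ) 𝓘(ℝ, E) γ 0
      (ContinuousLinearMap.toSpanSingleton ℝ X)) (h0 : γ 0 = 1) :
    HasDerivAt (fun t => (conjDeriv (γ t) : E →L[ℝ] E)) (adBil E H X) 0 := by
  have : CompleteSpace E := FiniteDimensional.complete ℝ E
  have hx : HasFDerivAt (fun t => unitChart E H (γ t))
      (ContinuousLinearMap.toSpanSingleton ℝ X) 0 :=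
    hasModelDerivAt_iff_hasFDerivAt.1 ((hasModelDerivAt_unitChart.comp hγ h0).congr_deriv
      (by ext; simp))
  have hx' : HasDerivAt (fun t => unitChart E H (γ t)) X 0 := by
    simpa using hx.hasDerivAt
  have e0 : unitChart E H (γ 0) = unitChart E H 1 := by rw [h0]
  have hL : HasDerivAt (fun t => leftTransChart E H (unitChart E H (γ t)))
      (mulChartMixed E H X) 0 :=
    HasFDerivAt.comp_hasDerivAt_of_eq (l := leftTransChart E H) 0 hasFDerivAt_leftTransChart hx' e0.symm
  have hR : HasDerivAt (fun t => rightTransChart E H (unitChart E H (γ t)))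
      ((mulChartMixed E H).flip X) 0 :=
    HasFDerivAt.comp_hasDerivAt_of_eq (l := rightTransChart E H) 0 hasFDerivAt_rightTransChart hx' e0.symm
  -- At the identity operator, inversion has derivative `-1`. The product rule for `R⁻¹ L` then
  -- gives the mixed part minus its flip.
  have hI : HasDerivAt (fun t => Ring.inverse (rightTransChart E H (unitChart E H (γ t))))
      (-(mulChartMixed E H).flip X) 0 := by
    have hi := hasFDerivAt_ringInverse (𝕜 := ℝ) (1 : (E →L[ℝ] E)ˣ)
    have := HasFDerivAt.comp_hasDerivAt_of_eq 0 hi hR (by rw [h0, rightTransChart_unit]; rfl)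
    exact this.congr_deriv (by simp)
  have hp := hI.mul hL
  rw [h0, leftTransChart_unit, rightTransChart_unit, Ring.inverse_one, mul_one, one_mul] at hp
  have hp' : HasDerivAt (fun t => Ring.inverse (rightTransChart E H (unitChart E H (γ t))) *
      leftTransChart E H (unitChart E H (γ t))) (adBil E H X) 0 := by
    exact hp.congr_deriv ((neg_add_eq_sub _ _).trans rfl)
  refine hp'.congr_of_eventuallyEq ?_
  have hγc : Tendsto γ (𝓝 0) (𝓝 1) := h0 ▸ hγ.mdifferentiableAt.continuousAt.tendsto
  have hu : ∀ᶠ t in 𝓝 (0 : ℝ), IsUnit (rightTransChart E H (unitChart E H (γ t))) :=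
    hR.continuousAt.eventually (show ∀ᶠ y in 𝓝 (rightTransChart E H (unitChart E H (γ 0))),
      IsUnit y by
      rw [h0, rightTransChart_unit]
      exact Units.isOpen.mem_nhds isUnit_one)
  filter_upwards [hγc.eventually (eventually_rightTransChart_comp_conjDeriv (E := E)), hu] with t h1 h2
  rw [← h1, ← mul_assoc, Ring.inverse_mul_cancel _ h2, one_mul]

/-- `Ad(γ(t))` solves the linear equation `A' = (ad X) A` with `A(0) = 1`, so `e^{-t ad X} Ad(γ(t))`
has zero derivative and is constantly `1`. -/
theorem IsOneParam.conjDeriv_eq_exp {γ : ℝ → H} {X : E} (h : IsOneParam γ X) (t : ℝ) :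
    (conjDeriv (γ t) : E →L[ℝ] E) = NormedSpace.exp (t • adBil E H X) := by
  have : CompleteSpace E := FiniteDimensional.complete ℝ E
  have hA : ∀ t, HasDerivAt (fun t => (conjDeriv (γ t) : E →L[ℝ] E))
      (adBil E H X * conjDeriv (γ t)) t := by
    intro t
    have h0 := hasDerivAt_conjDeriv h.2 h.map_zero
    have h1 : HasDerivAt (fun s : ℝ => s - t) 1 t := (hasDerivAt_id t).sub_const t
    have h2 := HasDerivAt.scomp_of_eq t h0 h1 (by simp)
    have h3 := h2.mul_const (conjDeriv (γ t) : E →L[ℝ] E)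
    rw [one_smul] at h3
    refine h3.congr_of_eventuallyEq (Eventually.of_forall fun s => ?_)
    simp only [Function.comp]
    rw [← conjDeriv_mul, ← h.1, sub_add_cancel]
  have hB : ∀ t : ℝ, HasDerivAt (fun t : ℝ => NormedSpace.exp (t • (-adBil E H X)))
      (NormedSpace.exp (t • (-adBil E H X)) * (-adBil E H X)) t :=
    fun t => hasDerivAt_exp_smul_const (𝕂 := ℝ) (-adBil E H X) t
  have hC : ∀ t, HasDerivAt (fun t : ℝ => NormedSpace.exp (t • (-adBil E H X)) *
      (conjDeriv (γ t) : E →L[ℝ] E)) 0 t := fun t => by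
    exact ((hB t).mul (hA t)).congr_deriv (by rw [mul_assoc, neg_mul, mul_neg, neg_add_cancel])
  have := is_const_of_deriv_eq_zero (fun t => (hC t).differentiableAt) (fun t => (hC t).deriv) t 0
  simp only [zero_smul, NormedSpace.exp_zero, h.map_zero, conjDeriv_one, mul_one] at this
  have h2 : NormedSpace.exp (t • adBil E H X) * NormedSpace.exp (t • (-adBil E H X)) = 1 := by
    let _ : NormedAlgebra ℚ (E →L[ℝ] E) := NormedAlgebra.restrictScalars ℚ ℝ _
    rw [← NormedSpace.exp_add_of_commute (((Commute.refl _).neg_right).smul_left t |>.smul_right t)]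
    simp
  calc (conjDeriv (γ t) : E →L[ℝ] E) = NormedSpace.exp (t • adBil E H X) *
        (NormedSpace.exp (t • (-adBil E H X)) * conjDeriv (γ t)) := by
        rw [← mul_assoc, h2, one_mul]
    _ = _ := by rw [this, mul_one]

end MulChart

/-! ### Comparison with the bracket of left-invariant vector fields. -/

section Bracket

variable {E : Type*} [NormedAddCommGroup E] [NormedSpace ℝ E]
  {H : Type*} [TopologicalSpace H] [ChartedSpace E H] [Group H] [LieGroup 𝓘(ℝ, E) ∞ H]

/-- Differentiating the multiplication in its second argument gives the coordinate expression of a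
left-invariant field. Its bracket at the identity then needs only the first derivative of
`leftTransChart` there. -/
theorem mpullbackWithin_mulInvariantVectorField (X : E) :
    ∀ᶠ x in 𝓝 (unitChart E H 1),
      VectorField.mpullbackWithin 𝓘(ℝ, E) 𝓘(ℝ, E) (unitChart E H).symm
        (mulInvariantVectorField (I := 𝓘(ℝ, E)) (G := H) X) (range 𝓘(ℝ, E)) x
      = leftTransChart E H x X := by
  have : IsManifold 𝓘(ℝ, E) 1 H :=
    have : IsManifold 𝓘(ℝ, E) ∞ H := LieGroup.toContMDiffMul.toIsManifold
    IsManifold.of_le (n := ∞) (by simp)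
  have c2 : Tendsto (fun x : E => (x, unitChart E H 1)) (𝓝 (unitChart E H 1))
      (𝓝 (unitChart E H 1, unitChart E H 1)) := Tendsto.prodMk_nhds tendsto_id tendsto_const_nhds
  filter_upwards [c2.eventually eventually_differentiableAt_mulChart,
    unitChart_target_mem (E := E) (H := H)] with x h2 hx
  set g : H := (unitChart E H).symm x with hg
  have hxs : g ∈ (unitChart E H).source := (unitChart E H).map_target hx
  have hgx : unitChart E H g = x := (unitChart E H).right_inv hx
  have h1 : HasModelDerivAt 𝓘(ℝ, E) 𝓘(ℝ, E) (unitChart E H) g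
      (modelDeriv 𝓘(ℝ, E) 𝓘(ℝ, E) (unitChart E H) g) :=
    MDifferentiableAt.hasModelDerivAt (mdifferentiableAt_extChartAt (by
      rw [← extChartAt_source 𝓘(ℝ, E)]; exact hxs))
  have hr : HasFDerivAt (fun ξ : E => mulChart E H (x, ξ))
      (leftTransChart E H x) (unitChart E H 1) :=
    h2.hasFDerivAt.comp _ (hasFDerivAt_prodMk_right _ _)
  have h3 := h1.comp ((hasModelDerivAt_mul_left g 1).comp hasModelDerivAt_unitChart_symm
    unitChart_symm_one) (by simp [unitChart_symm_one])
  have h4 : leftTransChart E H x = (modelDeriv 𝓘(ℝ, E) 𝓘(ℝ, E) (unitChart E H) g).comp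
      (modelDeriv 𝓘(ℝ, E) 𝓘(ℝ, E) (fun y : H => g * y) 1) :=
    hr.unique (hasModelDerivAt_iff_hasFDerivAt.1 h3)
  -- The derivatives of the chart and of its inverse are mutually inverse, so pulling back by the
  -- inverse chart is pushing forward by the chart.
  have h5 := mfderiv_extChartAt_comp_mfderivWithin_extChartAt_symm (I := 𝓘(ℝ, E)) (x := (1 : H)) hx
  have h6 := mfderivWithin_extChartAt_symm_comp_mfderiv_extChartAt (I := 𝓘(ℝ, E)) (x := (1 : H)) hx
  rw [VectorField.mpullbackWithin_apply, h4]
  exact congrArg (fun L => L (mulInvariantVectorField (I := 𝓘(ℝ, E)) (G := H) X g))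
    (ContinuousLinearMap.inverse_eq h6 h5)

/-- Mathlib's bracket of left-invariant vector fields is the antisymmetrized second derivative of
the multiplication. -/
theorem groupLieAlgebra_bracket_eq (X W : E) :
    (Bracket.bracket : GroupLieAlgebra 𝓘(ℝ, E) H → GroupLieAlgebra 𝓘(ℝ, E) H →
      GroupLieAlgebra 𝓘(ℝ, E) H) X W = adBil E H X W := by
  have hL : ∀ X : E, HasFDerivAt (fun x => leftTransChart E H x X)
      ((mulChartMixed E H).flip X) (unitChart E H 1) := fun X =>
    ((ContinuousLinearMap.apply ℝ E X).hasFDerivAt.comp (unitChart E H 1)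
      hasFDerivAt_leftTransChart).congr_fderiv (by ext; simp)
  have h1 : VectorField.lieBracketWithin ℝ
      (VectorField.mpullbackWithin 𝓘(ℝ, E) 𝓘(ℝ, E) (extChartAt 𝓘(ℝ, E) (1 : H)).symm
        (mulInvariantVectorField (I := 𝓘(ℝ, E)) (G := H) X) (range 𝓘(ℝ, E)))
      (VectorField.mpullbackWithin 𝓘(ℝ, E) 𝓘(ℝ, E) (extChartAt 𝓘(ℝ, E) (1 : H)).symm
        (mulInvariantVectorField (I := 𝓘(ℝ, E)) (G := H) W) (range 𝓘(ℝ, E)))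
      ((extChartAt 𝓘(ℝ, E) (1 : H)).symm ⁻¹' univ ∩ range 𝓘(ℝ, E)) (extChartAt 𝓘(ℝ, E) (1 : H) 1)
      = adBil E H X W := by
    refine (Filter.EventuallyEq.lieBracketWithin_vectorField_eq_nhds
      (mpullbackWithin_mulInvariantVectorField X)
      (mpullbackWithin_mulInvariantVectorField W)).trans ?_
    rw [preimage_univ, modelWithCornersSelf_coe, range_id, univ_inter,
      VectorField.lieBracketWithin_univ, VectorField.lieBracket_eq]
    change fderiv ℝ (fun x => leftTransChart E H x W) (unitChart E H 1)
        (leftTransChart E H (unitChart E H 1) X) -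
      fderiv ℝ (fun x => leftTransChart E H x X) (unitChart E H 1)
        (leftTransChart E H (unitChart E H 1) W) = adBil E H X W
    rw [(hL X).fderiv, (hL W).fderiv, leftTransChart_unit]
    rfl
  have h2 : modelDeriv 𝓘(ℝ, E) 𝓘(ℝ, E) (extChartAt 𝓘(ℝ, E) (1 : H)) 1 =
      ContinuousLinearMap.id ℝ E := hasModelDerivAt_unitChart.modelDeriv_eq
  refine (GroupLieAlgebra.bracket_def (I := 𝓘(ℝ, E)) (G := H) X W).trans ?_
  rw [← VectorField.mlieBracketWithin_univ, VectorField.mlieBracketWithin_apply]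
  refine Eq.trans (congrArg (fun v => (ContinuousLinearMap.inverse
    (modelDeriv 𝓘(ℝ, E) 𝓘(ℝ, E) (extChartAt 𝓘(ℝ, E) (1 : H)) 1)) v) h1) ?_
  rw [h2, ContinuousLinearMap.inverse_id]
  rfl

end Bracket

/-! ### The exponential map and its derivative. -/

section Exponential

variable {E : Type*} [NormedAddCommGroup E] [NormedSpace ℝ E]
  {H : Type*} [TopologicalSpace H] [ChartedSpace E H] [Group H]

/-- A curve `c` in `H` has left velocity `Z` at time `t`. -/
def HasLeftVelocityAt (c : ℝ → H) (t : ℝ) (Z : E) : Prop :=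
  HasModelDerivAt 𝓘(ℝ, ℝ) 𝓘(ℝ, E) (fun s => (c t)⁻¹ * c s) t
    (ContinuousLinearMap.toSpanSingleton ℝ Z)

theorem hasModelDerivAt_of_unitChart {F : Type*} [NormedAddCommGroup F] [NormedSpace ℝ F]
    {f : F → H} {p : F} {f' : F →L[ℝ] E} (hp : f p = 1)
    (hs : ∀ᶠ q in 𝓝 p, f q ∈ (unitChart E H).source)
    (h : HasFDerivAt (fun q => unitChart E H (f q)) f' p) :
    HasModelDerivAt 𝓘(ℝ, F) 𝓘(ℝ, E) f p f' := by
  have h1 := (hasModelDerivAt_unitChart_symm (E := E) (H := H)).comp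
    (hasModelDerivAt_iff_hasFDerivAt.2 h) (by rw [hp])
  refine HasMFDerivAt.congr_of_eventuallyEq (h1.congr_deriv (by ext; simp)) ?_
  filter_upwards [hs] with q hq
  exact ((unitChart E H).left_inv hq).symm

/-- The function `(e^a - 1) / a` of an operator `a`. -/
def expMean {A : Type*} [NormedRing A] [NormedAlgebra ℝ A] (a : A) : A :=
  ∫ t in (0 : ℝ)..1, NormedSpace.exp (t • a)

variable [LieGroup 𝓘(ℝ, E) ∞ H]

theorem HasLeftVelocityAt.continuousAt {c : ℝ → H} {t : ℝ} {Z : E} (h : HasLeftVelocityAt c t Z) :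
    ContinuousAt c t :=
  (((hasModelDerivAt_mul_left (E := E) (c t) _).comp h rfl).congr_fun
    (f₁ := c) (fun s => by simp)).mdifferentiableAt.continuousAt

/-- Writing `c(s) = c(t) (c(t)⁻¹ c(s))` turns left velocity into the differential equation `x' = L_x
Z` in the chart. -/
theorem HasLeftVelocityAt.hasDerivAt_unitChart {c : ℝ → H} {t : ℝ} {Z : E}
    (h : HasLeftVelocityAt c t Z) (hc : c t ∈ (unitChart E H).source)
    (hd : DifferentiableAt ℝ (mulChart E H) (unitChart E H (c t), unitChart E H 1)) :
    HasDerivAt (fun s => unitChart E H (c s)) (leftTransChart E H (unitChart E H (c t)) Z) t := by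
  have h1 : HasFDerivAt (fun s => unitChart E H ((c t)⁻¹ * c s))
      (ContinuousLinearMap.toSpanSingleton ℝ Z) t :=
    hasModelDerivAt_iff_hasFDerivAt.1 ((hasModelDerivAt_unitChart.comp h (by simp)).congr_deriv
      (by ext; simp))
  have h2 : HasFDerivAt (fun x : E => mulChart E H (unitChart E H (c t), x))
      (leftTransChart E H (unitChart E H (c t))) (unitChart E H 1) :=
    hd.hasFDerivAt.comp _ (hasFDerivAt_prodMk_right _ _)
  have h3 := HasFDerivAt.comp_hasDerivAt_of_eq t h2 h1.hasDerivAt (by simp)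
  refine (h3.congr_deriv (by simp)).congr_of_eventuallyEq ?_
  have h4 : Tendsto (fun s => (c t)⁻¹ * c s) (𝓝 t) (𝓝 1) := by
    have := h.mdifferentiableAt.continuousAt
    simpa [ContinuousAt] using this
  filter_upwards [h4.eventually (unitChart_source_mem (E := E) (H := H))] with s hs
  simp [mulChart, (unitChart E H).left_inv hc, (unitChart E H).left_inv hs]

variable [FiniteDimensional ℝ E] [T2Space H]

/-- A curve starting at the unit with small left velocity stays near the unit, and its endpoint is
approximated by the integral of the velocity. -/
theorem exists_radius_unitChart_endpoint (ε : ℝ) (hε : 0 < ε) :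
    ∃ r > 0, ∀ (c : ℝ → H) (Z : ℝ → E) (δ : ℝ), c 0 = 1 → Continuous Z →
      (∀ t, HasLeftVelocityAt c t (Z t)) → (∀ t ∈ Icc (0 : ℝ) 1, ‖Z t‖ ≤ δ) → δ < r →
      c 1 ∈ (unitChart E H).source ∧
        ‖unitChart E H (c 1) - unitChart E H 1 - ∫ t in (0 : ℝ)..1, Z t‖ ≤ ε * δ := by
  have : CompleteSpace E := FiniteDimensional.complete ℝ E
  have : ProperSpace E := FiniteDimensional.proper ℝ E
  set o := unitChart E H 1 with ho
  have c2 : Tendsto (fun x : E => (x, o)) (𝓝 o) (𝓝 (o, o)) :=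
    Tendsto.prodMk_nhds tendsto_id tendsto_const_nhds
  have c3 : ∀ᶠ x in 𝓝 o, ‖leftTransChart E H x - 1‖ < ε := by
    have h := (hasFDerivAt_leftTransChart (E := E) (H := H)).continuousAt
    have h' := h.sub_const 1
    have h'' := h'.norm
    refine h''.eventually (gt_mem_nhds ?_)
    rwa [leftTransChart_unit, sub_self, norm_zero]
  obtain ⟨R, hR, hball⟩ := Metric.nhds_basis_closedBall.eventually_iff.1
    ((c2.eventually eventually_differentiableAt_mulChart).and
      (c3.and (unitChart_target_mem (E := E) (H := H))))
  -- The open set is used to locate the first exit time. The compact image of the closed ball,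
  -- closed because `H` is Hausdorff, keeps the exit point itself inside the chart.
  have hop : IsOpen ((unitChart E H).source ∩ unitChart E H ⁻¹' Metric.ball o R) :=
    isOpen_extChartAt_preimage' (I := 𝓘(ℝ, E)) (1 : H) Metric.isOpen_ball
  have hcl : IsClosed ((unitChart E H).symm '' Metric.closedBall o R) :=
    ((isCompact_closedBall o R).image_of_continuousOn
      ((continuousOn_extChartAt_symm (I := 𝓘(ℝ, E)) (1 : H)).mono
        fun x hx => (hball hx).2.2)).isClosed
  -- In the chart the speed is at most `‖L_x‖ δ ≤ (1 + ε) δ`, so with this radius a curve cannot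
  -- travel the distance `R` within unit time.
  refine ⟨R / (1 + ε), by positivity, fun c Z δ hc0 hZc hc hZ hδ => ?_⟩
  have hδ' : (1 + ε) * δ < R := by
    rw [lt_div_iff₀ (by positivity)] at hδ
    linarith
  have hder : ∀ t, c t ∈ (unitChart E H).symm '' Metric.closedBall o R →
      c t ∈ (unitChart E H).source ∧ ‖leftTransChart E H (unitChart E H (c t)) - 1‖ < ε ∧
      HasDerivAt (fun s => unitChart E H (c s))
        (leftTransChart E H (unitChart E H (c t)) (Z t)) t := by
    rintro t ⟨ξ, hξ, hξt⟩
    obtain ⟨hd, hn, ht⟩ := hball hξ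
    have e1 : unitChart E H (c t) = ξ := by rw [← hξt]; exact (unitChart E H).right_inv ht
    have e2 : c t ∈ (unitChart E H).source := by rw [← hξt]; exact (unitChart E H).map_target ht
    exact ⟨e2, by rw [e1]; exact hn, (hc t).hasDerivAt_unitChart e2 (by rw [e1]; exact hd)⟩
  have hsub : ∀ t, c t ∈ (unitChart E H).source ∩ unitChart E H ⁻¹' Metric.ball o R →
      c t ∈ (unitChart E H).symm '' Metric.closedBall o R := fun t ht =>
    ⟨unitChart E H (c t), Metric.ball_subset_closedBall ht.2, (unitChart E H).left_inv ht.1⟩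
  have hcc : Continuous c := continuous_iff_continuousAt.2 fun t => (hc t).continuousAt
  have hbound : ∀ t ∈ Icc (0 : ℝ) 1, c t ∈ (unitChart E H).symm '' Metric.closedBall o R →
      ‖leftTransChart E H (unitChart E H (c t)) (Z t) - Z t‖ ≤ ε * δ := fun t ht hct => by
    calc ‖leftTransChart E H (unitChart E H (c t)) (Z t) - Z t‖
        = ‖(leftTransChart E H (unitChart E H (c t)) - 1) (Z t)‖ := by simp
      _ ≤ ‖leftTransChart E H (unitChart E H (c t)) - 1‖ * ‖Z t‖ :=
        ContinuousLinearMap.le_opNorm _ _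
      _ ≤ ε * δ := mul_le_mul (hder t hct).2.1.le (hZ t ht) (norm_nonneg _) hε.le
  have hstay : ∀ t ∈ Icc (0 : ℝ) 1,
      c t ∈ (unitChart E H).source ∩ unitChart E H ⁻¹' Metric.ball o R := by
    by_contra! hcon
    set T := {t ∈ Icc (0 : ℝ) 1 |
      c t ∉ (unitChart E H).source ∩ unitChart E H ⁻¹' Metric.ball o R} with hT
    have hTcl : IsClosed T := isClosed_Icc.inter (hop.isClosed_compl.preimage hcc)
    have hTne : T.Nonempty := hcon
    have hTbdd : BddBelow T := ⟨0, fun t ht => ht.1.1⟩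
    set t₀ := sInf T with ht₀
    have ht₀T : t₀ ∈ T := hTcl.csInf_mem hTne hTbdd
    have hlt : ∀ t ∈ Ico 0 t₀, c t ∈ (unitChart E H).source ∩ unitChart E H ⁻¹' Metric.ball o R := by
      intro t ht
      by_contra hn
      exact absurd (csInf_le hTbdd (show t ∈ T from ⟨⟨ht.1, ht.2.le.trans ht₀T.1.2⟩, hn⟩))
        (not_le.2 ht.2)
    have h0 : 0 < t₀ := by
      rcases ht₀T.1.1.lt_or_eq with h | h
      · exact h
      · refine absurd ?_ ht₀T.2
        rw [← h, hc0]
        exact ⟨one_mem_unitChart_source, Metric.mem_ball_self hR⟩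
    have hle : ∀ t ∈ Icc 0 t₀, c t ∈ (unitChart E H).symm '' Metric.closedBall o R := by
      have : Icc 0 t₀ ⊆ c ⁻¹' ((unitChart E H).symm '' Metric.closedBall o R) := by
        rw [← closure_Ico h0.ne]
        exact closure_minimal (fun t ht => hsub t (hlt t ht)) (hcl.preimage hcc)
      exact this
    -- The mean value inequality up to the exit time `t₀ ≤ 1` keeps the curve strictly inside the
    -- ball, contradicting the choice of `t₀`.
    have hmv := norm_image_sub_le_of_norm_deriv_le_segment' (a := 0) (b := t₀)
      (f := fun s => unitChart E H (c s)) (C := (1 + ε) * δ)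
      (fun t ht => (hder t (hle t ht)).2.2.hasDerivWithinAt)
      (fun t ht => by
        have ht1 : t ∈ Icc (0 : ℝ) 1 := ⟨ht.1, ht.2.le.trans ht₀T.1.2⟩
        calc _ ≤ ‖leftTransChart E H (unitChart E H (c t)) (Z t) - Z t‖ + ‖Z t‖ := by
              simpa using norm_add_le (leftTransChart E H (unitChart E H (c t)) (Z t) - Z t) (Z t)
          _ ≤ ε * δ + δ := add_le_add (hbound t ht1 (hle t ⟨ht.1, ht.2.le⟩)) (hZ t ht1)
          _ = (1 + ε) * δ := by ring)
      t₀ ⟨h0.le, le_rfl⟩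
    have hδ0 : 0 ≤ δ := (norm_nonneg _).trans (hZ 0 ⟨le_rfl, zero_le_one⟩)
    refine ht₀T.2 ⟨(hder t₀ (hle t₀ ⟨h0.le, le_rfl⟩)).1, ?_⟩
    rw [hc0] at hmv
    rw [mem_preimage, Metric.mem_ball, dist_eq_norm]
    refine hmv.trans_lt (lt_of_le_of_lt ?_ hδ')
    have : (1 + ε) * δ * (t₀ - 0) ≤ (1 + ε) * δ * 1 :=
      mul_le_mul_of_nonneg_left (by linarith [ht₀T.1.2]) (by positivity)
    linarith
  refine ⟨(hstay 1 ⟨zero_le_one, le_rfl⟩).1, ?_⟩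
  have hint : ∀ t, HasDerivAt (fun t => ∫ s in (0 : ℝ)..t, Z s) (Z t) t := fun t =>
    intervalIntegral.integral_hasDerivAt_right (hZc.intervalIntegrable _ _)
      hZc.aestronglyMeasurable.stronglyMeasurableAtFilter hZc.continuousAt
  -- Subtracting the primitive of `Z` leaves the derivative `(L_x - 1) Z`, which is bounded by `ε
  -- δ`.
  have hmv := norm_image_sub_le_of_norm_deriv_le_segment_01'
      (f := fun s => unitChart E H (c s) - ∫ u in (0 : ℝ)..s, Z u) (C := ε * δ)
      (fun t ht => ((hder t (hsub t (hstay t ht))).2.2.sub (hint t)).hasDerivWithinAt)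
      (fun t ht => hbound t ⟨ht.1, ht.2.le⟩ (hsub t (hstay t ⟨ht.1, ht.2.le⟩)))
  have e : unitChart E H (c 1) - o - ∫ t in (0 : ℝ)..1, Z t =
      unitChart E H (c 1) - (∫ u in (0 : ℝ)..1, Z u) -
        (unitChart E H (c 0) - ∫ u in (0 : ℝ)..0, Z u) := by
    rw [hc0, intervalIntegral.integral_same]; abel
  rw [e]
  exact hmv

/-- The exponential map of `H`. -/
def groupExp (X : E) : H := (exists_isOneParam X).choose 1

theorem IsOneParam.apply_one {γ : ℝ → H} {X : E} (h : IsOneParam γ X) : γ 1 = groupExp X :=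
  congrFun (h.unique (exists_isOneParam X).choose_spec) 1

theorem IsOneParam.apply_eq {γ : ℝ → H} {X : E} (h : IsOneParam γ X) (t : ℝ) :
    γ t = groupExp (t • X) := by
  rw [← (h.comp_mul t).apply_one, mul_one]

variable (H) in
theorem isOneParam_groupExp (X : E) : IsOneParam (fun t : ℝ => (groupExp (t • X) : H)) X := by
  obtain ⟨γ, h⟩ := exists_isOneParam (H := H) X
  rwa [← show γ = fun t : ℝ => (groupExp (t • X) : H) from funext h.apply_eq]

theorem groupExp_zero : (groupExp (0 : E) : H) = 1 := by
  simpa using (isOneParam_groupExp H (0 : E)).map_zero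

theorem groupExp_neg (X : E) : (groupExp (-X) : H) = (groupExp X)⁻¹ := by
  simpa using (isOneParam_groupExp H X).map_neg 1

theorem groupExp_add_smul (a b : ℝ) (X : E) :
    (groupExp ((a + b) • X) : H) = groupExp (a • X) * groupExp (b • X) :=
  (isOneParam_groupExp H X).1 a b

theorem groupExp_conj (g : H) (X : E) : (groupExp (conjDeriv g X) : H) = g * groupExp X * g⁻¹ := by
  simpa using (((isOneParam_groupExp H X).conj g).apply_one).symm

theorem conjDeriv_groupExp (X : E) :
    (conjDeriv (groupExp X : H) : E →L[ℝ] E) = NormedSpace.exp (adBil E H X) := by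
  simpa using (isOneParam_groupExp H X).conjDeriv_eq_exp 1

/-- With `c(t) = e^{t(X+Y)} e^{-tX}`, the quotient `c(t)⁻¹ c(s)` is the conjugate by `e^{tX}` of
`e^{(s-t)(X+Y)} e^{-(s-t)X}`, whose velocity at `s = t` is `(X + Y) - X`. The curve ends at `e^{X+Y}
e^{-X}`, so integrating its velocity computes the derivative of the exponential map without assuming
that map differentiable. -/
theorem hasLeftVelocityAt_groupExp (X Y : E) (t : ℝ) :
    HasLeftVelocityAt (fun t : ℝ => (groupExp (t • (X + Y)) : H) * (groupExp (t • X))⁻¹) t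
      (conjDeriv (groupExp (t • X) : H) Y) := by
  have h1 := (isOneParam_groupExp H (X + Y)).hasModelDerivAt_sub t
  have h2 := (isOneParam_groupExp H (-X)).hasModelDerivAt_sub t
  have h3 := HasModelDerivAt.conj (groupExp (t • X) : H)
    (HasModelDerivAt.mul_of_eq_one h1 h2 (by simp [groupExp_zero]) (by simp [groupExp_zero]))
    (by simp [groupExp_zero])
  refine (h3.congr_deriv (by ext; simp)).congr_fun fun s => ?_
  have e1 : (groupExp (s • (X + Y)) : H) =
      groupExp (t • (X + Y)) * groupExp ((s - t) • (X + Y)) := by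
    rw [← groupExp_add_smul]; congr 2; ring
  have e2 : (groupExp (s • X) : H) = groupExp (t • X) * groupExp ((s - t) • X) := by
    rw [← groupExp_add_smul]; congr 2; ring
  simp only [e1, e2, smul_neg, groupExp_neg]
  group

/-- The right logarithmic derivative of the exponential map. -/
theorem hasRightLogDerivAt_groupExp (X : E) :
    HasRightLogDerivAt 𝓘(ℝ, E) (fun X : E => (groupExp X : H)) X (expMean (adBil E H X)) := by
  have : CompleteSpace E := FiniteDimensional.complete ℝ E
  have hcont : Continuous fun t : ℝ => NormedSpace.exp (t • adBil E H X) :=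
    continuous_iff_continuousAt.2 fun t =>
      (hasDerivAt_exp_smul_const (𝕂 := ℝ) (adBil E H X) t).continuousAt
  obtain ⟨C, hC⟩ := isCompact_Icc.exists_bound_of_continuousOn (s := Icc (0 : ℝ) 1)
    hcont.continuousOn
  set D := max C 1 with hD
  have hDpos : 0 < D := lt_of_lt_of_le one_pos (le_max_right _ _)
  have key : ∀ ε > 0, ∀ᶠ Z in 𝓝 X, (groupExp Z : H) * (groupExp X)⁻¹ ∈ (unitChart E H).source ∧
      ‖unitChart E H ((groupExp Z : H) * (groupExp X)⁻¹) - unitChart E H 1 -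
        expMean (adBil E H X) (Z - X)‖ ≤ ε * ‖Z - X‖ := by
    intro ε hε
    -- The velocity `e^{t ad X}(Z - X)` is bounded by `D ‖Z - X‖`, so precision `ε / D` yields the
    -- error `ε ‖Z - X‖`.
    obtain ⟨r, hr, h⟩ := exists_radius_unitChart_endpoint (E := E) (H := H) (ε / D) (by positivity)
    filter_upwards [Metric.ball_mem_nhds X (show 0 < r / D by positivity)] with Z hZ
    rw [Metric.mem_ball, dist_eq_norm, lt_div_iff₀ hDpos, mul_comm] at hZ
    obtain ⟨h1, h2⟩ := h
      (fun t => (groupExp (t • (X + (Z - X))) : H) * (groupExp (t • X))⁻¹)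
      (fun t => NormedSpace.exp (t • adBil E H X) (Z - X)) (D * ‖Z - X‖) (by simp [groupExp_zero])
      (hcont.clm_apply continuous_const)
      (fun t => by
        have := hasLeftVelocityAt_groupExp (H := H) X (Z - X) t
        rwa [conjDeriv_groupExp, map_smul] at this)
      (fun t ht => (ContinuousLinearMap.le_opNorm _ _).trans
        (mul_le_mul_of_nonneg_right ((hC t ht).trans (le_max_left _ _)) (norm_nonneg _))) hZ
    simp only [one_smul, add_sub_cancel] at h1 h2
    refine ⟨h1, ?_⟩
    rw [expMean, ContinuousLinearMap.intervalIntegral_apply (hcont.intervalIntegrable _ _)]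
    refine h2.trans (le_of_eq ?_)
    field_simp
  refine hasModelDerivAt_of_unitChart (by simp) ((key 1 one_pos).mono fun Z hZ => hZ.1) ?_
  refine .of_isLittleO (Asymptotics.isLittleO_iff.2 fun ε hε => ?_)
  filter_upwards [key ε hε] with Z hZ
  rw [mul_inv_cancel]
  exact hZ.2

end Exponential

/-! ### Complex manifolds and Lie groups as real ones. -/

section RestrictScalars

variable {F : Type*} [NormedAddCommGroup F] [NormedSpace ℂ F] {K : Type*} [TopologicalSpace K]
  {M : Type*} [TopologicalSpace M] [ChartedSpace K M]
  {F' : Type*} [NormedAddCommGroup F'] [NormedSpace ℂ F'] {K' : Type*} [TopologicalSpace K']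
  {M' : Type*} [TopologicalSpace M'] [ChartedSpace K' M']

theorem extChartAt_congr_model {I : ModelWithCorners ℂ F K} {J : ModelWithCorners ℝ F K}
    (h : I.toPartialEquiv = J.toPartialEquiv) (x : M) : extChartAt I x = extChartAt J x := by
  simp only [extChartAt, OpenPartialHomeomorph.extend, h]

theorem ContMDiff.restrict_real {I : ModelWithCorners ℂ F K} {J : ModelWithCorners ℝ F K}
    {I' : ModelWithCorners ℂ F' K'} {J' : ModelWithCorners ℝ F' K'}
    (h : I.toPartialEquiv = J.toPartialEquiv) (h' : I'.toPartialEquiv = J'.toPartialEquiv)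
    {f : M → M'} {n : ℕ∞ω} (hf : ContMDiff I I' n f) : ContMDiff J J' n f := by
  intro x
  have hx := contMDiffAt_iff.1 (hf x)
  refine contMDiffAt_iff.2 ⟨hx.1, ?_⟩
  rw [← extChartAt_congr_model h, ← extChartAt_congr_model h']
  have hr : range J = range I := by
    change range J.toPartialEquiv = range I.toPartialEquiv
    rw [h]
  rw [hr]
  exact hx.2.restrict_scalars ℝ

theorem isManifold_real {M : Type*} [TopologicalSpace M] [ChartedSpace F M] {n : ℕ∞ω}
    [IsManifold 𝓘(ℂ, F) n M] : IsManifold 𝓘(ℝ, F) n M := by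
  refine isManifold_of_contDiffOn _ _ _ fun e e' he he' => ?_
  have h := (contDiffGroupoid n 𝓘(ℂ, F)).compatible he he'
  exact (mem_groupoid_of_pregroupoid.1 h).1.restrict_scalars ℝ

theorem lieGroup_real {M : Type*} [TopologicalSpace M] [ChartedSpace F M] [Group M]
    [LieGroup 𝓘(ℂ, F) ω M] : LieGroup 𝓘(ℝ, F) ∞ M := by
  have : IsManifold 𝓘(ℂ, F) ω M := LieGroup.toContMDiffMul.toIsManifold
  have : IsManifold 𝓘(ℝ, F) ω M := isManifold_real
  have : LieGroup 𝓘(ℝ, F) ω M :=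
    { contMDiff_mul := ContMDiff.restrict_real rfl rfl (contMDiff_mul 𝓘(ℂ, F) ω)
      contMDiff_inv := ContMDiff.restrict_real rfl rfl (contMDiff_inv 𝓘(ℂ, F) ω) }
  exact LieGroup.of_le (n := ω) le_top

theorem modelDeriv_smul {M : Type*} [TopologicalSpace M] [ChartedSpace F M]
    {M' : Type*} [TopologicalSpace M'] [ChartedSpace F' M'] {f : M → M'} {p : M}
    (hf : MDifferentiableAt 𝓘(ℂ, F) 𝓘(ℂ, F') f p) (c : ℂ) (v : F) :
    modelDeriv 𝓘(ℝ, F) 𝓘(ℝ, F') f p (c • v) = c • modelDeriv 𝓘(ℝ, F) 𝓘(ℝ, F') f p v := by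
  obtain ⟨L, hL⟩ : ∃ L : F →L[ℂ] F', HasMFDerivAt 𝓘(ℂ, F) 𝓘(ℂ, F') f p L := ⟨_, hf.hasMFDerivAt⟩
  have h : HasModelDerivAt 𝓘(ℝ, F) 𝓘(ℝ, F') f p (L.restrictScalars ℝ) :=
    ⟨hL.1, HasFDerivWithinAt.restrictScalars ℝ hL.2⟩
  rw [h.modelDeriv_eq]
  simp

end RestrictScalars

/-! ### Complex bilinearity of the bracket of a complex Lie group. -/

section ComplexGroup

variable {EC : Type*} [NormedAddCommGroup EC] [NormedSpace ℂ EC]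
  {GC : Type*} [TopologicalSpace GC] [ChartedSpace EC GC] [Group GC] [LieGroup 𝓘(ℂ, EC) ω GC]

theorem conjDeriv_smul_complex (g : GC) (c : ℂ) (v : EC) :
    conjDeriv g (c • v) = c • (conjDeriv g v : EC) :=
  modelDeriv_smul (((contMDiff_mul_right (I := 𝓘(ℂ, EC)) (n := ω)).mdifferentiable (by simp)
    _).comp _ ((contMDiff_mul_left (I := 𝓘(ℂ, EC)) (n := ω)).mdifferentiable (by simp) _)) c v

theorem modelDeriv_mul_right_smul_complex (g : GC) (c : ℂ) (v : EC) :
    modelDeriv 𝓘(ℝ, EC) 𝓘(ℝ, EC) (fun x : GC => x * g) 1 (c • v) =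
      c • modelDeriv 𝓘(ℝ, EC) 𝓘(ℝ, EC) (fun x : GC => x * g) 1 v :=
  modelDeriv_smul ((contMDiff_mul_right (I := 𝓘(ℂ, EC)) (n := ω)).mdifferentiable (by simp) _) c v

variable [FiniteDimensional ℂ EC] [T2Space GC]

/-- Conjugations are holomorphic, so `Ad` acts by complex-linear operators, and so does its
derivative along a one-parameter subgroup. Antisymmetry then gives linearity in the other argument.
-/
theorem adBil_smul_right_complex (X : EC) (c : ℂ) (W : EC) :
    adBil EC GC X (c • W) = c • adBil EC GC X W := by
  have : LieGroup 𝓘(ℝ, EC) ∞ GC := lieGroup_real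
  obtain ⟨γ, hγ⟩ := exists_isOneParam (H := GC) X
  have h := hasDerivAt_conjDeriv hγ.2 hγ.map_zero
  have h1 := h.clm_apply (hasDerivAt_const (0 : ℝ) (c • W))
  have h2 := (h.clm_apply (hasDerivAt_const (0 : ℝ) W)).const_smul c
  simp only [map_zero, add_zero] at h1 h2
  refine h1.unique (h2.congr_of_eventuallyEq (Eventually.of_forall fun t => ?_))
  exact conjDeriv_smul_complex _ _ _

theorem adBil_smul_left_complex (X : EC) (c : ℂ) (W : EC) :
    adBil EC GC (c • X) W = c • adBil EC GC X W := by
  rw [adBil_swap, adBil_smul_right_complex, adBil_swap W X, smul_neg, neg_neg]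

end ComplexGroup

/-! ### Complexifications, real forms and conjugation. -/

section ComplexTensor

variable {V : Type*} [AddCommGroup V] [Module ℝ V] {V' : Type*} [AddCommGroup V'] [Module ℝ V']
  {W : Type*} [AddCommGroup W] [Module ℂ W]

theorem exists_eq_tmul_add (w : ℂ ⊗[ℝ] V) :
    ∃ a b : V, w = (1 : ℂ) ⊗ₜ[ℝ] a + Complex.I ⊗ₜ[ℝ] b := by
  induction w using TensorProduct.induction_on with
  | zero => exact ⟨0, 0, by simp⟩
  | tmul z v =>
    refine ⟨z.re • v, z.im • v, ?_⟩
    rw [← TensorProduct.smul_tmul, ← TensorProduct.smul_tmul, ← TensorProduct.add_tmul]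
    congr 1
    simp [Complex.re_add_im]
  | add x y hx hy =>
    obtain ⟨a, b, rfl⟩ := hx
    obtain ⟨a', b', rfl⟩ := hy
    exact ⟨a + a', b + b', by rw [TensorProduct.tmul_add, TensorProduct.tmul_add]; abel⟩

theorem tmul_add_tmul_inj {a b a' b' : V} :
    (1 : ℂ) ⊗ₜ[ℝ] a + Complex.I ⊗ₜ[ℝ] b = (1 : ℂ) ⊗ₜ[ℝ] a' + Complex.I ⊗ₜ[ℝ] b' ↔
      a = a' ∧ b = b' := by
  refine ⟨fun h => ⟨?_, ?_⟩, fun h => by rw [h.1, h.2]⟩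
  · simpa using congrArg (fun w => TensorProduct.lid ℝ V (Complex.reLm.rTensor V w)) h
  · simpa using congrArg (fun w => TensorProduct.lid ℝ V (Complex.imLm.rTensor V w)) h

theorem I_smul_tmul_add (a b : V) :
    Complex.I • ((1 : ℂ) ⊗ₜ[ℝ] a + Complex.I ⊗ₜ[ℝ] b) =
      (1 : ℂ) ⊗ₜ[ℝ] (-b) + Complex.I ⊗ₜ[ℝ] a := by
  rw [smul_add, TensorProduct.smul_tmul', TensorProduct.smul_tmul', smul_eq_mul, mul_one,
    smul_eq_mul, Complex.I_mul_I, TensorProduct.neg_tmul, TensorProduct.tmul_neg, add_comm]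

theorem baseChange_tmul_add (L : V →ₗ[ℝ] V') (a b : V) :
    L.baseChange ℂ ((1 : ℂ) ⊗ₜ[ℝ] a + Complex.I ⊗ₜ[ℝ] b) =
      (1 : ℂ) ⊗ₜ[ℝ] L a + Complex.I ⊗ₜ[ℝ] L b := by
  simp

theorem mem_ker_baseChange_iff (L : V →ₗ[ℝ] V') (a b : V) :
    (1 : ℂ) ⊗ₜ[ℝ] a + Complex.I ⊗ₜ[ℝ] b ∈ LinearMap.ker (L.baseChange ℂ) ↔ L a = 0 ∧ L b = 0 := by
  rw [LinearMap.mem_ker, baseChange_tmul_add, ← tmul_add_tmul_inj (a' := (0 : V')) (b' := 0)]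
  simp

theorem mem_map_baseChange_iff (e : V ≃ₗ[ℝ] V') (P : Submodule ℂ (ℂ ⊗[ℝ] V)) (a b : V') :
    (1 : ℂ) ⊗ₜ[ℝ] a + Complex.I ⊗ₜ[ℝ] b ∈ P.map (e.toLinearMap.baseChange ℂ) ↔
      (1 : ℂ) ⊗ₜ[ℝ] e.symm a + Complex.I ⊗ₜ[ℝ] e.symm b ∈ P := by
  constructor
  · rintro ⟨w, hw, h⟩
    obtain ⟨a', b', rfl⟩ := exists_eq_tmul_add w
    rw [baseChange_tmul_add, tmul_add_tmul_inj] at h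
    rw [← h.1, ← h.2]
    simpa using hw
  · intro h
    exact ⟨_, h, by simp⟩

/-- The extension of a real-linear map to the complexification. -/
def complexLift [Module ℝ W] [IsScalarTower ℝ ℂ W] (j : V →ₗ[ℝ] W) : ℂ ⊗[ℝ] V →ₗ[ℂ] W :=
  j.liftBaseChange ℂ

variable [Module ℝ W] [IsScalarTower ℝ ℂ W]

theorem complexLift_tmul_add (j : V →ₗ[ℝ] W) (a b : V) :
    complexLift j ((1 : ℂ) ⊗ₜ[ℝ] a + Complex.I ⊗ₜ[ℝ] b) = j a + Complex.I • j b := by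
  simp [complexLift]

/-- `j` identifies `W` with the complexification of `V`. -/
def IsComplexForm (j : V →ₗ[ℝ] W) : Prop :=
  ∀ Z : W, ∃! UV : V × V, Z = j UV.1 + Complex.I • j UV.2

theorem IsComplexForm.bijective {j : V →ₗ[ℝ] W} (hj : IsComplexForm j) :
    Function.Bijective (complexLift j) := by
  refine ⟨fun w w' h => ?_, fun Z => ?_⟩
  · obtain ⟨a, b, rfl⟩ := exists_eq_tmul_add w
    obtain ⟨a', b', rfl⟩ := exists_eq_tmul_add w'
    rw [complexLift_tmul_add, complexLift_tmul_add] at h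
    have := (hj _).unique (y₁ := (a, b)) (y₂ := (a', b')) rfl h
    rw [Prod.mk.injEq] at this
    rw [this.1, this.2]
  · obtain ⟨⟨a, b⟩, h, -⟩ := hj Z
    exact ⟨(1 : ℂ) ⊗ₜ[ℝ] a + Complex.I ⊗ₜ[ℝ] b, by rw [complexLift_tmul_add, h]⟩

/-- The identification of `ℂ ⊗ V` with `W`. -/
def IsComplexForm.equiv {j : V →ₗ[ℝ] W} (hj : IsComplexForm j) : (ℂ ⊗[ℝ] V) ≃ₗ[ℂ] W :=
  LinearEquiv.ofBijective (complexLift j) hj.bijective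

theorem IsComplexForm.injective {j : V →ₗ[ℝ] W} (hj : IsComplexForm j) : Function.Injective j := by
  intro a a' h
  have := (hj (j a)).unique (y₁ := (a, 0)) (y₂ := (a', 0)) (by simp) (by simp [h])
  exact congrArg Prod.fst this

theorem IsComplexForm.prod {j : V →ₗ[ℝ] W} (hj : IsComplexForm j) (e : V' ≃ₗ[ℝ] V × V) :
    IsComplexForm ((j.prodMap j).comp e.toLinearMap) := by
  intro Z
  obtain ⟨⟨a, b⟩, h, hu⟩ := hj Z.1
  obtain ⟨⟨a', b'⟩, h', hu'⟩ := hj Z.2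
  refine ⟨(e.symm (a, a'), e.symm (b, b')), ?_, ?_⟩
  · ext <;> simp [h, h']
  · rintro ⟨c, d⟩ hcd
    have h1 := hu ((e c).1, (e d).1) (by simpa using congrArg Prod.fst hcd)
    have h2 := hu' ((e c).2, (e d).2) (by simpa using congrArg Prod.snd hcd)
    rw [Prod.mk.injEq] at h1 h2
    rw [Prod.mk.injEq, LinearEquiv.eq_symm_apply, LinearEquiv.eq_symm_apply]
    exact ⟨Prod.ext h1.1 h2.1, Prod.ext h1.2 h2.2⟩

/-- The conjugation of `W` fixing `V`. -/
def IsComplexForm.conj {j : V →ₗ[ℝ] W} (hj : IsComplexForm j) : W →ₗ[ℝ] W :=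
  (hj.equiv.toLinearMap.restrictScalars ℝ).comp
    ((Complex.conjAe.toLinearMap.rTensor V).comp (hj.equiv.symm.toLinearMap.restrictScalars ℝ))

theorem IsComplexForm.conj_apply {j : V →ₗ[ℝ] W} (hj : IsComplexForm j) (a b : V) :
    hj.conj (j a + Complex.I • j b) = j a - Complex.I • j b := by
  have h1 : hj.equiv.symm (j a + Complex.I • j b) =
      (1 : ℂ) ⊗ₜ[ℝ] a + Complex.I ⊗ₜ[ℝ] b := by
    rw [LinearEquiv.symm_apply_eq]; exact (complexLift_tmul_add j a b).symm
  have h2 : hj.conj (j a + Complex.I • j b) = complexLift j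
      (Complex.conjAe.toLinearMap.rTensor V (hj.equiv.symm (j a + Complex.I • j b))) := rfl
  rw [h2, h1, map_add, LinearMap.rTensor_tmul, LinearMap.rTensor_tmul]
  simp [complexLift, sub_eq_add_neg]

theorem IsComplexForm.conj_real {j : V →ₗ[ℝ] W} (hj : IsComplexForm j) (a : V) :
    hj.conj (j a) = j a := by
  simpa using hj.conj_apply a 0

theorem IsComplexForm.conj_I_smul {j : V →ₗ[ℝ] W} (hj : IsComplexForm j) (w : W) :
    hj.conj (Complex.I • w) = -(Complex.I • hj.conj w) := by
  obtain ⟨⟨a, b⟩, h, -⟩ := hj w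
  have e : Complex.I • w = j (-b) + Complex.I • j a := by
    rw [h, smul_add, smul_smul, Complex.I_mul_I, map_neg]; simp [add_comm]
  rw [e, hj.conj_apply, h, hj.conj_apply, smul_sub, smul_smul, Complex.I_mul_I, map_neg]
  simp only [neg_smul, one_smul]
  abel

theorem IsComplexForm.conj_smul {j : V →ₗ[ℝ] W} (hj : IsComplexForm j) (z : ℂ) (w : W) :
    hj.conj (z • w) = conj z • hj.conj w := by
  have e : z • w = z.re • w + z.im • (Complex.I • w) := by
    rw [← algebraMap_smul ℂ z.re, ← algebraMap_smul ℂ z.im, smul_smul, ← add_smul]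
    simp [Complex.re_add_im]
  have e' : conj z • hj.conj w = z.re • hj.conj w - z.im • (Complex.I • hj.conj w) := by
    rw [← algebraMap_smul ℂ z.re, ← algebraMap_smul ℂ z.im, smul_smul, ← sub_smul]
    congr 1
    apply Complex.ext <;> simp
  rw [e, map_add, map_smul, map_smul, hj.conj_I_smul, e', smul_neg, sub_eq_add_neg]

/-- The complex-linear extension of a real operator. -/
def IsComplexForm.extend {j : V →ₗ[ℝ] W} (hj : IsComplexForm j) (L : V →ₗ[ℝ] V) : W →ₗ[ℂ] W :=
  hj.equiv.toLinearMap.comp ((L.baseChange ℂ).comp hj.equiv.symm.toLinearMap)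

theorem IsComplexForm.extend_apply {j : V →ₗ[ℝ] W} (hj : IsComplexForm j) (L : V →ₗ[ℝ] V) (a : V) :
    hj.extend L (j a) = j (L a) := by
  have h1 : hj.equiv.symm (j a) = (1 : ℂ) ⊗ₜ[ℝ] a := by
    rw [LinearEquiv.symm_apply_eq]; simp [IsComplexForm.equiv, complexLift]
  have h2 : hj.extend L (j a) = complexLift j (L.baseChange ℂ (hj.equiv.symm (j a))) := rfl
  rw [h2, h1]
  simp [complexLift]

end ComplexTensor

/-! ### Holomorphic families of graphs and the identity theorem. -/

section HolomorphicFamilies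

variable {W : Type*} [AddCommGroup W] [Module ℂ W]

theorem IsHolomorphicFamily.comp {Z Z' : Type*} [NormedAddCommGroup Z] [NormedSpace ℂ Z]
    [NormedAddCommGroup Z'] [NormedSpace ℂ Z'] {P : Z → Submodule ℂ W}
    (hP : IsHolomorphicFamily P) {f : Z' → Z} (hf : ∀ z, AnalyticAt ℂ f z) :
    IsHolomorphicFamily fun z => P (f z) := by
  intro z₀
  obtain ⟨k, e, he, hs⟩ := hP (f z₀)
  exact ⟨k, fun j z => e j (f z), fun j l => (he j l).comp (hf z₀),
    (hf z₀).continuousAt.eventually hs⟩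

/-- A fixed basis `b` of `V` gives the global frame `(-K(z) b_j, b_j)`. It is independent because
its second components are. -/
theorem isHolomorphicFamily_graph {Z : Type*} [NormedAddCommGroup Z] [NormedSpace ℂ Z]
    {V : Type*} [NormedAddCommGroup V] [NormedSpace ℂ V] [FiniteDimensional ℂ V]
    (Ψ : W ≃ₗ[ℂ] V × V) (K : Z → V →L[ℂ] V) (hK : ∀ z, AnalyticAt ℂ K z)
    (P : Z → Submodule ℂ W) (hP : ∀ z w, w ∈ P z ↔ (Ψ w).1 + K z (Ψ w).2 = 0) :
    IsHolomorphicFamily P := by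
  intro z₀
  set b := Module.finBasis ℂ V
  refine ⟨_, fun j z => Ψ.symm (-K z (b j), b j), fun j l => ?_, Eventually.of_forall fun z => ⟨?_, ?_⟩⟩
  · set m : V × V →L[ℂ] ℂ := LinearMap.toContinuousLinearMap (l.comp Ψ.symm.toLinearMap)
    have h1 : AnalyticAt ℂ (fun z => (-K z (b j), b j)) z₀ :=
      (((ContinuousLinearMap.apply ℂ V (b j)).analyticAt _).comp (hK z₀)).neg.prod analyticAt_const
    exact (m.analyticAt _).comp h1
  · have h := b.linearIndependent
    have h2 : (fun j => b j) = (LinearMap.snd ℂ V V).comp Ψ.toLinearMap ∘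
        fun j => Ψ.symm (-K z (b j), b j) := by
      ext j; simp
    exact LinearIndependent.of_comp ((LinearMap.snd ℂ V V).comp Ψ.toLinearMap) (h2 ▸ h)
  · refine le_antisymm (Submodule.span_le.2 ?_) fun w hw => ?_
    · rintro _ ⟨j, rfl⟩
      rw [SetLike.mem_coe, hP]
      simp
    · have hw' : w = ∑ j, b.repr (Ψ w).2 j • Ψ.symm (-K z (b j), b j) := by
        apply Ψ.injective
        rw [map_sum]
        simp only [map_smul, LinearEquiv.apply_symm_apply, Prod.smul_mk, smul_neg]
        refine Prod.ext ?_ ?_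
        · simp only [Prod.fst_sum, Finset.sum_neg_distrib, ← map_smul, ← map_sum, b.sum_repr]
          exact eq_neg_of_add_eq_zero_left ((hP z w).1 hw)
        · simp only [Prod.snd_sum, b.sum_repr]
      rw [hw']
      exact Submodule.sum_mem _ fun j _ => Submodule.smul_mem _ _ (Submodule.subset_span ⟨j, rfl⟩)

theorem finrank_graph {V : Type*} [NormedAddCommGroup V] [NormedSpace ℂ V]
    (Ψ : W ≃ₗ[ℂ] V × V) (K : V →L[ℂ] V)
    (P : Submodule ℂ W) (hP : ∀ w, w ∈ P ↔ (Ψ w).1 + K (Ψ w).2 = 0) :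
    Module.finrank ℂ P = Module.finrank ℂ V := by
  refine LinearEquiv.finrank_eq (LinearEquiv.ofBijective
    (((LinearMap.snd ℂ V V).comp Ψ.toLinearMap).comp P.subtype) ⟨?_, fun v => ?_⟩)
  · rw [← LinearMap.ker_eq_bot, LinearMap.ker_eq_bot']
    rintro ⟨w, hw⟩ h
    have h2 : (Ψ w).2 = 0 := h
    have h1 := (hP w).1 hw
    rw [h2, map_zero, add_zero] at h1
    have : Ψ w = 0 := Prod.ext h1 h2
    simpa using this
  · exact ⟨⟨Ψ.symm (-K v, v), (hP _).2 (by simp)⟩, by simp⟩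

/-- The length of a local frame is locally constant, and `ℂ` is connected. -/
theorem IsHolomorphicFamily.finrank_eq {P : ℂ → Submodule ℂ W} (hP : IsHolomorphicFamily P) :
    ∀ z, Module.finrank ℂ (P z) = Module.finrank ℂ (P 0) := by
  have : IsLocallyConstant fun z => Module.finrank ℂ (P z) := by
    refine (IsLocallyConstant.iff_eventually_eq _).2 fun z₀ => ?_
    obtain ⟨k, e, -, he⟩ := hP z₀
    have h : ∀ᶠ z in 𝓝 z₀, Module.finrank ℂ (P z) = k := by
      filter_upwards [he] with z hz
      rw [← hz.2, finrank_span_eq_card hz.1, Fintype.card_fin]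
    filter_upwards [h] with z hz
    rw [hz, h.self_of_nhds]
  intro z
  exact this.apply_eq_of_preconnectedSpace z 0

/-- Identity theorem: a holomorphic family that agrees on the real axis with an entire family of
graphs agrees with it everywhere. -/
theorem eq_of_eq_on_real [FiniteDimensional ℂ W]
    {V : Type*} [NormedAddCommGroup V] [NormedSpace ℂ V] [FiniteDimensional ℂ V]
    (Ψ : W ≃ₗ[ℂ] V × V) (K : ℂ → V →L[ℂ] V) (hK : ∀ z, AnalyticAt ℂ K z)
    (P : ℂ → Submodule ℂ W) (hP : ∀ z w, w ∈ P z ↔ (Ψ w).1 + K z (Ψ w).2 = 0)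
    {P' : ℂ → Submodule ℂ W} (hP' : IsHolomorphicFamily P') (h : ∀ s : ℝ, P' s = P s) (z : ℂ) :
    P' z = P z := by
  -- Inclusion in a graph is the vanishing of an analytic expression in the local frame of `P'`, so
  -- inclusion at points accumulating at `z₀` forces it near `z₀`.
  have step : ∀ z₀, (∃ᶠ z in 𝓝[≠] z₀, P' z ≤ P z) → ∀ᶠ z in 𝓝 z₀, P' z ≤ P z := by
    intro z₀ hfr
    obtain ⟨k, e, hea, hes⟩ := hP' z₀
    have hcomp : ∀ (j) (m : W →ₗ[ℂ] V), AnalyticAt ℂ (fun z => m (e j z)) z₀ := by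
      intro j m
      -- Holomorphy of a frame is only given on functionals, so vector-valued analyticity is
      -- assembled from coordinates.
      set c := Module.finBasis ℂ V
      have : (fun z => m (e j z)) = fun z => ∑ i, (c.coord i).comp m (e j z) • c i := by
        ext z; exact (c.sum_repr _).symm
      rw [this]
      exact Finset.analyticAt_fun_sum _ fun i _ => (hea j _).smul analyticAt_const
    have han : ∀ j, AnalyticAt ℂ (fun z => (Ψ (e j z)).1 + K z (Ψ (e j z)).2) z₀ := fun j =>
      (hcomp j ((LinearMap.fst ℂ V V).comp Ψ.toLinearMap)).add
        (((ContinuousLinearMap.id ℂ (V →L[ℂ] V)).analyticAt_bilinear _).comp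
          ((hK z₀).prod (hcomp j ((LinearMap.snd ℂ V V).comp Ψ.toLinearMap))))
    have hz : ∀ j, ∀ᶠ z in 𝓝 z₀, (Ψ (e j z)).1 + K z (Ψ (e j z)).2 = 0 := by
      intro j
      refine ((han j).frequently_zero_iff_eventually_zero).1 ?_
      refine (hfr.and_eventually (hes.filter_mono nhdsWithin_le_nhds)).mono fun z hz => ?_
      rw [← hP]
      exact hz.1 (hz.2.2 ▸ Submodule.subset_span ⟨j, rfl⟩)
    filter_upwards [eventually_all.2 hz, hes] with z h1 h2
    rw [← h2.2, Submodule.span_le]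
    rintro _ ⟨j, rfl⟩
    exact (hP _ _).2 (h1 j)
  have hopen : IsOpen {z₀ | ∀ᶠ z in 𝓝 z₀, P' z ≤ P z} := isOpen_setOfPred_eventually_nhds
  have hclosed : IsClosed {z₀ | ∀ᶠ z in 𝓝 z₀, P' z ≤ P z} := by
    refine isClosed_of_closure_subset fun z₀ hz₀ => ?_
    by_cases hm : z₀ ∈ {z₀ | ∀ᶠ z in 𝓝 z₀, P' z ≤ P z}
    · exact hm
    · refine step z₀ ?_
      have h1 : ∃ᶠ z in 𝓝[≠] z₀, z ∈ {z₀ | ∀ᶠ z in 𝓝 z₀, P' z ≤ P z} := by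
        rw [frequently_nhdsWithin_iff]
        exact (mem_closure_iff_frequently.1 hz₀).mono fun z hz => ⟨hz, fun h => hm (h ▸ hz)⟩
      exact h1.mono fun z (hz : ∀ᶠ z in 𝓝 z, P' z ≤ P z) => hz.self_of_nhds
  -- The nonzero real parameters accumulate at `0`, which starts the clopen argument.
  have hne : {z₀ | ∀ᶠ z in 𝓝 z₀, P' z ≤ P z}.Nonempty := by
    refine ⟨0, step 0 ?_⟩
    have h1 : Tendsto (fun s : ℝ => (s : ℂ)) (𝓝[≠] 0) (𝓝[≠] 0) :=
      tendsto_nhdsWithin_iff.2 ⟨(Complex.continuous_ofReal.tendsto' 0 0 rfl).mono_left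
        nhdsWithin_le_nhds, by filter_upwards [self_mem_nhdsWithin] with s hs; simpa using hs⟩
    exact h1.frequently (Frequently.of_forall fun s => (h s).le)
  have huniv := IsClopen.eq_univ ⟨hclosed, hopen⟩ hne
  have hev : ∀ᶠ z in 𝓝 z, P' z ≤ P z :=
    show z ∈ {z₀ | ∀ᶠ z in 𝓝 z₀, P' z ≤ P z} from huniv ▸ mem_univ z
  have hle : P' z ≤ P z := hev.self_of_nhds
  -- Inclusion becomes equality by rank: both ranks are independent of `z`, and they agree at the
  -- real point `0`.
  refine Submodule.eq_of_le_of_finrank_eq hle ?_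
  have h0 := h 0
  rw [Complex.ofReal_zero] at h0
  rw [hP'.finrank_eq, h0, finrank_graph Ψ (K 0) _ (hP 0),
    finrank_graph Ψ (K z) _ (hP z)]

end HolomorphicFamilies

/-! ### Analyticity and intertwining of operator exponentials. -/

section OperatorExponentials

theorem continuous_exp_smul {A : Type*} [NormedRing A] [NormedAlgebra ℝ A] [CompleteSpace A]
    (a : A) : Continuous fun t : ℝ => NormedSpace.exp (t • a) :=
  continuous_iff_continuousAt.2 fun t =>
    (hasDerivAt_exp_smul_const (𝕂 := ℝ) a t).continuousAt

theorem analyticAt_exp_smul {A : Type*} [NormedRing A] [NormedAlgebra ℂ A] [CompleteSpace A]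
    (a : A) (z : ℂ) : AnalyticAt ℂ (fun z : ℂ => NormedSpace.exp (z • a)) z :=
  (NormedSpace.exp_analytic (𝕂 := ℂ) (z • a)).comp (f := fun z : ℂ => z • a)
    (analyticAt_id.smul analyticAt_const)

theorem analyticAt_expMean_smul {A : Type*} [NormedRing A] [NormedAlgebra ℂ A] [CompleteSpace A]
    (a : A) (z : ℂ) : AnalyticAt ℂ (fun z : ℂ => expMean (z • a)) z := by
  have hexp : Continuous (NormedSpace.exp : A → A) :=
    continuous_iff_continuousAt.2 fun x => (NormedSpace.exp_analytic (𝕂 := ℂ) x).continuousAt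
  have hc : Continuous fun p : ℂ × ℝ => NormedSpace.exp (p.1 • (p.2 • a)) * (p.2 • a) :=
    (hexp.comp (by fun_prop)).mul (by fun_prop)
  have hd : Differentiable ℂ fun z : ℂ => expMean (z • a) := by
    intro z₀
    -- A bound for the `z`-derivative of the integrand on a compact set permits differentiation
    -- under the integral. Complex differentiability everywhere then gives analyticity.
    obtain ⟨C, hC⟩ := ((isCompact_closedBall z₀ 1).prod (isCompact_Icc (a := (0 : ℝ))
      (b := 1))).exists_bound_of_continuousOn hc.continuousOn
    have h := intervalIntegral.hasDerivAt_integral_of_dominated_loc_of_deriv_le (𝕜 := ℂ)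
      (μ := MeasureTheory.volume) (a := 0) (b := 1) (bound := fun _ => C)
      (F := fun z t => NormedSpace.exp (z • (t • a)))
      (F' := fun z t => NormedSpace.exp (z • (t • a)) * (t • a)) (x₀ := z₀)
      (Metric.ball_mem_nhds z₀ one_pos)
      (Eventually.of_forall fun z => (hexp.comp (by fun_prop)).aestronglyMeasurable)
      ((hexp.comp (by fun_prop)).intervalIntegrable _ _)
      ((hc.comp (by fun_prop : Continuous fun t : ℝ => (z₀, t))).aestronglyMeasurable)
      (Eventually.of_forall fun t ht z hz => hC (z, t) ⟨Metric.ball_subset_closedBall hz, by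
        rw [uIoc_of_le zero_le_one] at ht
        exact Ioc_subset_Icc_self ht⟩)
      intervalIntegrable_const
      (Eventually.of_forall fun t _ z _ => hasDerivAt_exp_smul_const (𝕂 := ℂ) (t • a) z)
    refine h.2.differentiableAt.congr_of_eventuallyEq (Eventually.of_forall fun z => ?_)
    simp only [expMean, smul_comm z]
  exact hd.analyticAt z

/-- Termwise in the exponential series. The intended `c` is the conjugation of `𝔤_ℂ`, which is only
real-linear and carries `ad(zU)` to `ad(z̄U)` for `U` in `𝔤`. -/
theorem semiconjBy_exp {A : Type*} [NormedRing A] [NormedAlgebra ℝ A] [CompleteSpace A]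
    {c a b : A} (h : SemiconjBy c a b) : SemiconjBy c (NormedSpace.exp a) (NormedSpace.exp b) := by
  have h1 := (NormedSpace.exp_series_hasSum_exp' (𝕂 := ℝ) a).mul_left c
  have h2 := (NormedSpace.exp_series_hasSum_exp' (𝕂 := ℝ) b).mul_right c
  refine h1.unique ?_
  convert h2 using 2 with n
  rw [mul_smul_comm, smul_mul_assoc, (h.pow_right n).eq]

theorem semiconjBy_expMean {A : Type*} [NormedRing A] [NormedAlgebra ℝ A] [CompleteSpace A]
    {c a b : A} (h : SemiconjBy c a b) : SemiconjBy c (expMean a) (expMean b) := by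
  have h1 := ((ContinuousLinearMap.mul ℝ A) c).intervalIntegral_comp_comm
    ((continuous_exp_smul a).intervalIntegrable (μ := MeasureTheory.volume) 0 1)
  have h2 := ((ContinuousLinearMap.mul ℝ A).flip c).intervalIntegral_comp_comm
    ((continuous_exp_smul b).intervalIntegrable (μ := MeasureTheory.volume) 0 1)
  simp only [ContinuousLinearMap.mul_apply', ContinuousLinearMap.flip_apply] at h1 h2
  rw [SemiconjBy, expMean, expMean, ← h1, ← h2]
  congr 1
  ext t
  exact semiconjBy_exp (by simp only [SemiconjBy, mul_smul_comm, smul_mul_assoc, h.eq])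

theorem exp_apply_of_apply_eq_zero {V : Type*} [NormedAddCommGroup V] [NormedSpace ℝ V]
    [CompleteSpace V] {a : V →L[ℝ] V} {v : V} (h : a v = 0) : NormedSpace.exp a v = v := by
  have h1 : HasDerivAt (fun t : ℝ => NormedSpace.exp (t • a) v) 0 0 := by
    simpa [h] using (hasDerivAt_exp_smul_const (𝕂 := ℝ) a 0).clm_apply (hasDerivAt_const 0 v)
  have h2 : ∀ t, HasDerivAt (fun t : ℝ => NormedSpace.exp (t • a) v) 0 t := fun t => by
    simpa [h] using (hasDerivAt_exp_smul_const (𝕂 := ℝ) a t).clm_apply (hasDerivAt_const t v)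
  simpa using is_const_of_deriv_eq_zero (fun t => (h2 t).differentiableAt) (fun t => (h2 t).deriv) 1 0

theorem expMean_apply_of_apply_eq_zero {V : Type*} [NormedAddCommGroup V] [NormedSpace ℝ V]
    [CompleteSpace V] {a : V →L[ℝ] V} {v : V} (h : a v = 0) : expMean a v = v := by
  rw [expMean, ContinuousLinearMap.intervalIntegral_apply
    ((continuous_exp_smul a).intervalIntegrable _ _)]
  have : ∀ t : ℝ, NormedSpace.exp (t • a) v = v := fun t =>
    exp_apply_of_apply_eq_zero (by simp [h])
  simp [this]

variable {V : Type*} [NormedAddCommGroup V] [NormedSpace ℂ V]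

variable (V) in
/-- Restriction of scalars, as a ring homomorphism between operator algebras. -/
def restrictRingHom : (V →L[ℂ] V) →+* (V →L[ℝ] V) where
  toFun a := a.restrictScalars ℝ
  map_one' := rfl
  map_mul' _ _ := rfl
  map_zero' := rfl
  map_add' _ _ := rfl

theorem continuous_restrictRingHom : Continuous (restrictRingHom V) :=
  (ContinuousLinearMap.restrictScalarsL ℂ V V ℝ ℝ).continuous

variable [CompleteSpace V]

theorem restrictRingHom_exp (a : V →L[ℂ] V) :
    restrictRingHom V (NormedSpace.exp a) = NormedSpace.exp (restrictRingHom V a) := by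
  let _ : NormedAlgebra ℚ (V →L[ℂ] V) := NormedAlgebra.restrictScalars ℚ ℝ _
  let _ : NormedAlgebra ℚ (V →L[ℝ] V) := NormedAlgebra.restrictScalars ℚ ℝ _
  exact NormedSpace.map_exp (restrictRingHom V) continuous_restrictRingHom a

theorem restrictRingHom_expMean (a : V →L[ℂ] V) :
    restrictRingHom V (expMean a) = expMean (restrictRingHom V a) := by
  have h := (ContinuousLinearMap.restrictScalarsL ℂ V V ℝ ℝ).intervalIntegral_comp_comm
    ((continuous_exp_smul a).intervalIntegrable (μ := MeasureTheory.volume) 0 1)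
  refine h.symm.trans (intervalIntegral.integral_congr fun t _ => ?_)
  exact restrictRingHom_exp (t • a)

end OperatorExponentials

/-! ### The adjoint action on `𝔤`, invariant gradients and Cartan subalgebras. -/

section AdjointAction

variable {E : Type*} [NormedAddCommGroup E] [NormedSpace ℝ E]
  {G : Type*} [TopologicalSpace G] [ChartedSpace E G] [Group G]

variable (E) in
/-- The adjoint action as a continuous linear map. -/
def AdL (g : G) : LieAlg E G →L[ℝ] LieAlg E G := (conjDeriv g : E →L[ℝ] E)

variable (E G) in
/-- The bracket of `𝔤` as a continuous bilinear map. -/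
def adL : LieAlg E G →L[ℝ] LieAlg E G →L[ℝ] LieAlg E G := adBil E G

theorem adL_self (U : LieAlg E G) : adL E G U U = 0 := adBil_self (E := E) (H := G) U

theorem adL_swap (U V : LieAlg E G) : adL E G U V = -adL E G V U :=
  adBil_swap (E := E) (H := G) U V

variable [LieGroup 𝓘(ℝ, E) ∞ G]

theorem bracket_eq_adL (U V : LieAlg E G) : ⁅U, V⁆ = adL E G U V :=
  groupLieAlgebra_bracket_eq (E := E) (H := G) U V

theorem AdL_mul_apply (a b : G) (U : LieAlg E G) : AdL E (a * b) U = AdL E a (AdL E b U) :=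
  congrArg (fun L : E →L[ℝ] E => L U) (conjDeriv_mul (E := E) a b)

theorem AdL_one_apply (U : LieAlg E G) : AdL E (1 : G) U = U :=
  congrArg (fun L : E →L[ℝ] E => L U) (conjDeriv_one (E := E) (H := G))

theorem AdL_apply_inv_self (a : G) (U : LieAlg E G) : AdL E a (AdL E a⁻¹ U) = U := by
  rw [← AdL_mul_apply, mul_inv_cancel, AdL_one_apply]

variable [FiniteDimensional ℝ E] [T2Space G]

/-- The exponential map `𝔤 → G`. -/
def expG (U : LieAlg E G) : G := groupExp (E := E) (H := G) U

theorem expG_zero : expG (0 : LieAlg E G) = 1 := groupExp_zero (E := E) (H := G)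

theorem expG_neg (U : LieAlg E G) : expG (-U) = (expG U)⁻¹ := groupExp_neg (E := E) (H := G) U

theorem expG_add_smul (a b : ℝ) (U : LieAlg E G) :
    expG ((a + b) • U) = expG (a • U) * expG (b • U) := groupExp_add_smul (E := E) (H := G) a b U

theorem expG_AdL (g : G) (U : LieAlg E G) : expG (AdL E g U) = g * expG U * g⁻¹ :=
  groupExp_conj (E := E) g U

theorem AdL_expG (U : LieAlg E G) : AdL E (expG U) = NormedSpace.exp (adL E G U) :=
  conjDeriv_groupExp (E := E) (H := G) U

theorem hasRightLogDerivAt_expG (U : LieAlg E G) :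
    HasRightLogDerivAt (E := E) 𝓘(ℝ, LieAlg E G) (expG : LieAlg E G → G) U
      (expMean (adL E G U) : LieAlg E G →L[ℝ] LieAlg E G) :=
  hasRightLogDerivAt_groupExp (E := E) (H := G) U

/-- A bilinear form as a continuous bilinear map. -/
def contBilin (B : LinearMap.BilinForm ℝ (LieAlg E G)) :
    LieAlg E G →L[ℝ] LieAlg E G →L[ℝ] ℝ :=
  LinearMap.toContinuousLinearMap (LinearMap.toContinuousLinearMap.toLinearMap ∘ₗ B)

variable {B : LinearMap.BilinForm ℝ (LieAlg E G)}

theorem hasDerivAt_exp_adL (U V : LieAlg E G) (t : ℝ) :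
    HasDerivAt (fun t : ℝ => NormedSpace.exp (t • adL E G U) V)
      (adL E G U (NormedSpace.exp (t • adL E G U) V)) t := by
  have : CompleteSpace (LieAlg E G) := FiniteDimensional.complete ℝ _
  simpa using (hasDerivAt_exp_smul_const' (𝕂 := ℝ) (adL E G U) t).clm_apply (hasDerivAt_const t V)

theorem AdL_expG_smul (t : ℝ) (U : LieAlg E G) :
    AdL E (expG (t • U)) = NormedSpace.exp (t • adL E G U) := by
  rw [AdL_expG, map_smul]

/-- Differentiate the invariance of `B` under `Ad(e^{tX}) = e^{t ad X}` at `t = 0`. -/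
theorem IsAdInvariantInner.adL_skew (hB : IsAdInvariantInner B) (X U V : LieAlg E G) :
    B (adL E G X U) V = -B U (adL E G X V) := by
  have h := (contBilin B).hasDerivAt_of_bilinear (u := fun t : ℝ => NormedSpace.exp (t • adL E G X) U)
    (v := fun t : ℝ => NormedSpace.exp (t • adL E G X) V)
    (fun _ => hasDerivAt_exp_adL X U 0) (fun _ => hasDerivAt_exp_adL X V 0)
  have h2 : (fun t : ℝ => contBilin B (NormedSpace.exp (t • adL E G X) U)
      (NormedSpace.exp (t • adL E G X) V)) = fun _ => B U V := by
    ext t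
    rw [← AdL_expG_smul]
    exact hB.ad_invariant _ _ _
  rw [h2] at h
  have h3 := h.unique (hasDerivAt_const 0 (B U V))
  simp only [zero_smul, NormedSpace.exp_zero] at h3
  have h4 : B U (adL E G X V) + B (adL E G X U) V = 0 := h3
  linarith

theorem IsAdInvariantInner.eq_of_forall (hB : IsAdInvariantInner B) {U V : LieAlg E G}
    (h : ∀ W, B U W = B V W) : U = V := by
  by_contra hne
  have h1 := hB.pos (U - V) (sub_ne_zero.2 hne)
  rw [show B (U - V) (U - V) = B U (U - V) - B V (U - V) by simp, h, sub_self] at h1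
  exact lt_irrefl _ h1

/-- A skew operator has no nontrivial nilpotent part: if `ad² W = 0`, then `⟨ad W, ad W⟩ = -⟨W, ad²
W⟩ = 0`, so the exponent can be lowered to one. -/
theorem IsAdInvariantInner.adL_eq_zero_of_iterate (hB : IsAdInvariantInner B) (X V : LieAlg E G)
    (k : ℕ) (h : (adL E G X)^[k] V = 0) : adL E G X V = 0 := by
  induction k with
  | zero => rw [show V = 0 from h, map_zero]
  | succ k ih =>
    cases k with
    | zero => exact h
    | succ k =>
      refine ih ?_
      rw [Function.iterate_succ_apply']
      rw [Function.iterate_succ_apply', Function.iterate_succ_apply'] at h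
      set W := (adL E G X)^[k] V
      by_contra hne
      have := hB.pos _ hne
      rw [hB.adL_skew, h, map_zero, neg_zero] at this
      exact lt_irrefl _ this

/-- A Cartan subalgebra is nilpotent, so `ad U` is nilpotent on it. Skewness then makes it vanish
there. -/
theorem IsAdInvariantInner.cartan_abelian (hB : IsAdInvariantInner B)
    {𝔱 : LieSubalgebra ℝ (LieAlg E G)} (h𝔱 : 𝔱.IsCartanSubalgebra) {U V : LieAlg E G}
    (hU : U ∈ 𝔱) (hV : V ∈ 𝔱) : adL E G U V = 0 := by
  have := h𝔱.nilpotent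
  obtain ⟨k, hk⟩ := LieModule.isNilpotent_toEnd_of_isNilpotent ℝ 𝔱 𝔱 ⟨U, hU⟩
  refine hB.adL_eq_zero_of_iterate U V k ?_
  have h1 : ∀ n : ℕ, ((((LieModule.toEnd ℝ 𝔱 𝔱 ⟨U, hU⟩) ^ n) ⟨V, hV⟩ : 𝔱) : LieAlg E G) =
      (adL E G U)^[n] V := by
    intro n
    induction n with
    | zero => rfl
    | succ n ih =>
      rw [pow_succ', Module.End.mul_apply, LieModule.toEnd_apply_apply, LieSubalgebra.coe_bracket,
        ih, bracket_eq_adL, Function.iterate_succ_apply']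
  rw [← h1 k, hk]
  rfl

theorem IsAdInvariantInner.gradient_apply (hB : IsAdInvariantInner B) (h : LieAlg E G → ℝ)
    (y A : LieAlg E G) : B (gradient hB h y) A = fderiv ℝ h y A :=
  LinearMap.BilinForm.apply_toDual_symm_apply (hB := hB.nondegenerate) _ _

theorem IsInvariantConvex.differentiable_gradient (hB : IsAdInvariantInner B)
    {h : LieAlg E G → ℝ} (hh : IsInvariantConvex h) : Differentiable ℝ (gradient hB h) := by
  have h1 : Differentiable ℝ (fderiv ℝ h) :=
    (hh.smooth.fderiv_right (m := 1) (by rw [one_add_one_eq_two]; exact ENat.LEInfty.out)).differentiable (by simp)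
  set L : (LieAlg E G →L[ℝ] ℝ) →L[ℝ] LieAlg E G := LinearMap.toContinuousLinearMap
    ((B.toDual hB.nondegenerate).symm.toLinearMap ∘ₗ
      LinearMap.toContinuousLinearMap.symm.toLinearMap)
  exact L.differentiable.comp h1

/-- The chain rule for `h ∘ Ad(g) = h`, combined with orthogonality of `Ad(g)`. -/
theorem IsInvariantConvex.gradient_AdL (hB : IsAdInvariantInner B)
    {h : LieAlg E G → ℝ} (hh : IsInvariantConvex h) (g : G) (y : LieAlg E G) :
    gradient hB h (AdL E g y) = AdL E g (gradient hB h y) := by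
  have hd : Differentiable ℝ h := hh.smooth.differentiable (by simp)
  refine hB.eq_of_forall fun W => ?_
  rw [← AdL_apply_inv_self g W]
  set A := AdL E g⁻¹ W
  rw [hB.gradient_apply]
  have h1 : B (AdL E g (gradient hB h y)) (AdL E g A) = B (gradient hB h y) A :=
    hB.ad_invariant g _ _
  rw [h1, hB.gradient_apply]
  have h2 : HasFDerivAt (fun y => h (AdL E g y)) ((fderiv ℝ h (AdL E g y)).comp (AdL E g)) y :=
    (hd _).hasFDerivAt.comp y (AdL E g).hasFDerivAt
  have h3 : (fun y => h (AdL E g y)) = h := funext fun y => hh.ad_invariant g y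
  rw [h3] at h2
  rw [h2.fderiv]
  rfl

/-- Since `e^{t ad y}` fixes `y`, equivariance makes it fix the gradient at `y`. Differentiate in
`t`. -/
theorem IsInvariantConvex.adL_gradient (hB : IsAdInvariantInner B)
    {h : LieAlg E G → ℝ} (hh : IsInvariantConvex h) (y : LieAlg E G) :
    adL E G y (gradient hB h y) = 0 := by
  have : CompleteSpace (LieAlg E G) := FiniteDimensional.complete ℝ _
  have h1 := hasDerivAt_exp_adL y (gradient hB h y) 0
  have h2 : (fun t : ℝ => NormedSpace.exp (t • adL E G y) (gradient hB h y)) =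
      fun _ => gradient hB h y := by
    ext t
    rw [← AdL_expG_smul, ← hh.gradient_AdL hB, AdL_expG_smul,
      exp_apply_of_apply_eq_zero (by simp [adL_self])]
  rw [h2] at h1
  simpa using h1.unique (hasDerivAt_const 0 _)

/-- Pair with `W` and move `F` across: `F W` commutes with `F U`, so `Ad(e^{FU})` fixes it and can
be removed by invariance of `B`. -/
theorem IsTorusForm.apply_exp (hB : IsAdInvariantInner B) {𝔱 : LieSubalgebra ℝ (LieAlg E G)}
    (h𝔱 : 𝔱.IsCartanSubalgebra) {F : LieAlg E G →ₗ[ℝ] LieAlg E G}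
    (hF : IsTorusForm B 𝔱.toSubmodule F) (U y : LieAlg E G) :
    F (AdL E (expG (F U)) y) = F y := by
  have : CompleteSpace (LieAlg E G) := FiniteDimensional.complete ℝ _
  refine hB.eq_of_forall fun W => ?_
  rw [hF.self_adjoint, hF.self_adjoint]
  have h1 : AdL E (expG (F U)) (F W) = F W := by
    rw [AdL_expG]
    exact exp_apply_of_apply_eq_zero
      (hB.cartan_abelian h𝔱 (hF.image_subset U) (hF.image_subset W))
  have h2 : B (AdL E (expG (F U)) y) (AdL E (expG (F U)) (F W)) = B y (F W) :=
    hB.ad_invariant _ _ _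
  rwa [h1] at h2

end AdjointAction

/-! ### Explicit Hamiltonian flows. -/

section Flows

variable {E : Type*} [NormedAddCommGroup E] [NormedSpace ℝ E]
  {G : Type*} [TopologicalSpace G] [ChartedSpace E G] [Group G] [LieGroup 𝓘(ℝ, E) ∞ G]
  [FiniteDimensional ℝ E] [T2Space G]

/-- The curve `t ↦ (x e^{t w(y)}, Ad(e^{-t w(y)}) y)`. -/
def gradFlow (w : LieAlg E G → LieAlg E G) (t : ℝ) (p : CotG E G) : CotG E G :=
  (p.1 * expG (t • w p.2), AdL E (expG (-(t • w p.2))) p.2)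

/-- `w` is constant along the curves `gradFlow w`. -/
def IsFlowInvariant (w : LieAlg E G → LieAlg E G) : Prop :=
  ∀ (t : ℝ) (y : LieAlg E G), w (AdL E (expG (t • w y)) y) = w y

theorem gradFlow_zero (w : LieAlg E G → LieAlg E G) (p : CotG E G) : gradFlow w 0 p = p := by
  simp [gradFlow, expG_zero, AdL_one_apply]

theorem gradFlow_add {w : LieAlg E G → LieAlg E G} (hw : IsFlowInvariant w) (s t : ℝ)
    (p : CotG E G) : gradFlow w s (gradFlow w t p) = gradFlow w (s + t) p := by
  have h : w (AdL E (expG (-(t • w p.2))) p.2) = w p.2 := by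
    rw [← neg_smul]; exact hw (-t) p.2
  simp only [gradFlow, h]
  rw [mul_assoc, ← expG_add_smul, ← AdL_mul_apply, ← neg_smul, ← neg_smul, ← neg_smul,
    ← expG_add_smul, add_comm t s, neg_add]

/-- The left translation `𝔤 → T_x G`. -/
def leftPush (x : G) : LieAlg E G →L[ℝ] E :=
  (modelDeriv 𝓘(ℝ, E) 𝓘(ℝ, E) (fun z : G => x * z) 1 : E →L[ℝ] E)

/-- The left trivialization as a continuous linear map. -/
def leftTrivL (x : G) : E →L[ℝ] LieAlg E G :=
  (modelDeriv 𝓘(ℝ, E) 𝓘(ℝ, E) (fun z : G => x⁻¹ * z) x : E →L[ℝ] E)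

theorem leftTrivL_leftPush (x : G) (U : LieAlg E G) : leftTrivL x (leftPush x U) = U := by
  have h := ((hasModelDerivAt_mul_left (E := E) x⁻¹ x).comp (hasModelDerivAt_mul_left x 1)
    (by simp)).unique ((HasModelDerivAt.id (J := 𝓘(ℝ, E)) (1 : G)).congr_fun (by simp))
  exact congrArg (fun L : E →L[ℝ] E => L U) h

theorem leftPush_leftTrivL (x : G) (v : E) : leftPush x (leftTrivL x v) = v := by
  have h := ((hasModelDerivAt_mul_left (E := E) x 1).comp (hasModelDerivAt_mul_left x⁻¹ x)
    (by simp)).unique ((HasModelDerivAt.id (J := 𝓘(ℝ, E)) (x : G)).congr_fun (by simp))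
  exact congrArg (fun L : E →L[ℝ] E => L v) h

theorem hasModelDerivAt_mul_expG (x : G) (U : LieAlg E G) (t : ℝ) :
    HasModelDerivAt 𝓘(ℝ, ℝ) 𝓘(ℝ, E) (fun t : ℝ => x * expG (t • U)) t
      (ContinuousLinearMap.toSpanSingleton ℝ (leftPush (x * expG (t • U)) U)) := by
  have h1 : HasModelDerivAt 𝓘(ℝ, ℝ) 𝓘(ℝ, E) (fun s : ℝ => expG ((s - t) • U)) t
      (ContinuousLinearMap.toSpanSingleton ℝ (show E from U)) :=
    (isOneParam_groupExp (E := E) G U).hasModelDerivAt_sub t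
  have h2 := (hasModelDerivAt_mul_left (E := E) (x * expG (t • U)) 1).comp h1
    (by simp [expG_zero])
  refine (h2.congr_fun (f₁ := fun s : ℝ => x * expG (s • U)) fun s => ?_).congr_deriv ?_
  · rw [mul_assoc, ← expG_add_smul, add_sub_cancel]
  · refine ContinuousLinearMap.ext_ring ?_
    rw [ContinuousLinearMap.comp_apply, ContinuousLinearMap.toSpanSingleton_apply,
      ContinuousLinearMap.toSpanSingleton_apply, one_smul, one_smul]
    rfl

/-- The Hamiltonian field in the left trivialization is `(w(y), [y, w(y)])`: by skewness its second
component cancels the term `⟨y, [w(y), ·]⟩` of the symplectic form. Flow invariance of `w` makes the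
velocity of the explicit curve equal to this field at all times. -/
theorem isHamiltonianFlow_gradFlow {B : LinearMap.BilinForm ℝ (LieAlg E G)}
    (hB : IsAdInvariantInner B) {w : LieAlg E G → LieAlg E G} (hw : IsFlowInvariant w)
    {g : LieAlg E G → ℝ} {g' : LieAlg E G → LieAlg E G →L[ℝ] ℝ}
    (hg : ∀ y, HasFDerivAt g (g' y) y) (hgw : ∀ y A, g' y A = B (w y) A) :
    IsHamiltonianFlow B (fun p => g p.2) (gradFlow w) := by
  refine ⟨fun p => ((leftPush p.1 (w p.2), adL E G p.2 (w p.2)) : E × LieAlg E G),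
    fun p v => ?_, fun p => ⟨gradFlow_zero w p, fun t => ?_⟩⟩
  · have h1 : HasModelDerivAt (cotModel E G) 𝓘(ℝ, ℝ) (fun p : CotG E G => g p.2) p
        ((g' p.2).comp (ContinuousLinearMap.snd ℝ E (LieAlg E G))) :=
      (hasModelDerivAt_iff_hasFDerivAt.2 (hg p.2)).comp (HasModelDerivAt.snd p) rfl
    have h2 : mfderiv (cotModel E G) 𝓘(ℝ, ℝ) (fun p : CotG E G => g p.2) p v =
        g' p.2 v.2 := congrArg (fun L : E × LieAlg E G →L[ℝ] ℝ => L v) h1.modelDeriv_eq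
    rw [h2, hgw]
    change B (leftTrivL (E := E) p.1 (leftPush (E := E) p.1 (w p.2))) v.2 -
      B (adL E G p.2 (w p.2)) (leftTrivL (E := E) p.1 v.1) +
      B p.2 ⁅leftTrivL (E := E) p.1 (leftPush (E := E) p.1 (w p.2)),
        leftTrivL (E := E) p.1 v.1⁆ = B (w p.2) v.2
    rw [leftTrivL_leftPush, bracket_eq_adL, adL_swap p.2, map_neg, LinearMap.neg_apply, hB.adL_skew]
    ring
  · have h1 := hasModelDerivAt_mul_expG p.1 (w p.2) t
    have h2 : HasModelDerivAt 𝓘(ℝ, ℝ) 𝓘(ℝ, LieAlg E G)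
        (fun t : ℝ => AdL E (expG (-(t • w p.2))) p.2) t
        (ContinuousLinearMap.toSpanSingleton ℝ
          (adL E G (AdL E (expG (-(t • w p.2))) p.2) (w p.2))) := by
      refine hasModelDerivAt_iff_hasFDerivAt.2 ?_
      have h := hasDerivAt_exp_adL (-(w p.2)) p.2 t
      have e : ∀ t : ℝ, AdL E (expG (-(t • w p.2))) p.2 =
          NormedSpace.exp (t • adL E G (-(w p.2))) p.2 := fun t => by
        rw [← AdL_expG_smul, smul_neg]
      simp only [e]
      rw [adL_swap, ← neg_apply, ← map_neg]
      exact h.hasFDerivAt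
    have h3 := h1.prodMk h2
    have e : w (AdL E (expG (-(t • w p.2))) p.2) = w p.2 := by
      rw [← neg_smul]; exact hw (-t) p.2
    refine HasModelDerivAt.congr_deriv h3 ?_
    refine ContinuousLinearMap.ext_ring ?_
    change (_, _) = (1 : ℝ) • ((leftPush (p.1 * expG (t • w p.2))
      (w (AdL E (expG (-(t • w p.2))) p.2)), _) : E × LieAlg E G)
    rw [e, one_smul]
    refine Prod.ext ?_ ?_
    · exact one_smul ℝ (leftPush (p.1 * expG (t • w p.2)) (w p.2))
    · exact (one_smul ℝ (adL E G (AdL E (expG (-(t • w p.2))) p.2) (w p.2))).trans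
        (congrArg _ e.symm)

theorem mdifferentiableAt_gradFlow {w : LieAlg E G → LieAlg E G} (hw : Differentiable ℝ w)
    (t : ℝ) (p : CotG E G) :
    MDifferentiableAt (cotModel E G) (cotModel E G) (gradFlow w t) p := by
  have : CompleteSpace (LieAlg E G) := FiniteDimensional.complete ℝ _
  have h1 : HasModelDerivAt (cotModel E G) 𝓘(ℝ, LieAlg E G) (fun p : CotG E G => t • w p.2) p
      ((fderiv ℝ (fun y => t • w y) p.2).comp (ContinuousLinearMap.snd ℝ E (LieAlg E G))) :=
    (hasModelDerivAt_iff_hasFDerivAt.2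
      ((hw p.2).const_smul t).hasFDerivAt).comp (HasModelDerivAt.snd p) rfl
  have h2 := (hasRightLogDerivAt_expG (E := E) (G := G) (t • w p.2)).hasModelDerivAt.comp h1 rfl
  have h3 : MDifferentiableAt (cotModel E G) 𝓘(ℝ, E)
      (fun p : CotG E G => p.1 * expG (t • w p.2)) p :=
    MDifferentiableAt.comp p
      (((contMDiff_mul 𝓘(ℝ, E) ∞).mdifferentiable (by simp)) (p.1, expG (t • w p.2)))
      ((HasModelDerivAt.fst p).prodMk h2).mdifferentiableAt
  have h4 : Differentiable ℝ fun y => AdL E (expG (-(t • w y))) y := by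
    simp only [AdL_expG]
    have h5 : Differentiable ℝ fun y => adL E G (-(t • w y)) :=
      (adL E G).differentiable.comp (hw.const_smul t).neg
    intro y
    exact ((NormedSpace.exp_analytic (𝕂 := ℝ) _).differentiableAt.comp y (h5 y)).clm_apply
      differentiableAt_id
  have h6 := (hasModelDerivAt_iff_hasFDerivAt.2 (h4 p.2).hasFDerivAt).comp
    (HasModelDerivAt.snd (J := 𝓘(ℝ, E)) p) rfl
  exact ((MDifferentiableAt.hasModelDerivAt h3).prodMk h6).mdifferentiableAt

end Flows

/-! ### The complex-linear adjoint operator. -/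

section ComplexAdjoint

variable {EC : Type*} [NormedAddCommGroup EC] [NormedSpace ℂ EC] [FiniteDimensional ℂ EC]
  {GC : Type*} [TopologicalSpace GC] [ChartedSpace EC GC] [Group GC] [T2Space GC]
  [LieGroup 𝓘(ℂ, EC) ω GC]

variable (GC) in
/-- The complex-linear adjoint action of the Lie algebra of a complex Lie group. -/
def adC (X : EC) : EC →L[ℂ] EC :=
  LinearMap.toContinuousLinearMap
    { toFun := fun W => adBil EC GC X W
      map_add' := fun W W' => map_add _ W W'
      map_smul' := fun c W => adBil_smul_right_complex X c W }

/-- Real calculus produces functions of `ad(zX)`. Rewriting it as `z ad X` in the complex operator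
algebra makes their holomorphic dependence on `z` visible. -/
theorem restrictRingHom_smul_adC (z : ℂ) (X : EC) :
    restrictRingHom EC (z • adC GC X) = adBil EC GC (z • X) := by
  ext W
  exact (adBil_smul_left_complex X z W).symm

theorem exp_smul_adC_apply (z : ℂ) (X W : EC) :
    NormedSpace.exp (z • adC GC X) W = NormedSpace.exp (adBil EC GC (z • X)) W := by
  have : CompleteSpace EC := FiniteDimensional.complete ℂ EC
  rw [← restrictRingHom_smul_adC, ← restrictRingHom_exp]
  rfl

theorem expMean_smul_adC_apply (z : ℂ) (X W : EC) :
    expMean (z • adC GC X) W = expMean (adBil EC GC (z • X)) W := by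
  have : CompleteSpace EC := FiniteDimensional.complete ℂ EC
  rw [← restrictRingHom_smul_adC, ← restrictRingHom_expMean]
  rfl

theorem lieExp_eq_groupExp [LieGroup 𝓘(ℝ, EC) ∞ GC] (X : EC) :
    lieExp (EC := EC) (GC := GC) X = groupExp X := by
  have hX : ∃ γ : ℝ → GC, IsOneParameterSubgroup (EC := EC) γ X := exists_isOneParam (H := GC) X
  have h1 : lieExp (EC := EC) (GC := GC) X = hX.choose 1 := dif_pos hX
  have h2 : IsOneParam (E := EC) hX.choose X := hX.choose_spec
  rw [h1, h2.apply_one]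

end ComplexAdjoint

section LogDeriv

variable {E : Type*} [NormedAddCommGroup E] [NormedSpace ℝ E]
  {H : Type*} [TopologicalSpace H] [ChartedSpace E H] [Group H]
  {F : Type*} [NormedAddCommGroup F] [NormedSpace ℝ F] {K : Type*} [TopologicalSpace K]
  {J : ModelWithCorners ℝ F K} {M : Type*} [TopologicalSpace M] [ChartedSpace K M]
  {F' : Type*} [NormedAddCommGroup F'] [NormedSpace ℝ F'] {K' : Type*} [TopologicalSpace K']
  {J' : ModelWithCorners ℝ F' K'} {M' : Type*} [TopologicalSpace M'] [ChartedSpace K' M']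

theorem HasRightLogDerivAt.comp {g : M' → H} {f : M → M'} {p : M} {g' : F' →L[ℝ] E}
    {f' : F →L[ℝ] F'} (hg : HasRightLogDerivAt J' g (f p) g') (hf : HasModelDerivAt J J' f p f') :
    HasRightLogDerivAt J (fun q => g (f q)) p (g'.comp f') :=
  HasModelDerivAt.comp hg hf rfl

end LogDeriv

/-! ### Compatibility of `ι` with adjoint actions, brackets and exponentials. -/

section ComplexForm

variable {E : Type*} [NormedAddCommGroup E] [NormedSpace ℝ E]
  {G : Type*} [TopologicalSpace G] [ChartedSpace E G] [Group G]
  {EC : Type*} [NormedAddCommGroup EC] [NormedSpace ℂ EC]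
  {GC : Type*} [TopologicalSpace GC] [ChartedSpace EC GC] [Group GC]

variable (EC E) in
/-- The derivative `𝔤 → T₁(GC)` of a homomorphism at the identity as a continuous linear map. -/
def dHomL (ι : G →* GC) : LieAlg E G →L[ℝ] EC :=
  (modelDeriv 𝓘(ℝ, E) 𝓘(ℝ, EC) ι 1 : E →L[ℝ] EC)

variable {ι : G →* GC}

theorem IsComplexification.isComplexForm (hι : IsComplexification EC E ι) :
    IsComplexForm (dHomL E EC ι).toLinearMap := fun Z => hι.lie_algebra Z

theorem IsComplexification.hasModelDerivAt_one (hι : IsComplexification EC E ι) :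
    HasModelDerivAt 𝓘(ℝ, E) 𝓘(ℝ, EC) ι 1 (dHomL E EC ι : E →L[ℝ] EC) :=
  MDifferentiableAt.hasModelDerivAt (hι.smooth.mdifferentiable (by simp) 1)

variable [LieGroup 𝓘(ℝ, E) ∞ G] [LieGroup 𝓘(ℝ, EC) ∞ GC]
  [FiniteDimensional ℝ E] [T2Space G] [FiniteDimensional ℂ EC] [T2Space GC]

theorem IsComplexification.hasRightLogDerivAt (hι : IsComplexification EC E ι) (x : G) :
    HasRightLogDerivAt (E := EC) 𝓘(ℝ, E) ι x
      ((conjDeriv (ι x)).comp ((dHomL E EC ι).comp (leftTrivL x))) := by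
  have h1 := hι.hasModelDerivAt_one.comp (hasModelDerivAt_mul_left (E := E) x⁻¹ x) (by simp)
  exact (HasModelDerivAt.conj (ι x) h1 (by simp)).congr_fun fun q => by simp

theorem IsComplexification.conjDeriv_dHomL (hι : IsComplexification EC E ι) (g : G)
    (V : LieAlg E G) : conjDeriv (ι g) (dHomL E EC ι V) = dHomL E EC ι (AdL E g V) := by
  have h1 := HasModelDerivAt.conj (ι g) hι.hasModelDerivAt_one (map_one ι)
  have h2 := hι.hasModelDerivAt_one.comp (hasModelDerivAt_conj (E := E) g) (by simp)
  exact congrArg (fun L : E →L[ℝ] EC => L V) (h1.unique (h2.congr_fun fun q => by simp))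

theorem IsComplexification.isOneParam (hι : IsComplexification EC E ι) {γ : ℝ → G} {U : E}
    (hγ : IsOneParam γ U) : IsOneParam (E := EC) (fun t => ι (γ t)) (dHomL E EC ι U) := by
  refine ⟨fun a b => (congrArg ι (hγ.1 a b)).trans (map_mul ι _ _), ?_⟩
  refine (hι.hasModelDerivAt_one.comp hγ.2 hγ.map_zero).congr_deriv ?_
  refine ContinuousLinearMap.ext_ring ?_
  exact map_smul (dHomL E EC ι) (1 : ℝ) (show LieAlg E G from U)

theorem IsComplexification.map_expG (hι : IsComplexification EC E ι) (U : LieAlg E G) :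
    ι (expG U) = groupExp (dHomL E EC ι U) := by
  have h := (hι.isOneParam (isOneParam_groupExp (E := E) G U)).apply_one
  exact (congrArg (fun V : E => ι (groupExp V)) (one_smul ℝ (show E from U)).symm).trans h

/-- Differentiate the intertwining of the two adjoint actions by `ι` along `e^{tU}`. -/
theorem IsComplexification.adBil_dHomL (hι : IsComplexification EC E ι) (U V : LieAlg E G) :
    adBil EC GC (dHomL E EC ι U) (dHomL E EC ι V) = dHomL E EC ι (adL E G U V) := by
  have h0 := isOneParam_groupExp (E := E) G U
  have h1 := hι.isOneParam h0
  have h2 := (hasDerivAt_conjDeriv h1.2 h1.map_zero).clm_apply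
    (hasDerivAt_const (0 : ℝ) (dHomL E EC ι V))
  have h3 := (dHomL E EC ι).hasFDerivAt.comp_hasDerivAt (0 : ℝ) (hasDerivAt_exp_adL U V 0)
  simp only [map_zero, add_zero, zero_smul, NormedSpace.exp_zero] at h2 h3
  refine h2.unique (h3.congr_of_eventuallyEq (Eventually.of_forall fun t => ?_))
  refine (hι.conjDeriv_dHomL _ V).trans ?_
  exact congrArg (fun L : LieAlg E G →L[ℝ] LieAlg E G => dHomL E EC ι (L V)) (AdL_expG_smul t U)

end ComplexForm

/-! ### The logarithmic derivative of `A_{τ,σ}` and its conjugate. -/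

section ContinuedFamily

variable {E : Type*} [NormedAddCommGroup E] [NormedSpace ℝ E] [FiniteDimensional ℝ E]
  {G : Type*} [TopologicalSpace G] [ChartedSpace E G] [Group G] [LieGroup 𝓘(ℝ, E) ∞ G] [T2Space G]
  {EC : Type*} [NormedAddCommGroup EC] [NormedSpace ℂ EC] [FiniteDimensional ℂ EC]
  {GC : Type*} [TopologicalSpace GC] [ChartedSpace EC GC] [Group GC] [T2Space GC]
  [LieGroup 𝓘(ℂ, EC) ω GC] [LieGroup 𝓘(ℝ, EC) ∞ GC]
  {ι : G →* GC} (hι : IsComplexification EC E ι)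

/-- The complex-linear extension to `T₁(GC)` of an operator on `𝔤`. -/
def IsComplexification.extendL (L : LieAlg E G →ₗ[ℝ] LieAlg E G) : EC →L[ℂ] EC :=
  LinearMap.toContinuousLinearMap (hι.isComplexForm.extend L)

theorem IsComplexification.extendL_dHomL (L : LieAlg E G →ₗ[ℝ] LieAlg E G) (V : LieAlg E G) :
    hι.extendL L (dHomL E EC ι V) = dHomL E EC ι (L V) :=
  hι.isComplexForm.extend_apply L V

/-- The part of the logarithmic derivative of `(x, y) ↦ x e^{z u(y)} e^{w F y}` in the direction
of `y`. -/
def slope (u : LieAlg E G → LieAlg E G) (F : LieAlg E G →ₗ[ℝ] LieAlg E G) (y : LieAlg E G)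
    (z : ℂ × ℂ) : EC →L[ℂ] EC :=
  z.1 • expMean (z.1 • adC GC (dHomL E EC ι (u y))) * hι.extendL (fderiv ℝ u y).toLinearMap +
    z.2 • NormedSpace.exp (z.1 • adC GC (dHomL E EC ι (u y))) * hι.extendL F

variable (u : LieAlg E G → LieAlg E G) (F : LieAlg E G →ₗ[ℝ] LieAlg E G)

theorem slope_apply_dHomL (y : LieAlg E G) (z : ℂ × ℂ) (V : LieAlg E G) :
    slope hι u F y z (dHomL E EC ι V) =
      z.1 • expMean (z.1 • adC GC (dHomL E EC ι (u y))) (dHomL E EC ι (fderiv ℝ u y V)) +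
        z.2 • NormedSpace.exp (z.1 • adC GC (dHomL E EC ι (u y))) (dHomL E EC ι (F V)) := by
  rw [← hι.extendL_dHomL F, ← ContinuousLinearMap.coe_coe (fderiv ℝ u y), ← hι.extendL_dHomL]
  rfl

theorem analyticAt_slope (y : LieAlg E G) (z : ℂ × ℂ) : AnalyticAt ℂ (slope hι u F y) z := by
  have : CompleteSpace EC := FiniteDimensional.complete ℂ EC
  set a := adC GC (dHomL E EC ι (u y))
  have h1 : AnalyticAt ℂ (fun z : ℂ × ℂ => expMean (z.1 • a)) z :=
    (analyticAt_expMean_smul a z.1).comp (f := Prod.fst) analyticAt_fst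
  have h2 : AnalyticAt ℂ (fun z : ℂ × ℂ => NormedSpace.exp (z.1 • a)) z :=
    (analyticAt_exp_smul a z.1).comp (f := Prod.fst) analyticAt_fst
  exact ((analyticAt_fst.smul h1).mul analyticAt_const).add
    ((analyticAt_snd.smul h2).mul analyticAt_const)

/-- The bracket of `𝔤_ℂ` is complex bilinear and restricts to the bracket of `𝔤`, so conjugation
respects it. -/
theorem IsComplexification.semiconjBy_conj (U : LieAlg E G) (z : ℂ) :
    SemiconjBy (LinearMap.toContinuousLinearMap hι.isComplexForm.conj)
      (adBil EC GC (z • dHomL E EC ι U)) (adBil EC GC (conj z • dHomL E EC ι U)) := by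
  ext W
  obtain ⟨⟨a, b⟩, h, -⟩ := hι.isComplexForm W
  have h' : W = dHomL E EC ι a + Complex.I • dHomL E EC ι b := h
  have hc : ∀ a b, hι.isComplexForm.conj (dHomL E EC ι a + Complex.I • dHomL E EC ι b) =
    dHomL E EC ι a - Complex.I • dHomL E EC ι b := hι.isComplexForm.conj_apply
  change hι.isComplexForm.conj (adBil EC GC (z • dHomL E EC ι U) W) =
    adBil EC GC (conj z • dHomL E EC ι U) (hι.isComplexForm.conj W)
  rw [adBil_smul_left_complex, adBil_smul_left_complex, hι.isComplexForm.conj_smul, h', hc,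
    map_add, map_sub, adBil_smul_right_complex, hι.adBil_dHomL,
    hι.adBil_dHomL, hc]

theorem conj_slope (y : LieAlg E G) (z w : ℂ) (V : LieAlg E G) :
    hι.isComplexForm.conj (slope hι u F y (z, w) (dHomL E EC ι V)) =
      slope hι u F y (conj z, conj w) (dHomL E EC ι V) := by
  have : CompleteSpace EC := FiniteDimensional.complete ℂ EC
  have hs := hι.semiconjBy_conj (u y) z
  have h1 := fun W => congrArg (fun L : EC →L[ℝ] EC => L W) (semiconjBy_exp hs).eq
  have h2 := fun W => congrArg (fun L : EC →L[ℝ] EC => L W) (semiconjBy_expMean hs).eq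
  have hr : ∀ a, hι.isComplexForm.conj (dHomL E EC ι a) = dHomL E EC ι a :=
    hι.isComplexForm.conj_real
  have h1' : ∀ a, hι.isComplexForm.conj (NormedSpace.exp (adBil EC GC (z • dHomL E EC ι (u y)))
      (dHomL E EC ι a)) = NormedSpace.exp (adBil EC GC (conj z • dHomL E EC ι (u y)))
      (dHomL E EC ι a) := fun a => (h1 _).trans (congrArg _ (hr a))
  have h2' : ∀ a, hι.isComplexForm.conj (expMean (adBil EC GC (z • dHomL E EC ι (u y)))
      (dHomL E EC ι a)) = expMean (adBil EC GC (conj z • dHomL E EC ι (u y)))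
      (dHomL E EC ι a) := fun a => (h2 _).trans
      (congrArg (fun W => expMean (adBil EC GC (conj z • dHomL E EC ι (u y))) W) (hr a))
  rw [slope_apply_dHomL, slope_apply_dHomL, map_add, hι.isComplexForm.conj_smul,
    hι.isComplexForm.conj_smul]
  simp only [exp_smul_adC_apply, expMean_smul_adC_apply, h1', h2']

/-- The left-translated logarithmic derivative of `(x, y) ↦ x e^{z u(y)} e^{w F y}`. -/
def logSlope (z : ℂ × ℂ) (p : CotG E G) : E × LieAlg E G →L[ℝ] EC :=
  ((dHomL E EC ι).comp (leftTrivL p.1)).comp (ContinuousLinearMap.fst ℝ E (LieAlg E G)) +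
    (restrictRingHom EC (slope hι u F p.2 z)).comp
      ((dHomL E EC ι).comp (ContinuousLinearMap.snd ℝ E (LieAlg E G)))

theorem logSlope_apply (z : ℂ × ℂ) (p : CotG E G) (v : E × LieAlg E G) :
    logSlope hι u F z p v = dHomL E EC ι (leftTrivL p.1 v.1) +
      slope hι u F p.2 z (dHomL E EC ι v.2) := rfl

theorem conj_logSlope (z w : ℂ) (p : CotG E G) (v : E × LieAlg E G) :
    hι.isComplexForm.conj (logSlope hι u F (z, w) p v) =
      logSlope hι u F (conj z, conj w) p v := by
  rw [logSlope_apply, logSlope_apply, map_add, conj_slope]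
  exact congrArg (· + _) (hι.isComplexForm.conj_real _)

theorem mapA_eq (z w : ℂ) (p : CotG E G) : mapA EC ι u F z w p =
    ι p.1 * groupExp (z • dHomL E EC ι (u p.2)) * groupExp (w • dHomL E EC ι (F p.2)) :=
  congrArg₂ (· * ·) (congrArg (ι p.1 * ·) (lieExp_eq_groupExp _)) (lieExp_eq_groupExp _)

/-- The product rule for the three factors of `A`. Conjugation by `x` is common to all terms and is
factored out, and the last term is also conjugated by `e^{z u(y)}`. -/
theorem hasRightLogDerivAt_mapA {u : LieAlg E G → LieAlg E G} (hu : Differentiable ℝ u)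
    (hF : ∀ U V, adL E G (F U) (F V) = 0) (z w : ℂ) (p : CotG E G) :
    HasRightLogDerivAt (E := EC) (cotModel E G) (mapA EC ι u F z w) p
      ((conjDeriv (ι p.1)).comp (logSlope hι u F (z, w) p)) := by
  have : CompleteSpace EC := FiniteDimensional.complete ℂ EC
  have h1 : HasRightLogDerivAt (E := EC) (cotModel E G) (fun q : CotG E G => ι q.1) p _ :=
    (hι.hasRightLogDerivAt p.1).comp (HasModelDerivAt.fst (J' := 𝓘(ℝ, LieAlg E G)) p)
  have hexp : ∀ (c : ℂ) {v : LieAlg E G → LieAlg E G}, Differentiable ℝ v →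
      HasRightLogDerivAt (E := EC) (cotModel E G)
        (fun q : CotG E G => (groupExp (c • dHomL E EC ι (v q.2)) : GC)) p
        ((expMean (adBil EC GC (c • dHomL E EC ι (v p.2)))).comp
          ((c • ((dHomL E EC ι).comp (fderiv ℝ v p.2))).comp
            (ContinuousLinearMap.snd ℝ E (LieAlg E G)))) := by
    intro c v hv
    refine HasRightLogDerivAt.comp
      (hasRightLogDerivAt_groupExp (H := GC) (c • dHomL E EC ι (v p.2)))
      (f := fun q : CotG E G => c • dHomL E EC ι (v q.2)) ?_
    refine HasModelDerivAt.comp (hasModelDerivAt_iff_hasFDerivAt.2 ?_)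
      (HasModelDerivAt.snd (J := 𝓘(ℝ, E)) p) rfl (g := fun y => c • dHomL E EC ι (v y))
    exact ((dHomL E EC ι).hasFDerivAt.comp p.2 (hv p.2).hasFDerivAt).const_smul c
  have h4 := (h1.mul (hexp z hu)).mul
    (hexp w (v := F) (LinearMap.toContinuousLinearMap F).differentiable)
  refine (HasModelDerivAt.congr_fun h4 fun q => ?_).congr_deriv ?_
  · rw [mapA_eq, mapA_eq]
  -- The image of `F` is abelian, so the exponential of `w F y` contributes no correction and the
  -- formula is linear in `w`.
  · have hfix : ∀ V, expMean (adBil EC GC (w • dHomL E EC ι (F p.2))) (w • dHomL E EC ι (F V)) =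
        w • dHomL E EC ι (F V) := fun V => expMean_apply_of_apply_eq_zero (by
      rw [adBil_smul_left_complex, adBil_smul_right_complex, hι.adBil_dHomL, hF, map_zero,
        smul_zero, smul_zero])
    have hfd : ∀ V, fderiv ℝ F p.2 V = F V := fun V => congrArg (fun L => L V)
      (LinearMap.toContinuousLinearMap F).hasFDerivAt.fderiv
    have hmul : ∀ W : EC, conjDeriv (ι p.1 * groupExp (z • dHomL E EC ι (u p.2))) W =
        conjDeriv (ι p.1) (NormedSpace.exp (z • adC GC (dHomL E EC ι (u p.2))) W) := fun W => by
      rw [conjDeriv_mul, conjDeriv_groupExp, exp_smul_adC_apply]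
      rfl
    refine ContinuousLinearMap.ext fun v => ?_
    change (conjDeriv (ι p.1) (dHomL E EC ι (leftTrivL p.1 v.1)) +
        conjDeriv (ι p.1) (expMean (adBil EC GC (z • dHomL E EC ι (u p.2)))
          (z • dHomL E EC ι (fderiv ℝ u p.2 v.2)))) +
        conjDeriv (ι p.1 * groupExp (z • dHomL E EC ι (u p.2)))
          (expMean (adBil EC GC (w • dHomL E EC ι (F p.2)))
            (w • dHomL E EC ι (fderiv ℝ F p.2 v.2))) =
        conjDeriv (ι p.1) (logSlope hι u F (z, w) p v)
    rw [hfd, hfix, hmul, logSlope_apply, slope_apply_dHomL,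
      ← expMean_smul_adC_apply, map_smul,
      map_smul (NormedSpace.exp (z • adC GC (dHomL E EC ι (u p.2)))), map_add, map_add, add_assoc]

end ContinuedFamily

theorem IsComplexForm.conj_injective {V : Type*} [AddCommGroup V] [Module ℝ V] {W : Type*}
    [AddCommGroup W] [Module ℂ W] [Module ℝ W] [IsScalarTower ℝ ℂ W] {j : V →ₗ[ℝ] W}
    (hj : IsComplexForm j) : Function.Injective hj.conj := by
  have h : ∀ w, hj.conj (hj.conj w) = w := fun w => by
    obtain ⟨⟨a, b⟩, h, -⟩ := hj w
    rw [h, hj.conj_apply, sub_eq_add_neg, ← smul_neg, ← map_neg, hj.conj_apply]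
    simp
  exact Function.LeftInverse.injective h

theorem IsComplexForm.add_I_smul_eq_zero_iff {V : Type*} [AddCommGroup V] [Module ℝ V] {W : Type*}
    [AddCommGroup W] [Module ℂ W] [Module ℝ W] [IsScalarTower ℝ ℂ W] {j : V →ₗ[ℝ] W}
    (hj : IsComplexForm j) {A B : W} (hA : hj.conj A = A) (hB : hj.conj B = B) :
    A + Complex.I • B = 0 ↔ A = 0 ∧ B = 0 := by
  refine ⟨fun h => ?_, fun h => by simp [h.1, h.2]⟩
  have h' := congrArg hj.conj h
  rw [map_add, hj.conj_I_smul, hA, hB, map_zero, ← sub_eq_add_neg] at h'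
  have hA0 : (2 : ℂ) • A = 0 := by
    rw [show (2 : ℂ) • A = (A + Complex.I • B) + (A - Complex.I • B) by rw [two_smul]; abel, h, h',
      add_zero]
  have hA1 : A = 0 := (smul_eq_zero.1 hA0).resolve_left two_ne_zero
  rw [hA1, zero_add] at h
  exact ⟨hA1, (smul_eq_zero.1 h).resolve_left Complex.I_ne_zero⟩

/-! ### Injectivity of translations and conjugations. -/

section Translations

variable {E : Type*} [NormedAddCommGroup E] [NormedSpace ℝ E]
  {H : Type*} [TopologicalSpace H] [ChartedSpace E H] [Group H] [LieGroup 𝓘(ℝ, E) ∞ H]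

theorem injective_modelDeriv_mul_right (g : H) :
    Function.Injective (modelDeriv 𝓘(ℝ, E) 𝓘(ℝ, E) (fun x : H => x * g) 1) := by
  have h := ((hasModelDerivAt_mul_right (E := E) g⁻¹ (1 * g)).comp (hasModelDerivAt_mul_right g 1)
    rfl).unique ((HasModelDerivAt.id (J := 𝓘(ℝ, E)) (1 : H)).congr_fun (by simp))
  exact Function.LeftInverse.injective fun v => congrArg (fun L : E →L[ℝ] E => L v) h

theorem injective_conjDeriv (g : H) : Function.Injective (conjDeriv g : E →L[ℝ] E) :=
  Function.LeftInverse.injective (g := (conjDeriv g⁻¹ : E →L[ℝ] E)) fun v =>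
    congrArg (fun L : E →L[ℝ] E => L v) (conjDeriv_inv_mul g)

end Translations

section Trivialization

variable {E : Type*} [NormedAddCommGroup E] [NormedSpace ℝ E] [FiniteDimensional ℝ E]
  {G : Type*} [TopologicalSpace G] [ChartedSpace E G] [Group G] [LieGroup 𝓘(ℝ, E) ∞ G] [T2Space G]

/-- The left trivialization `T_{(x,y)}(T*G) ≅ 𝔤 ⊕ 𝔤`. -/
def trivEquiv (p : CotG E G) : TCotG E G p ≃ₗ[ℝ] LieAlg E G × LieAlg E G :=
  (LinearEquiv.prodCongr
    { (leftTrivL p.1 : E →L[ℝ] LieAlg E G).toLinearMap with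
      invFun := leftPush p.1
      left_inv := leftPush_leftTrivL p.1
      right_inv := leftTrivL_leftPush p.1 }
    (LinearEquiv.refl ℝ (LieAlg E G)) : (E × LieAlg E G) ≃ₗ[ℝ] LieAlg E G × LieAlg E G)

/-- After the flow of `v`, equivariance replaces `u` by `Ad(e^{-sv}) u`. Conjugating by `e^{sv}`
moves the new exponential to the left, giving the order of factors in `A`. -/
theorem gradFlow_comp_fst {u : LieAlg E G → LieAlg E G}
    (hu : ∀ (g : G) y, u (AdL E g y) = AdL E g (u y)) (v : LieAlg E G → LieAlg E G)
    (t s : ℝ) (p : CotG E G) :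
    (gradFlow u t (gradFlow v s p)).1 = p.1 * expG (t • u p.2) * expG (s • v p.2) := by
  simp only [gradFlow, hu]
  rw [← map_smul, expG_AdL, expG_neg, inv_inv]
  group

end Trivialization

/-! ### The continued distribution, its real values and the pull-backs. -/

section Distribution

variable {E : Type*} [NormedAddCommGroup E] [NormedSpace ℝ E] [FiniteDimensional ℝ E]
  {G : Type*} [TopologicalSpace G] [ChartedSpace E G] [Group G] [LieGroup 𝓘(ℝ, E) ∞ G] [T2Space G]
  {EC : Type*} [NormedAddCommGroup EC] [NormedSpace ℂ EC] [FiniteDimensional ℂ EC]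
  {GC : Type*} [TopologicalSpace GC] [ChartedSpace EC GC] [Group GC] [T2Space GC]
  [LieGroup 𝓘(ℂ, EC) ω GC] [LieGroup 𝓘(ℝ, EC) ∞ GC]
  {ι : G →* GC} (hι : IsComplexification EC E ι)

/-- The identification `T_p(T*G) ⊗ ℂ ≅ 𝔤_ℂ ⊕ 𝔤_ℂ`. -/
def IsComplexification.trivEquivC (p : CotG E G) : (ℂ ⊗[ℝ] TCotG E G p) ≃ₗ[ℂ] EC × EC :=
  (hι.isComplexForm.prod (trivEquiv p)).equiv

variable (u : LieAlg E G → LieAlg E G) (F : LieAlg E G →ₗ[ℝ] LieAlg E G)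

/-- The analytic continuation of the pulled back vertical distributions. -/
def contDist (z : ℂ × ℂ) : ComplexDistribution E G := fun p =>
  LinearMap.ker ((LinearMap.fst ℂ EC EC + (slope hι u F p.2 z).toLinearMap ∘ₗ
    LinearMap.snd ℂ EC EC) ∘ₗ (hι.trivEquivC p).toLinearMap)

theorem mem_contDist_iff (z : ℂ × ℂ) (p : CotG E G) (w : ℂ ⊗[ℝ] TCotG E G p) :
    w ∈ contDist hι u F z p ↔
      (hι.trivEquivC p w).1 + slope hι u F p.2 z (hι.trivEquivC p w).2 = 0 := Iff.rfl

theorem logSlope_add_I_smul (z : ℂ × ℂ) (p : CotG E G) (a b : E × LieAlg E G) :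
    dHomL E EC ι (leftTrivL p.1 a.1) + Complex.I • dHomL E EC ι (leftTrivL p.1 b.1) +
        slope hι u F p.2 z (dHomL E EC ι a.2 + Complex.I • dHomL E EC ι b.2) =
      logSlope hι u F z p a + Complex.I • logSlope hι u F z p b := by
  rw [map_add, map_smul, logSlope_apply, logSlope_apply, smul_add]
  abel

theorem tmul_add_mem_contDist_iff (z : ℂ × ℂ) (p : CotG E G) (a b : TCotG E G p) {A B : EC}
    (hA : logSlope hι u F z p a = A) (hB : logSlope hι u F z p b = B) :
    (1 : ℂ) ⊗ₜ[ℝ] a + Complex.I ⊗ₜ[ℝ] b ∈ contDist hι u F z p ↔ A + Complex.I • B = 0 := by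
  have h : hι.trivEquivC p ((1 : ℂ) ⊗ₜ[ℝ] a + Complex.I ⊗ₜ[ℝ] b) =
      (dHomL E EC ι (leftTrivL p.1 a.1) + Complex.I • dHomL E EC ι (leftTrivL p.1 b.1),
        dHomL E EC ι a.2 + Complex.I • dHomL E EC ι b.2) := complexLift_tmul_add _ a b
  have h' := (congrArg (fun W : EC × EC => W.1 + slope hι u F p.2 z W.2) h).trans
    (logSlope_add_I_smul hι u F z p a b)
  rw [hA, hB] at h'
  exact iff_of_eq (congrArg (· = 0) h')

theorem isHolomorphicFamily_contDist (p : CotG E G) :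
    IsHolomorphicFamily fun z => contDist hι u F z p :=
  isHolomorphicFamily_graph (hι.trivEquivC p) (slope hι u F p.2) (analyticAt_slope hι u F p.2) _
    fun z w => mem_contDist_iff hι u F z p w

variable {u}

/-- `T` is right translation by `A(p)` after conjugation by `ι x`, both holomorphic. Complex-linear
equations for `DA` can therefore be tested on the translated derivative. -/
theorem exists_modelDeriv_mapA (hu : Differentiable ℝ u)
    (hF : ∀ U V, adL E G (F U) (F V) = 0) (z w : ℂ) (p : CotG E G) :
    ∃ T : EC →ₗ[ℂ] EC, Function.Injective T ∧
      ∀ v, modelDeriv (cotModel E G) 𝓘(ℝ, EC) (mapA EC ι u F z w) p v =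
        T (logSlope hι u F (z, w) p v) := by
  have h := (hasRightLogDerivAt_mapA hι F hu hF z w p).hasModelDerivAt.modelDeriv_eq
  refine ⟨{ toFun := fun W => modelDeriv 𝓘(ℝ, EC) 𝓘(ℝ, EC)
              (fun x : GC => x * mapA EC ι u F z w p) 1 (conjDeriv (ι p.1) W)
            map_add' := fun W W' => by rw [map_add, map_add]
            map_smul' := fun c W => by
              rw [conjDeriv_smul_complex, modelDeriv_mul_right_smul_complex]; rfl },
    fun W W' hW => injective_conjDeriv _ (injective_modelDeriv_mul_right _ hW), fun v => ?_⟩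
  rw [h]
  rfl

theorem pullbackT10_mapA (hu : Differentiable ℝ u)
    (hF : ∀ U V, adL E G (F U) (F V) = 0) (z w : ℂ) :
    pullbackT10 EC (mapA EC ι u F z w) = contDist hι u F (conj z, conj w) := by
  funext p
  obtain ⟨T, hT, hd⟩ := exists_modelDeriv_mapA hι F hu hF z w p
  ext x
  obtain ⟨a, b, rfl⟩ := exists_eq_tmul_add x
  rw [tmul_add_mem_contDist_iff hι u F _ p a b (conj_logSlope hι u F z w p a).symm
    (conj_logSlope hι u F z w p b).symm]
  set D : TCotG E G p →ₗ[ℝ] RTan EC (mapA EC ι u F z w p) :=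
    (mfderiv (cotModel E G) 𝓘(ℝ, EC) (mapA EC ι u F z w) p).toLinearMap with hD
  have hDv : ∀ v, D v = T (logSlope hι u F (z, w) p v) := hd
  have h1 : (1 : ℂ) ⊗ₜ[ℝ] a + Complex.I ⊗ₜ[ℝ] b ∈ pullbackT10 EC (mapA EC ι u F z w) p ↔
      (cmul (EC := EC) Complex.I (mapA EC ι u F z w p)).baseChange ℂ
        (D.baseChange ℂ ((1 : ℂ) ⊗ₜ[ℝ] a + Complex.I ⊗ₜ[ℝ] b)) =
      Complex.I • D.baseChange ℂ ((1 : ℂ) ⊗ₜ[ℝ] a + Complex.I ⊗ₜ[ℝ] b) :=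
    Module.End.mem_eigenspace_iff
  rw [h1, baseChange_tmul_add, baseChange_tmul_add, I_smul_tmul_add, tmul_add_tmul_inj, hDv, hDv]
  -- The eigenvalue equation says `A = i B`. Conjugation reverses the sign of `i`, which gives the
  -- defining equation of `contDist` at the conjugate parameters.
  suffices key : ∀ A B : EC, (Complex.I • T A = -T B ∧ Complex.I • T B = T A) ↔
      hι.isComplexForm.conj A + Complex.I • hι.isComplexForm.conj B = 0 from key _ _
  intro A B
  have hn : Complex.I • hι.isComplexForm.conj B = -hι.isComplexForm.conj (Complex.I • B) := by
    rw [hι.isComplexForm.conj_I_smul, neg_neg]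
  rw [← map_smul, ← map_smul, ← map_neg, hT.eq_iff, hT.eq_iff, hn, ← sub_eq_add_neg, sub_eq_zero,
    hι.isComplexForm.conj_injective.eq_iff]
  constructor
  · exact fun h => h.2.symm
  · rintro rfl
    rw [smul_smul, Complex.I_mul_I, neg_one_smul]
    exact ⟨rfl, rfl⟩

/-- The pull-back of the vertical distribution by the real flows. -/
theorem isPushforward_gradFlow (hu : Differentiable ℝ u) (hF : ∀ U V, adL E G (F U) (F V) = 0)
    (huAd : ∀ (g : G) y, u (AdL E g y) = AdL E g (u y)) (hiu : IsFlowInvariant u)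
    (hiF : IsFlowInvariant F) (t s : ℝ) :
    IsPushforward (gradFlow F (-s) ∘ gradFlow u (-t)) (vertical E G)
      (contDist hι u F ((t : ℂ), (s : ℂ))) := by
  intro p
  have hFd : Differentiable ℝ F := (LinearMap.toContinuousLinearMap F).differentiable
  set φ : CotG E G → CotG E G := gradFlow F (-s) ∘ gradFlow u (-t) with hφ
  -- `ψ` is the inverse of `φ`, so the push-forward by `φ` consists of the vectors that `Dψ` makes
  -- vertical.
  set ψ : CotG E G → CotG E G := gradFlow u t ∘ gradFlow F s with hψ
  have hψφ : ∀ q, ψ (φ q) = q := fun q => by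
    simp only [hφ, hψ, Function.comp_apply]
    rw [gradFlow_add hiF, add_neg_cancel, gradFlow_zero, gradFlow_add hiu, add_neg_cancel,
      gradFlow_zero]
  have hφψ : ∀ q, φ (ψ q) = q := fun q => by
    simp only [hφ, hψ, Function.comp_apply]
    rw [gradFlow_add hiu, neg_add_cancel, gradFlow_zero, gradFlow_add hiF, neg_add_cancel,
      gradFlow_zero]
  have hφd : HasModelDerivAt (cotModel E G) (cotModel E G) φ p _ :=
    MDifferentiableAt.hasModelDerivAt ((mdifferentiableAt_gradFlow hFd (-s) _).comp p
      (mdifferentiableAt_gradFlow hu (-t) p))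
  have hψd : HasModelDerivAt (cotModel E G) (cotModel E G) ψ (φ p) _ :=
    MDifferentiableAt.hasModelDerivAt ((mdifferentiableAt_gradFlow hu t _).comp (φ p)
      (mdifferentiableAt_gradFlow hFd s (φ p)))
  set dφ : E × LieAlg E G →L[ℝ] E × LieAlg E G := modelDeriv (cotModel E G) (cotModel E G) φ p
  set dψ : E × LieAlg E G →L[ℝ] E × LieAlg E G := modelDeriv (cotModel E G) (cotModel E G) ψ (φ p)
  have h1 : dψ.comp dφ = ContinuousLinearMap.id ℝ _ :=
    (hψd.comp hφd rfl).unique ((HasModelDerivAt.id p).congr_fun hψφ)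
  have h2 : dφ.comp dψ = ContinuousLinearMap.id ℝ _ :=
    (hφd.comp hψd (hψφ p)).unique ((HasModelDerivAt.id (φ p)).congr_fun hφψ)
  let e : TCotG E G p ≃ₗ[ℝ] TCotG E G (φ p) :=
    ({ dφ.toLinearMap with
        invFun := dψ
        left_inv := fun v => congrArg (fun L : E × LieAlg E G →L[ℝ] E × LieAlg E G => L v) h1
        right_inv := fun v => congrArg (fun L : E × LieAlg E G →L[ℝ] E × LieAlg E G => L v) h2 } :
      (E × LieAlg E G) ≃ₗ[ℝ] (E × LieAlg E G))
  have hA : ∀ q, ι (ψ q).1 = mapA EC ι u F t s q := fun q => by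
    rw [mapA_eq]
    simp only [hψ, Function.comp_apply, gradFlow_comp_fst huAd, map_mul, hι.map_expG, map_smul]
    rfl
  obtain ⟨T, hT, hd⟩ := exists_modelDeriv_mapA hι F hu hF t s (φ p)
  have hιd := (hι.hasRightLogDerivAt p.1).hasModelDerivAt
  have h3 := ((hιd.comp (HasModelDerivAt.fst (J' := 𝓘(ℝ, LieAlg E G)) p) rfl).comp hψd
    (hψφ p)).congr_fun (fun q => (hA q).symm)
  -- Compare the derivative of `A_{t,s}` with that of `ι ∘ π ∘ ψ`. Apart from the first component of
  -- `Dψ`, only injective linear maps occur.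
  have hker : ∀ v, logSlope hι u F ((t : ℂ), (s : ℂ)) (φ p) v = 0 ↔ (dψ v).1 = 0 := fun v => by
    have h4 : T (logSlope hι u F ((t : ℂ), (s : ℂ)) (φ p) v) =
        modelDeriv 𝓘(ℝ, EC) 𝓘(ℝ, EC) (fun x : GC => x * ι p.1) 1
          (conjDeriv (ι p.1) (dHomL E EC ι (leftTrivL p.1 (dψ v).1))) :=
      (hd v).symm.trans (congrArg (fun L : E × LieAlg E G →L[ℝ] EC => L v) h3.modelDeriv_eq)
    constructor
    · intro h
      rw [h, map_zero] at h4
      have h5 := injective_conjDeriv _ (injective_modelDeriv_mul_right _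
        ((h4.symm.trans (map_zero _).symm).trans (congrArg _ (map_zero _).symm)))
      have h6 : leftTrivL p.1 (dψ v).1 = 0 :=
        hι.isComplexForm.injective (h5.trans (map_zero (dHomL E EC ι)).symm)
      rw [← leftPush_leftTrivL p.1 (dψ v).1, h6, map_zero]
    · intro h
      rw [h, map_zero, map_zero, map_zero, map_zero] at h4
      exact hT (h4.trans (map_zero T).symm)
  ext x
  obtain ⟨a, b, rfl⟩ := exists_eq_tmul_add x
  have hmap := mem_map_baseChange_iff e (vertical E G p) a b
  refine Iff.trans ?_ hmap.symm
  have hvert : ∀ a b : TCotG E G p, (1 : ℂ) ⊗ₜ[ℝ] a + Complex.I ⊗ₜ[ℝ] b ∈ vertical E G p ↔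
      a.1 = 0 ∧ b.1 = 0 := fun a b => by
    have h5 := (HasModelDerivAt.fst (J := 𝓘(ℝ, E)) (J' := 𝓘(ℝ, LieAlg E G)) p).modelDeriv_eq
    have h6 : ∀ v : E × LieAlg E G,
        modelDeriv (cotModel E G) 𝓘(ℝ, E) (Prod.fst : CotG E G → G) p v = v.1 := fun v =>
      congrArg (fun L : E × LieAlg E G →L[ℝ] E => L v) h5
    exact (mem_ker_baseChange_iff _ a b).trans
      (and_congr (iff_of_eq (congrArg (· = 0) (h6 a))) (iff_of_eq (congrArg (· = 0) (h6 b))))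
  -- For real parameters the translated derivative takes values in `𝔤`, so its complex kernel splits
  -- into real and imaginary parts.
  have hreal : ∀ v, hι.isComplexForm.conj (logSlope hι u F ((t : ℂ), (s : ℂ)) (φ p) v) =
      logSlope hι u F ((t : ℂ), (s : ℂ)) (φ p) v := fun v => by
    rw [conj_logSlope, Complex.conj_ofReal, Complex.conj_ofReal]
  exact (((tmul_add_mem_contDist_iff hι u F _ (φ p) a b rfl rfl).trans
    (hι.isComplexForm.add_I_smul_eq_zero_iff (hreal a) (hreal b))).trans
    (and_congr (hker a) (hker b))).trans (hvert (e.symm a) (e.symm b)).symm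

end Distribution

/-! ### Constancy of `u_h` and `F` along their flows. -/

section FlowInvariance

variable {E : Type*} [NormedAddCommGroup E] [NormedSpace ℝ E] [FiniteDimensional ℝ E]
  {G : Type*} [TopologicalSpace G] [ChartedSpace E G] [Group G] [LieGroup 𝓘(ℝ, E) ∞ G] [T2Space G]
  {B : LinearMap.BilinForm ℝ (LieAlg E G)}

theorem IsInvariantConvex.isFlowInvariant_gradient (hB : IsAdInvariantInner B)
    {h : LieAlg E G → ℝ} (hh : IsInvariantConvex h) : IsFlowInvariant (gradient hB h) := by
  have : CompleteSpace (LieAlg E G) := FiniteDimensional.complete ℝ _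
  intro t y
  have h1 : AdL E (expG (t • gradient hB h y)) y = y := by
    rw [AdL_expG]
    refine exp_apply_of_apply_eq_zero ?_
    rw [adL_swap, map_smul, hh.adL_gradient hB, smul_zero, neg_zero]
  rw [h1]

theorem IsTorusForm.isFlowInvariant (hB : IsAdInvariantInner B)
    {𝔱 : LieSubalgebra ℝ (LieAlg E G)} (h𝔱 : 𝔱.IsCartanSubalgebra)
    {F : LieAlg E G →ₗ[ℝ] LieAlg E G} (hF : IsTorusForm B 𝔱.toSubmodule F) :
    IsFlowInvariant F := fun t y => by
  have := hF.apply_exp hB h𝔱 (t • y) y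
  rwa [map_smul] at this

theorem IsTorusForm.hasFDerivAt_quadratic (hB : IsAdInvariantInner B)
    {𝔱 : Submodule ℝ (LieAlg E G)} {F : LieAlg E G →ₗ[ℝ] LieAlg E G} (hF : IsTorusForm B 𝔱 F)
    (y : LieAlg E G) :
    HasFDerivAt (fun y => (1 / 2 : ℝ) * B y (F y)) (contBilin B (F y)) y := by
  have h1 := ((contBilin B).hasFDerivAt_of_bilinear (hasFDerivAt_id (𝕜 := ℝ) y)
    (LinearMap.toContinuousLinearMap F).hasFDerivAt).const_mul (1 / 2 : ℝ)
  refine h1.congr_fderiv ?_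
  ext A
  change (1 / 2 : ℝ) * (B y (F A) + B A (F y)) = B (F y) A
  rw [← hF.self_adjoint, hB.symm A]
  ring

end FlowInvariance

/-! ### Uniqueness of the continuations. -/

section Uniqueness

variable {E : Type*} [NormedAddCommGroup E] [NormedSpace ℝ E] [FiniteDimensional ℝ E]
  {G : Type*} [TopologicalSpace G] [ChartedSpace E G] [Group G] [LieGroup 𝓘(ℝ, E) ∞ G] [T2Space G]
  {EC : Type*} [NormedAddCommGroup EC] [NormedSpace ℂ EC] [FiniteDimensional ℂ EC]
  {GC : Type*} [TopologicalSpace GC] [ChartedSpace EC GC] [Group GC] [T2Space GC]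
  [LieGroup 𝓘(ℂ, EC) ω GC] [LieGroup 𝓘(ℝ, EC) ∞ GC]
  {ι : G →* GC} (hι : IsComplexification EC E ι)
  (u : LieAlg E G → LieAlg E G) (F : LieAlg E G →ₗ[ℝ] LieAlg E G)

theorem IsPushforward.unique {φ : CotG E G → CotG E G} (hφ : Function.Surjective φ)
    {P Q Q' : ComplexDistribution E G} (h : IsPushforward φ P Q) (h' : IsPushforward φ P Q') :
    Q = Q' := by
  funext q
  obtain ⟨p, rfl⟩ := hφ q
  rw [h, h']

/-- A family of distributions, holomorphic along an entire holomorphic curve of parameters, is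
determined by its values at real times. -/
theorem eq_contDist_of_eq_on_real (γ : ℂ → ℂ × ℂ) (hγ : ∀ z, AnalyticAt ℂ γ z)
    {Q : ℂ → ComplexDistribution E G} (hQ : ∀ p, IsHolomorphicFamily fun z => Q z p)
    (h : ∀ s : ℝ, Q s = contDist hι u F (γ s)) (z : ℂ) : Q z = contDist hι u F (γ z) := by
  funext p
  have : FiniteDimensional ℂ (ℂ ⊗[ℝ] TCotG E G p) :=
    Module.Finite.equiv (hι.trivEquivC p).symm
  exact eq_of_eq_on_real (hι.trivEquivC p) (fun z => slope hι u F p.2 (γ z))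
    (fun z => (analyticAt_slope hι u F p.2 (γ z)).comp (hγ z))
    (fun z => contDist hι u F (γ z) p) (fun z w => mem_contDist_iff hι u F (γ z) p w) (hQ p)
    (fun s => congrFun (h s) p) z

/-- The one-variable identity theorem is applied twice: in the second parameter for each real first
parameter, then in the first for each complex second parameter. -/
theorem eq_contDist_of_eq_on_real_prod {P : ℂ × ℂ → ComplexDistribution E G}
    (hP : ∀ p, IsHolomorphicFamily fun z => P z p)
    (h : ∀ t s : ℝ, P ((t : ℂ), (s : ℂ)) = contDist hι u F ((t : ℂ), (s : ℂ))) :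
    P = contDist hι u F := by
  have h1 : ∀ (t : ℝ) (w : ℂ), P ((t : ℂ), w) = contDist hι u F ((t : ℂ), w) := fun t =>
    eq_contDist_of_eq_on_real hι u F (fun w => ((t : ℂ), w))
      (fun w => analyticAt_const.prod analyticAt_id)
      (fun p => (hP p).comp fun w => analyticAt_const.prod analyticAt_id) (h t)
  funext ⟨z, w⟩
  exact eq_contDist_of_eq_on_real hι u F (fun z => (z, w))
    (fun z => analyticAt_id.prod analyticAt_const)
    (Q := fun z => P (z, w))
    (fun p => (hP p).comp fun z => analyticAt_id.prod analyticAt_const) (fun t => h1 t w) z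

end Uniqueness

end CotangentPolarization

end

/-! ### The main theorem. -/

open CotangentPolarization in
theorem mainTheorem4
    {E : Type*} [NormedAddCommGroup E] [NormedSpace ℝ E] [FiniteDimensional ℝ E]
    {G : Type*} [TopologicalSpace G] [ChartedSpace E G] [Group G] [LieGroup 𝓘(ℝ, E) ∞ G]
    [T2Space G] [CompactSpace G] [ConnectedSpace G]
    {EC : Type*} [NormedAddCommGroup EC] [NormedSpace ℂ EC] [FiniteDimensional ℂ EC]
    {GC : Type*} [TopologicalSpace GC] [ChartedSpace EC GC] [Group GC] [T2Space GC]
    (ι : G →* GC) (hι : IsComplexification EC E ι)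
    (B : LinearMap.BilinForm ℝ (LieAlg E G)) (hB : IsAdInvariantInner B)
    (h : LieAlg E G → ℝ) (hh : IsInvariantConvex h)
    (𝔱 : LieSubalgebra ℝ (LieAlg E G)) (h𝔱 : 𝔱.IsCartanSubalgebra)
    (F : LieAlg E G →ₗ[ℝ] LieAlg E G) (hF : IsTorusForm B 𝔱.toSubmodule F) :
    ∃ φh φf : ℝ → CotG E G → CotG E G,
      IsHamiltonianFlow B (fun p => h p.2) φh ∧
      IsHamiltonianFlow B (fun p => (1 / 2 : ℝ) * B p.2 (F p.2)) φf ∧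
      ∃ P : ℂ × ℂ → ComplexDistribution E G,
        ContinuesFlow φh φf P ∧ (∀ P', ContinuesFlow φh φf P' → P' = P) ∧
        ∀ τ : ℂ, 0 < τ.im →
          ∃ Q : ℂ → ComplexDistribution E G,
            ContinuesPullback EC ι (gradient hB h) F τ Q ∧
            (∀ Q', ContinuesPullback EC ι (gradient hB h) F τ Q' → Q' = Q) ∧
            ∀ σ : ℂ, 0 ≤ σ.im →
              Q (starRingEnd ℂ σ) = P (starRingEnd ℂ τ, starRingEnd ℂ σ) := by
  have := hι.lie_group
  have : LieGroup 𝓘(ℝ, EC) ∞ GC := lieGroup_real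
  have hu := hh.differentiable_gradient hB
  have hFF : ∀ U V, adL E G (F U) (F V) = 0 := fun U V =>
    hB.cartan_abelian h𝔱 (hF.image_subset U) (hF.image_subset V)
  have hiu := hh.isFlowInvariant_gradient hB
  have hiF := hF.isFlowInvariant hB h𝔱
  have hpush := isPushforward_gradFlow hι F hu hFF (hh.gradient_AdL hB) hiu hiF
  have hpull := fun τ => pullbackT10_mapA hι F hu hFF τ
  set u := gradient hB h
  refine ⟨gradFlow u, gradFlow F, ?_, ?_, contDist hι u F,
    ⟨isHolomorphicFamily_contDist hι u F, hpush⟩, fun P' hP' => ?_, fun τ _ => ?_⟩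
  · exact isHamiltonianFlow_gradFlow hB hiu
      (fun y => (hh.smooth.differentiable (by simp) y).hasFDerivAt)
      fun y A => (hB.gradient_apply h y A).symm
  · exact isHamiltonianFlow_gradFlow hB hiF (hF.hasFDerivAt_quadratic hB) fun _ _ => rfl
  -- A push-forward determines the distribution at every point because the composed flow is onto,
  -- with the opposite flows supplying preimages.
  · refine eq_contDist_of_eq_on_real_prod hι u F hP'.1 fun t s =>
      (hP'.2 t s).unique (fun q => ⟨gradFlow u t (gradFlow F s q), ?_⟩) (hpush t s)
    rw [Function.comp_apply, gradFlow_add hiu, neg_add_cancel, gradFlow_zero, gradFlow_add hiF,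
      neg_add_cancel, gradFlow_zero]
  · have hγ : ∀ z : ℂ, AnalyticAt ℂ (fun z : ℂ => (starRingEnd ℂ τ, z)) z := fun z =>
      analyticAt_const.prod analyticAt_id
    have hreal : ∀ s : ℝ, pullbackT10 EC (mapA EC ι u F τ s) =
        contDist hι u F (starRingEnd ℂ τ, (s : ℂ)) := fun s => by
      rw [hpull, Complex.conj_ofReal]
    -- The continuation is the restriction of the two-parameter family to the line with first
    -- coordinate `τ̄`, so the comparison with `P` holds by definition.
    refine ⟨fun z => contDist hι u F (starRingEnd ℂ τ, z),
      ⟨fun p => (isHolomorphicFamily_contDist hι u F p).comp hγ, fun s => (hreal s).symm⟩,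
      fun Q' hQ' => funext fun z => eq_contDist_of_eq_on_real hι u F
        (fun z => (starRingEnd ℂ τ, z)) hγ hQ'.1 (fun s => (hQ'.2 s).trans (hreal s)) z,
      fun σ _ => rfl⟩
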